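/- **Setting.** Let $\bar M$ be a smooth compact $(n+1)$-dimensional manifold with boundary, $n\ge 1$, with interior $M$, and let $\rho:\bar M\to[0,\infty)$ be a smooth defining function: $\rho^{-1}(0)=\partial M$ and $d\rho\ne 0$ on $\partial M$. Fix a smooth Riemannian metric $\bar h$ on $\bar M$ with $|d\rho|_{\bar h}=1$ along $\partial M$, and let $\bar\nabla$ be its Levi-Civita connection. The *weight* $r$ of a tensor field is its covariant rank minus its contravariant rank. *Hölder spaces.* Let $B_s$ be the ball of radius $s$ centered at $(0,1)$ in the hyperbolic upper half-space $\{(x,y): x\in\mathbb R^n,\ y>0\}$. Fix finitely many smooth charts $\Theta=(\theta,\rho)$ of $\bar M$ having $\rho$ as last coordinate, each with a compact subset of its domain. A Möbius parametrization $\Phi:B_2\to M$ is a map $\Phi(x,y)=\Theta^{-1}(\theta_0+\rho_0x,\rho_0y)$, $\rho_0>0$, with image in the chosen compact subset for one of these charts. Fix countably many Möbius parametrizations and finitely many further maps $B_2\to M$, each the restriction of a smooth parametrization of an open subset of $M$ by a neighborhood of $\overline{B_2}$. Call all these maps $\Phi_i$; assume that the sets $\Phi_i(B_1)$ cover $M$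 and that the sets $\Phi_i(B_2)$ are uniformly locally finite. For $k\in\mathbb N_0$, $\alpha\in[0,1)$, $\delta\in\mathbb R$, let $C^{k,\alpha}_\delta(M)$ be the space of $C^k$ tensor fields $u$ on $M$ (of a given type) with $$\|u\|_{C^{k,\alpha}_\delta(M)}=\sup_i\|\Phi_i^*(\rho^{-\delta}u)\|_{C^{k,\alpha}(B_2)}<\infty .$$ *The spaces $\mathscr C^{k,\alpha;m}(M)$.* For $0\le m\le k$ and $\alpha\in[0,1)$, a tensor field $u$ of weight $r$ is in $\mathscr C^{k,\alpha;m}(M)$ if $\mathcal L_{X_1}\cdots\mathcal L_{X_j}u\in C^{k-j,\alpha}_r(M)$ for all $0\le j\le m$ and all vector fields $X_1,\dots,X_j$ smooth on $\bar M$. Put $$|\!|\!|u|\!|\!|_{k,\alpha;m}=\sum_{j=0}^m\|\bar\nabla^ju\|_{C^{k-j,\alpha}_{r+j}(M)}.$$ **Theorem.** Let $0\le m\le l$ and $\beta\in[0,1)$, and consider tensor fields of a fixed type, of weight $r$. There is a linear map $\tau\mapsto\widetilde\tau$ such that for every $\tau\in\mathscr C^{l,\beta;m}(M)$ of this type: 1.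 $\widetilde\tau\in\mathscr C^{k,\alpha;m}(M)$ for all $k\ge m$ and all $0\le\alpha<1$; 2. $\widetilde\tau-\tau\in C^{l,\beta}_{r+m}(M)$. Moreover, for each $k\ge m$ and $0\le\alpha<1$ there is a constant $C$, independent of $\tau$, such that $$|\!|\!|\widetilde\tau|\!|\!|_{k,\alpha;m}\le C\,|\!|\!|\tau|\!|\!|_{l,\beta;m}\qquad\text{for all such }\tau .$$ -/

import Mathlib

open scoped Manifold ContDiff NNReal
open scoped ENNReal

noncomputable section

namespace WAH

/-- The model vector space `ℝ^{n+1}`. Coordinate `0` is the one that is nonnegative on the model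
half-space; it plays the role of `ρ` (or `y`), and coordinates `1, …, n` play the role of `θ`
(or `x`). -/
abbrev EE (n : ℕ) := EuclideanSpace ℝ (Fin (n + 1))

/-- Purely contravariant tensors of rank `b` on `ℝ^{n+1}`: multilinear functions of `b` covectors,
with the operator norm. -/
def ContraTensor (n b : ℕ) := (EE n →L[ℝ] ℝ) [×b]→L[ℝ] ℝ

instance (n b : ℕ) : NormedAddCommGroup (ContraTensor n b) :=
  inferInstanceAs (NormedAddCommGroup ((EE n →L[ℝ] ℝ) [×b]→L[ℝ] ℝ))

instance (n b : ℕ) : NormedSpace ℝ (ContraTensor n b) :=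
  inferInstanceAs (NormedSpace ℝ ((EE n →L[ℝ] ℝ) [×b]→L[ℝ] ℝ))

instance (n b : ℕ) : CompleteSpace (ContraTensor n b) :=
  inferInstanceAs (CompleteSpace ((EE n →L[ℝ] ℝ) [×b]→L[ℝ] ℝ))

instance (n b : ℕ) : CoeFun (ContraTensor n b) (fun _ => (Fin b → (EE n →L[ℝ] ℝ)) → ℝ) :=
  ⟨fun T => DFunLike.coe (F := (EE n →L[ℝ] ℝ) [×b]→L[ℝ] ℝ) T⟩

@[ext] lemma ContraTensor.ext {n b : ℕ} {S T : ContraTensor n b} (h : ∀ φ, S φ = T φ) : S = T :=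
  ContinuousMultilinearMap.ext h

@[simp] lemma ContraTensor.add_apply {n b : ℕ} (S T : ContraTensor n b)
    (φ : Fin b → (EE n →L[ℝ] ℝ)) : (S + T) φ = S φ + T φ := rfl

@[simp] lemma ContraTensor.sub_apply {n b : ℕ} (S T : ContraTensor n b)
    (φ : Fin b → (EE n →L[ℝ] ℝ)) : (S - T) φ = S φ - T φ := rfl

@[simp] lemma ContraTensor.smul_apply {n b : ℕ} (c : ℝ) (T : ContraTensor n b)
    (φ : Fin b → (EE n →L[ℝ] ℝ)) : (c • T) φ = c * T φ := rfl

@[simp] lemma ContraTensor.sum_apply {n b : ℕ} {ι : Type*} (s : Finset ι)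
    (T : ι → ContraTensor n b) (φ : Fin b → (EE n →L[ℝ] ℝ)) :
    (∑ i ∈ s, T i) φ = ∑ i ∈ s, T i φ :=
  map_sum (⟨⟨fun S => S φ, rfl⟩, fun _ _ => rfl⟩ : ContraTensor n b →+ ℝ) T s

/-- Transformation of the arguments: `T ↦ (φ ↦ T (L₁ φ₁, …, L_b φ_b))`. -/
def ContraTensor.compL {n b : ℕ} (L : Fin b → ((EE n →L[ℝ] ℝ) →L[ℝ] (EE n →L[ℝ] ℝ))) :
    ContraTensor n b →L[ℝ] ContraTensor n b :=
  ContinuousMultilinearMap.compContinuousLinearMapL (F := ℝ) L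

@[simp] lemma ContraTensor.compL_apply {n b : ℕ}
    (L : Fin b → ((EE n →L[ℝ] ℝ) →L[ℝ] (EE n →L[ℝ] ℝ))) (T : ContraTensor n b)
    (φ : Fin b → (EE n →L[ℝ] ℝ)) : ContraTensor.compL L T φ = T (fun t => L t (φ t)) := rfl

lemma ContraTensor.map_update_add {n b : ℕ} (T : ContraTensor n b)
    (φ : Fin b → (EE n →L[ℝ] ℝ)) (t : Fin b) (x y : EE n →L[ℝ] ℝ) :
    T (Function.update φ t (x + y)) = T (Function.update φ t x) + T (Function.update φ t y) :=
  ContinuousMultilinearMap.map_update_add (T : (EE n →L[ℝ] ℝ) [×b]→L[ℝ] ℝ) φ t x y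

lemma ContraTensor.map_update_smul {n b : ℕ} (T : ContraTensor n b)
    (φ : Fin b → (EE n →L[ℝ] ℝ)) (t : Fin b) (c : ℝ) (x : EE n →L[ℝ] ℝ) :
    T (Function.update φ t (c • x)) = c * T (Function.update φ t x) :=
  ContinuousMultilinearMap.map_update_smul (T : (EE n →L[ℝ] ℝ) [×b]→L[ℝ] ℝ) φ t c x

/-- Tensors of type `(a, b)` (covariant rank `a`, contravariant rank `b`) on `ℝ^{n+1}`:
`T v φ` with `a` vector arguments `v` and `b` covector arguments `φ`. -/
abbrev Tensor (n a b : ℕ) := EE n [×a]→L[ℝ] ContraTensor n b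

/-- A tensor field of type `(a, b)`. Recall that in Mathlib `TangentSpace I x` is by definition the
model space, so `u x` is a tensor on `T_x`. Only the values at interior points are ever used: such
a function represents a tensor field on the interior. -/
abbrev TensorField (n : ℕ) (Mb : Type*) (a b : ℕ) := Mb → Tensor n a b

/-- `(pull A B T) v φ = T (A v₁, …, A v_a) (φ₁ ∘ B, …, φ_b ∘ B)`. With `A` invertible and
`B = A⁻¹` this is the pullback of `T` by the linear isomorphism `A`. -/
def Tensor.pull {n a b : ℕ} (A B : EE n →L[ℝ] EE n) (T : Tensor n a b) : Tensor n a b :=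
  (ContraTensor.compL (fun _ => ContinuousLinearMap.precomp ℝ B)).compContinuousMultilinearMap
    (T.compContinuousLinearMap (fun _ => A))

lemma Tensor.pull_apply {n a b : ℕ} (A B : EE n →L[ℝ] EE n) (T : Tensor n a b)
    (v : Fin a → EE n) (φ : Fin b → (EE n →L[ℝ] ℝ)) :
    T.pull A B v φ = T (fun s => A (v s)) (fun t => (φ t).comp B) := rfl

/-- The derivation of the tensor algebra induced by an endomorphism `A`:
`(act A T) v φ = ∑ₛ T (…, A vₛ, …) φ - ∑ₜ T v (…, φₜ ∘ A, …)`. -/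
def Tensor.act {n a b : ℕ} (A : EE n →L[ℝ] EE n) (T : Tensor n a b) : Tensor n a b :=
  (∑ s : Fin a, T.compContinuousLinearMap
      (Function.update (fun _ => ContinuousLinearMap.id ℝ (EE n)) s A)) -
  ∑ t : Fin b, (ContraTensor.compL
      (Function.update (fun _ : Fin b => ContinuousLinearMap.id ℝ (EE n →L[ℝ] ℝ)) t
        (ContinuousLinearMap.precomp ℝ A))).compContinuousMultilinearMap T

lemma Tensor.act_apply {n a b : ℕ} (A : EE n →L[ℝ] EE n) (T : Tensor n a b)
    (v : Fin a → EE n) (φ : Fin b → (EE n →L[ℝ] ℝ)) :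
    T.act A v φ = (∑ s, T (Function.update v s (A (v s))) φ) -
      ∑ t, T v (Function.update φ t ((φ t).comp A)) := by
  have h1 : ∀ s : Fin a, (fun i => (Function.update
      (fun _ => ContinuousLinearMap.id ℝ (EE n)) s A : Fin a → _) i (v i)) =
      Function.update v s (A (v s)) := by
    intro s; ext1 i; by_cases h : i = s
    · subst h; simp
    · simp [h]
  have h2 : ∀ t : Fin b, (fun i => (Function.update
      (fun _ : Fin b => ContinuousLinearMap.id ℝ (EE n →L[ℝ] ℝ)) t
        (ContinuousLinearMap.precomp ℝ A) : Fin b → _) i (φ i)) =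
      Function.update φ t ((φ t).comp A) := by
    intro t; ext1 i; by_cases h : i = t
    · subst h; simp
    · simp [h]
  simp [Tensor.act, h1, h2]

/-- `act` as a linear function of the endomorphism. -/
def Tensor.actL {n a b : ℕ} (T : Tensor n a b) : (EE n →L[ℝ] EE n) →L[ℝ] Tensor n a b :=
  LinearMap.toContinuousLinearMap
    { toFun := fun A => T.act A
      map_add' := by
        intro A B; ext v φ
        simp [Tensor.act_apply, ContinuousLinearMap.comp_add, Finset.sum_add_distrib,
          ContraTensor.map_update_add]
        ring
      map_smul' := by
        intro c A; ext v φ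
        simp [Tensor.act_apply, Finset.mul_sum, mul_sub,
          ContraTensor.map_update_smul] }

@[simp] lemma Tensor.actL_apply {n a b : ℕ} (T : Tensor n a b) (A : EE n →L[ℝ] EE n) :
    T.actL A = T.act A := rfl

section Manifold

variable {n : ℕ} {Mb : Type*} [TopologicalSpace Mb] [ChartedSpace (EuclideanHalfSpace (n + 1)) Mb]

/-- The differential at `z` of a parametrization `Φ` of (a part of) the manifold by `ℝ^{n+1}`. -/
def dParam (Φ : EE n → Mb) (z : EE n) : EE n →L[ℝ] EE n :=
  mfderiv 𝓘(ℝ, EE n) (𝓡∂ (n + 1)) Φ z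

/-- The pullback `Φ^* u` of a tensor field by a (local) parametrization `Φ`. -/
def pullback {a b : ℕ} (Φ : EE n → Mb) (u : TensorField n Mb a b) (z : EE n) : Tensor n a b :=
  (u (Φ z)).pull (dParam Φ z) (dParam Φ z).inverse

/-- The preferred parametrization around `x`: the inverse of the preferred chart. -/
def paramAt (n : ℕ) {Mb : Type*} [TopologicalSpace Mb]
    [ChartedSpace (EuclideanHalfSpace (n + 1)) Mb] (x : Mb) : EE n → Mb :=
  (extChartAt (𝓡∂ (n + 1)) x).symm

/-- The coordinates of `x` in its preferred chart. -/
def coordAt (n : ℕ) {Mb : Type*} [TopologicalSpace Mb]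
    [ChartedSpace (EuclideanHalfSpace (n + 1)) Mb] (x : Mb) : EE n :=
  extChartAt (𝓡∂ (n + 1)) x x

variable (n Mb) in
/-- Smooth vector fields on the manifold with boundary, smooth up to the boundary. -/
abbrev VField [IsManifold (𝓡∂ (n + 1)) ∞ Mb] :=
  Cₛ^∞⟮𝓡∂ (n + 1); EE n, (TangentSpace (𝓡∂ (n + 1)) : Mb → Type _)⟯

/-- The Lie derivative `𝓛_X u` (at interior points), by the usual formula
`(𝓛_X u)_{i…}^{j…} = X^k ∂_k u_{i…}^{j…} + ∑ u_{…k…}^{j…} ∂_i X^k - ∑ u_{i…}^{…k…} ∂_k X^j`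
in the preferred chart around `x`. -/
def lieDeriv [IsManifold (𝓡∂ (n + 1)) ∞ Mb] {a b : ℕ} (X : VField n Mb)
    (u : TensorField n Mb a b) : TensorField n Mb a b := fun x =>
  let Xc : EE n → EE n := fun z =>
    (dParam (paramAt n x) z).inverse (X (paramAt n x z))
  let uc : EE n → Tensor n a b := pullback (paramAt n x) u
  let z := coordAt n x
  fderiv ℝ uc z (Xc z) + (uc z).act (fderiv ℝ Xc z)

/-- Smooth Riemannian metrics on the manifold with boundary, smooth up to the boundary. -/
abbrev Metric (n : ℕ) (Mb : Type*) [TopologicalSpace Mb]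
    [ChartedSpace (EuclideanHalfSpace (n + 1)) Mb] [IsManifold (𝓡∂ (n + 1)) ∞ Mb] :=
  Bundle.ContMDiffRiemannianMetric (𝓡∂ (n + 1)) ∞ (EE n)
    (fun x : Mb => TangentSpace (𝓡∂ (n + 1)) x)

/-- The inner product given by the metric on the tangent space at `x`. -/
def Metric.at [IsManifold (𝓡∂ (n + 1)) ∞ Mb] (h : Metric n Mb) (x : Mb) :
    EE n →L[ℝ] EE n →L[ℝ] ℝ := h.inner x

/-- The coefficients `h_{ij}` of the metric in a parametrization. -/
def Metric.coeff [IsManifold (𝓡∂ (n + 1)) ∞ Mb] (h : Metric n Mb) (Φ : EE n → Mb) (z : EE n) :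
    EE n →L[ℝ] EE n →L[ℝ] ℝ :=
  (h.at (Φ z)).bilinearComp (dParam Φ z) (dParam Φ z)

/-- The Christoffel symbols of the Levi-Civita connection in a parametrization: with
`G = (h_{ij})`, `Γ v w` is the vector such that for all `y`
`2 G(Γ v w, y) = (D_v G)(w, y) + (D_w G)(v, y) - (D_y G)(v, w)`. -/
def Metric.christoffel [IsManifold (𝓡∂ (n + 1)) ∞ Mb] (h : Metric n Mb) (Φ : EE n → Mb)
    (z : EE n) : EE n →L[ℝ] EE n →L[ℝ] EE n :=
  let DG : EE n →L[ℝ] EE n →L[ℝ] EE n →L[ℝ] ℝ := fderiv ℝ (h.coeff Φ) z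
  LinearMap.toContinuousLinearMap
    { toFun := fun v => (h.coeff Φ z).inverse.comp
        ((1 / 2 : ℝ) • (DG v + DG.flip v - (DG.flip v).flip))
      map_add' := by
        intro v w
        rw [← ContinuousLinearMap.comp_add]
        congr 1; ext y t; simp; ring
      map_smul' := by
        intro c v
        rw [RingHom.id_apply, ← ContinuousLinearMap.comp_smul, smul_comm c]
        congr 2; ext y t; simp [mul_add, mul_sub] }

/-- The covariant derivative `∇u` (at interior points) of a tensor field of type `(a, b)` with
respect to the Levi-Civita connection; a tensor field of type `(a + 1, b)` whose first argument is
the direction of differentiation: in the preferred chart around `x`,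
`∇_v u = D_v u - ∑ u(…, Γ(v, wₛ), …; φ) + ∑ u(w; …, φₜ ∘ Γ(v, ·), …)`. -/
def covDeriv [IsManifold (𝓡∂ (n + 1)) ∞ Mb] (h : Metric n Mb) {a b : ℕ}
    (u : TensorField n Mb a b) : TensorField n Mb (a + 1) b := fun x =>
  let uc : EE n → Tensor n a b := pullback (paramAt n x) u
  let z := coordAt n x
  ContinuousLinearMap.uncurryLeft
    (fderiv ℝ uc z - (uc z).actL.comp (h.christoffel (paramAt n x) z))

/-- The iterated covariant derivative `∇^j u`. -/
def covDerivIter [IsManifold (𝓡∂ (n + 1)) ∞ Mb] (h : Metric n Mb) {a b : ℕ}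
    (u : TensorField n Mb a b) : (j : ℕ) → TensorField n Mb (a + j) b
  | 0 => u
  | j + 1 => covDeriv h (covDerivIter h u j)

end Manifold

/-! ### The hyperbolic half-space, Möbius parametrizations and Hölder norms -/

/-- The point `(0, …, 0, 1)` of the half-space (with our ordering of the coordinates). -/
def basePt (n : ℕ) : EE n := EuclideanSpace.single 0 1

/-- The hyperbolic distance of the upper half-space model. -/
def hypDist {n : ℕ} (z w : EE n) : ℝ :=
  2 * Real.arsinh (dist z w / (2 * √(z 0 * w 0)))

/-- The hyperbolic ball of radius `r` around the base point. -/
def hypBall (n : ℕ) (r : ℝ) : Set (EE n) := {z | 0 < z 0 ∧ hypDist z (basePt n) < r}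

/-- The closed hyperbolic ball of radius `r` around the base point. -/
def hypClosedBall (n : ℕ) (r : ℝ) : Set (EE n) := {z | 0 < z 0 ∧ hypDist z (basePt n) ≤ r}

/-- For `p = (θ₀, ρ₀)`, the map `(x, y) ↦ (θ₀ + ρ₀ x, ρ₀ y)`. -/
def mobius {n : ℕ} (p z : EE n) : EE n := p + p 0 • (z - basePt n)

lemma mobius_zero {n : ℕ} (p z : EE n) : mobius p z 0 = p 0 * z 0 := by
  simp [mobius, basePt]; ring

lemma mobius_ne {n : ℕ} (p z : EE n) (j : Fin (n + 1)) (hj : j ≠ 0) :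
    mobius p z j = p j + p 0 * z j := by
  simp [mobius, basePt, hj]

/-- The `C^{k,α}` norm on a set `B` of a function on `ℝ^{n+1}`, where `0 ≤ α < 1`. -/
def holderNormOn {n : ℕ} {F : Type*} [NormedAddCommGroup F] [NormedSpace ℝ F]
    (B : Set (EE n)) (k : ℕ) (α : ℝ) (f : EE n → F) : ℝ≥0∞ :=
  (∑ j ∈ Finset.range (k + 1), ⨆ z ∈ B, ‖iteratedFDeriv ℝ j f z‖ₑ) +
  (if α = 0 then 0 else
    ⨆ z ∈ B, ⨆ w ∈ B, ‖iteratedFDeriv ℝ k f z - iteratedFDeriv ℝ k f w‖ₑ / edist z w ^ α)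

variable {n : ℕ} {Mb : Type*} [TopologicalSpace Mb]
  [ChartedSpace (EuclideanHalfSpace (n + 1)) Mb]

/-- `ρ` is a defining function: smooth, nonnegative, vanishing exactly on the boundary, where its
differential does not vanish. -/
structure IsDefiningFunction (n : ℕ) {Mb : Type*} [TopologicalSpace Mb]
    [ChartedSpace (EuclideanHalfSpace (n + 1)) Mb] (ρ : Mb → ℝ) : Prop where
  smooth : ContMDiff (𝓡∂ (n + 1)) 𝓘(ℝ, ℝ) ∞ ρ
  nonneg : ∀ x, 0 ≤ ρ x
  eq_zero_iff : ∀ x, ρ x = 0 ↔ x ∈ (𝓡∂ (n + 1)).boundary Mb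
  mfderiv_ne_zero : ∀ x ∈ (𝓡∂ (n + 1)).boundary Mb, mfderiv (𝓡∂ (n + 1)) 𝓘(ℝ, ℝ) ρ x ≠ 0

/-- `|dρ|_h = 1` along the boundary: the `h`-gradient of `ρ` has length one there. -/
def UnitAlongBoundary [IsManifold (𝓡∂ (n + 1)) ∞ Mb] (ρ : Mb → ℝ) (h : Metric n Mb) : Prop :=
  ∀ x ∈ (𝓡∂ (n + 1)).boundary Mb, ∃ N : EE n,
    (∀ v : EE n, h.at x N v = mfderiv (𝓡∂ (n + 1)) 𝓘(ℝ, ℝ) ρ x v) ∧ h.at x N N = 1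

/-- A choice of background coordinates and of a covering of the interior by Möbius
parametrizations.

* `chart c`, for `c` in the finite set `κ`, are the background coordinates: smooth charts
  `Θ = (θ, ρ)` of the manifold with boundary that have `ρ` itself as their distinguished
  coordinate, each with a compact subset `K c` of its domain;
* for `i : ι`, `center i = (θ₀, ρ₀)` are the coordinates of the center of a Möbius parametrization
  `(x, y) ↦ Θ⁻¹ (θ₀ + ρ₀ x, ρ₀ y)` of the hyperbolic ball of radius `2`, with image in `K c`;
* for the finitely many `i : ι₀`, `intChart i` gives a smooth parametrization of a neighborhood of
  the closed hyperbolic ball of radius `2`. -/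
structure MobiusCover (n : ℕ) (Mb : Type*) [TopologicalSpace Mb]
    [ChartedSpace (EuclideanHalfSpace (n + 1)) Mb] (ρ : Mb → ℝ) where
  κ : Type
  finite_κ : Finite κ
  chart : κ → OpenPartialHomeomorph Mb (EuclideanHalfSpace (n + 1))
  chart_mem : ∀ c, chart c ∈ IsManifold.maximalAtlas (𝓡∂ (n + 1)) ∞ Mb
  chart_rho : ∀ c, ∀ p ∈ (chart c).source, (chart c).extend (𝓡∂ (n + 1)) p 0 = ρ p
  K : κ → Set Mb
  K_compact : ∀ c, IsCompact (K c)
  K_subset : ∀ c, K c ⊆ (chart c).source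
  ι : Type
  countable_ι : Countable ι
  idx : ι → κ
  center : ι → EE n
  center_pos : ∀ i, 0 < center i 0
  image_subset : ∀ i, ∀ z ∈ hypBall n 2,
    mobius (center i) z ∈ (chart (idx i)).extend (𝓡∂ (n + 1)) '' K (idx i)
  ι₀ : Type
  finite_ι₀ : Finite ι₀
  intChart : ι₀ → OpenPartialHomeomorph Mb (EuclideanHalfSpace (n + 1))
  intChart_mem : ∀ i, intChart i ∈ IsManifold.maximalAtlas (𝓡∂ (n + 1)) ∞ Mb
  ball_subset : ∀ i, hypClosedBall n 2 ⊆ ((intChart i).extend (𝓡∂ (n + 1))).target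
  /-- the images of the balls of radius `1` cover the interior -/
  cover : ∀ p ∈ (𝓡∂ (n + 1)).interior Mb,
    (∃ i, ∃ z ∈ hypBall n 1,
      ((chart (idx i)).extend (𝓡∂ (n + 1))).symm (mobius (center i) z) = p) ∨
    (∃ i, ∃ z ∈ hypBall n 1, ((intChart i).extend (𝓡∂ (n + 1))).symm z = p)
  /-- the images of the balls of radius `2` are uniformly locally finite -/
  locallyFinite : ∃ N : ℕ, ∀ p ∈ (𝓡∂ (n + 1)).interior Mb,
    {i | ∃ z ∈ hypBall n 2,
      ((chart (idx i)).extend (𝓡∂ (n + 1))).symm (mobius (center i) z) = p}.encard ≤ N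

/-- The parametrizations `Φ_i : B₂ → M` of the covering (only their values on `B₂` matter). -/
def MobiusCover.param {ρ : Mb → ℝ} (𝒜 : MobiusCover n Mb ρ) : 𝒜.ι ⊕ 𝒜.ι₀ → EE n → Mb
  | .inl i => fun z => ((𝒜.chart (𝒜.idx i)).extend (𝓡∂ (n + 1))).symm (mobius (𝒜.center i) z)
  | .inr i => fun z => ((𝒜.intChart i).extend (𝓡∂ (n + 1))).symm z

/-- The coordinate representation `Φ_i^* (ρ^{-δ} u)` on `B₂`. -/
def MobiusCover.rep {ρ : Mb → ℝ} (𝒜 : MobiusCover n Mb ρ) {a b : ℕ} (δ : ℝ)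
    (u : TensorField n Mb a b) (i : 𝒜.ι ⊕ 𝒜.ι₀) : EE n → Tensor n a b :=
  pullback (𝒜.param i) (fun x => (ρ x) ^ (-δ) • u x)

/-- The weighted Hölder norm `‖u‖_{C^{k,α}_δ(M)} = sup_i ‖Φ_i^* (ρ^{-δ} u)‖_{C^{k,α}(B₂)}`. -/
def MobiusCover.holderNorm {ρ : Mb → ℝ} (𝒜 : MobiusCover n Mb ρ) (k : ℕ) (α δ : ℝ) {a b : ℕ}
    (u : TensorField n Mb a b) : ℝ≥0∞ :=
  ⨆ i, holderNormOn (hypBall n 2) k α (𝒜.rep δ u i)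

/-- Membership in the weighted Hölder space `C^{k,α}_δ(M)`. -/
def MobiusCover.MemHolder {ρ : Mb → ℝ} (𝒜 : MobiusCover n Mb ρ) (k : ℕ) (α δ : ℝ) {a b : ℕ}
    (u : TensorField n Mb a b) : Prop :=
  (∀ i, ContDiffOn ℝ k (𝒜.rep δ u i) (hypBall n 2)) ∧ 𝒜.holderNorm k α δ u < ⊤

/-- The weight of a tensor bundle: covariant rank less contravariant rank. -/
def weight (a b : ℕ) : ℝ := (a : ℝ) - (b : ℝ)

/-- Membership in `𝒞^{k,α;m}(M)` (for `m ≤ k`): for all `j ≤ m` and all vector fields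
`X₁, …, X_j` smooth up to the boundary, `𝓛_{X₁} ⋯ 𝓛_{X_j} u ∈ C^{k-j,α}_r(M)`, where `r` is the
weight of `u`. -/
def MobiusCover.MemScriptC [IsManifold (𝓡∂ (n + 1)) ∞ Mb] {ρ : Mb → ℝ} (𝒜 : MobiusCover n Mb ρ)
    (k : ℕ) (α : ℝ) (m : ℕ) {a b : ℕ} (u : TensorField n Mb a b) : Prop :=
  ∀ X : List (VField n Mb), X.length ≤ m →
    𝒜.MemHolder (k - X.length) α (weight a b) (X.foldr lieDeriv u)

/-- The norm `|||u|||_{k,α;m} = ∑_{j=0}^m ‖∇^j u‖_{C^{k-j,α}_{r+j}(M)}` (for `m ≤ k`), with `∇` the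
Levi-Civita connection of the metric `h` and `r` the weight of `u`. -/
def MobiusCover.scriptNorm [IsManifold (𝓡∂ (n + 1)) ∞ Mb] {ρ : Mb → ℝ} (𝒜 : MobiusCover n Mb ρ)
    (h : Metric n Mb) (k : ℕ) (α : ℝ) (m : ℕ) {a b : ℕ} (u : TensorField n Mb a b) : ℝ≥0∞ :=
  ∑ j ∈ Finset.range (m + 1),
    𝒜.holderNorm (k - j) α (weight a b + j) (covDerivIter h u j)

end WAH

end

/-! The regularization patches Taylor polynomials in the manner of Whitney. In the chart of the i-th
parametrization, τ is replaced by the Taylor polynomial, of degree less than m, of its components at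
the center of the ball; these polynomials are glued by a partition of unity subordinate to the
images of the balls (`whit`).

All norms are read off from `crep`, the chart components of a tensor in the coordinates of the ball.
A parametrization scales vectors by `sc i`, the height of its center, and powers of ρ / `sc i` have
uniformly bounded derivatives on the ball. Hence the pullback of ρ^(-δ) u is `sc i` ^ (r - δ) times
a harmless factor times `crep` (`rep_eq`), and a bound in weight r + t is a bound of `crep` by a
multiple of `sc i` ^ t. A chart derivative is `(sc i)⁻¹` times a derivative in the ball
(`fderiv_crep`). Membership in 𝒞^{k,α;m} therefore means that the derivatives of `crep` of order q ≤
k are O(`sc i` ^ min q m), with a matching Hölder bound at the top order. In one direction this uses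
that vector fields and Christoffel symbols are smooth up to the boundary, hence have bounded
derivatives in the charts (`exists_repBound_lieDeriv`, `exists_repBound_covDeriv`); in the other
direction it suffices to differentiate along coordinate fields, extended to the whole manifold
(`exists_wHolder_crep`).

The heart is `exists_tpolyIn_sub_bound`: Taylor polynomials P_i and P_j belonging to overlapping
balls differ by O(`sc` ^ m) together with their derivatives of every order, when derivatives are
measured at the scale `sc`. Up to order m this holds because both approximate τ. Beyond order m the
chart derivatives are merely bounded, but the powers of `sc` gained from the scale suffice. The
partition functions have bounded scaled derivatives and sum to one, so the regularization minus P_j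
is the weighted sum of the P_i - P_j, again O(`sc` ^ m) to every order (`exists_whit_sub_bound`).
Adding P_j gives the bounds `sc` ^ min q m for all q, which is the first conclusion
(`exists_repBound_whit`). Comparing with τ - P_j gives the second one up to order m; above order m
the regularization and τ are each already O(`sc` ^ m) (`memHolder_whit_sub`).

For the norm estimate, the chart derivatives of τ up to order m are bounded by the sup norms of the
covariant derivatives ∇^t τ, t ≤ m, since D = ∇ + Γ (`exists_wjet_covDerivIter`). Linearity is that
of Taylor coefficients on the tensor fields that are C^m at all centers; the map is extended
linearly from that subspace (`exists_whit_linear`). -/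

noncomputable section

namespace WAH

open Filter Topology Function

/-! ### Linear algebra and the product rule for pullbacks of tensors -/

section TensorAlgebra

variable {n a b : ℕ}

/-- Precomposition of covectors, as a linear function of the endomorphism. -/
def precompL (n : ℕ) : (EE n →L[ℝ] EE n) →L[ℝ] ((EE n →L[ℝ] ℝ) →L[ℝ] (EE n →L[ℝ] ℝ)) :=
  LinearMap.toContinuousLinearMap
    { toFun := fun B => ContinuousLinearMap.precomp ℝ B
      map_add' := fun B C => by ext φ v; simp
      map_smul' := fun c B => by ext φ v; simp }

lemma contDiff_precompL (n : ℕ) (N : WithTop ℕ∞) : ContDiff ℝ N (precompL n) := by fun_prop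

lemma hasFDerivAt_precompL (n : ℕ) (B : EE n →L[ℝ] EE n) :
    HasFDerivAt (precompL n) (precompL n) B := by exact ContinuousLinearMap.hasFDerivAt _

/-- Postcomposition of `a`-linear maps, as a linear function of the outer map. -/
def postcompL (n a b : ℕ) :
    (ContraTensor n b →L[ℝ] ContraTensor n b) →L[ℝ] (Tensor n a b →L[ℝ] Tensor n a b) :=
  LinearMap.mkContinuous
      { toFun := fun g => ContinuousLinearMap.compContinuousMultilinearMapL ℝ
          (fun _ : Fin a => EE n) (ContraTensor n b) (ContraTensor n b) g
        map_add' := fun _ _ => rfl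
        map_smul' := fun _ _ => rfl } 1 (fun g => by
          refine ContinuousLinearMap.opNorm_le_bound _ (by positivity) fun f => ?_
          rw [one_mul]
          exact ContinuousLinearMap.norm_compContinuousMultilinearMap_le g f)

lemma contDiff_postcompL (n a b : ℕ) (N : WithTop ℕ∞) : ContDiff ℝ N (postcompL n a b) := by fun_prop

/-- `Tensor.pull A B` as a continuous linear map. -/
def Tensor.pullL (A B : EE n →L[ℝ] EE n) : Tensor n a b →L[ℝ] Tensor n a b :=
  (ContinuousLinearMap.compContinuousMultilinearMapL ℝ (fun _ : Fin a => EE n) (ContraTensor n b)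
    (ContraTensor n b) (ContraTensor.compL (fun _ => ContinuousLinearMap.precomp ℝ B))).comp
  (ContinuousMultilinearMap.compContinuousLinearMapL (fun _ => A))

@[simp] lemma Tensor.pullL_apply (A B : EE n →L[ℝ] EE n) (T : Tensor n a b) :
    Tensor.pullL A B T = T.pull A B := rfl

lemma Tensor.ext' {S T : Tensor n a b} (h : ∀ v φ, S v φ = T v φ) : S = T := by
  ext v φ; exact h v φ

lemma Tensor.pull_pull (A B C D : EE n →L[ℝ] EE n) (T : Tensor n a b) :
    (T.pull A B).pull C D = T.pull (A.comp C) (D.comp B) := by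
  apply Tensor.ext'; intro v φ; simp [Tensor.pull_apply, ContinuousLinearMap.comp_assoc]

lemma Tensor.pull_id (T : Tensor n a b) :
    T.pull (ContinuousLinearMap.id ℝ _) (ContinuousLinearMap.id ℝ _) = T := by
  apply Tensor.ext'; intro v φ; simp [Tensor.pull_apply]

/-- Precomposition is multilinear in the maps inserted into the separate slots; here it is
restricted to the diagonal. -/
lemma contDiff_compCLM_multilinear (ι : Type*) [Fintype ι] {V W G X : Type*}
    [NormedAddCommGroup V] [NormedSpace ℝ V] [NormedAddCommGroup W] [NormedSpace ℝ W]
    [NormedAddCommGroup G] [NormedSpace ℝ G] [NormedAddCommGroup X] [NormedSpace ℝ X]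
    {N : WithTop ℕ∞} {A : X → V →L[ℝ] W} {s : Set X} (hA : ContDiffOn ℝ N A s) :
    ContDiffOn ℝ N (fun x => ContinuousMultilinearMap.compContinuousLinearMapL (F := G)
      (fun _ : ι => A x)) s := by
  have h := (ContinuousMultilinearMap.compContinuousLinearMapContinuousMultilinear ℝ
    (fun _ : ι => V) (fun _ : ι => W) G).contDiff (n := N)
  exact h.comp_contDiffOn (contDiffOn_pi.2 fun _ => hA)

lemma contDiffOn_pullL {X : Type*} [NormedAddCommGroup X] [NormedSpace ℝ X]
    {N : WithTop ℕ∞} {A B : X → EE n →L[ℝ] EE n} {s : Set X}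
    (hA : ContDiffOn ℝ N A s) (hB : ContDiffOn ℝ N B s) :
    ContDiffOn ℝ N (fun x => Tensor.pullL (a := a) (b := b) (A x) (B x)) s := by
  have h1 : ContDiffOn ℝ N (fun x => (ContinuousLinearMap.precomp ℝ (B x) :
      (EE n →L[ℝ] ℝ) →L[ℝ] (EE n →L[ℝ] ℝ))) s :=
    (contDiff_precompL n N).comp_contDiffOn hB
  have h2 : ContDiffOn ℝ N (fun x => ContraTensor.compL (n := n) (b := b)
      (fun _ => ContinuousLinearMap.precomp ℝ (B x))) s :=
    contDiff_compCLM_multilinear (Fin b) h1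
  have h3 : ContDiffOn ℝ N (fun x => ContinuousMultilinearMap.compContinuousLinearMapL
      (F := ContraTensor n b) (fun _ : Fin a => A x)) s :=
    contDiff_compCLM_multilinear (Fin a) hA
  have h4 : ContDiffOn ℝ N (fun x => ContinuousLinearMap.compContinuousMultilinearMapL ℝ
      (fun _ : Fin a => EE n) (ContraTensor n b)
      (ContraTensor n b) (ContraTensor.compL (fun _ => ContinuousLinearMap.precomp ℝ (B x)))) s :=
    (contDiff_postcompL n a b N).comp_contDiffOn h2
  exact h4.clm_comp h3

lemma contDiff_pullL (n a b : ℕ) : ContDiff ℝ ∞ (fun P : (EE n →L[ℝ] EE n) × (EE n →L[ℝ] EE n) =>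
    Tensor.pullL (a := a) (b := b) P.1 P.2) :=
  contDiffOn_univ.1 (contDiffOn_pullL contDiff_fst.contDiffOn contDiff_snd.contDiffOn)

/-- The slot action commutes with the change of basis: A (B D A v) = D (A v) as soon as A B = 1.
This is what makes the zeroth-order terms of Lie and covariant derivatives transform as tensors. -/
lemma Tensor.act_pull {A B : EE n →L[ℝ] EE n} (hBA : A.comp B = ContinuousLinearMap.id ℝ _)
    (D : EE n →L[ℝ] EE n) (T : Tensor n a b) :
    (T.pull A B).act (B.comp (D.comp A)) = (T.act D).pull A B := by
  have hAB' : ∀ x, A (B x) = x := fun x => DFunLike.congr_fun hBA x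
  apply Tensor.ext'; intro v φ
  simp only [Tensor.pull_apply, Tensor.act_apply]
  congr 1
  · refine Finset.sum_congr rfl fun s _ => ?_
    congr 2
    ext1 i; by_cases h : i = s
    · subst h; simp [hAB']
    · simp [h]
  · refine Finset.sum_congr rfl fun t _ => ?_
    congr 1
    ext1 i; by_cases h : i = t
    · subst h; ext y; simp [hAB']
    · simp [h]

lemma Tensor.act_add (D D' : EE n →L[ℝ] EE n) (T : Tensor n a b) :
    T.act (D + D') = T.act D + T.act D' := map_add (Tensor.actL T) D D'

lemma Tensor.act_sub (D D' : EE n →L[ℝ] EE n) (T : Tensor n a b) :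
    T.act (D - D') = T.act D - T.act D' := map_sub (Tensor.actL T) D D'

/-- The product rule for evaluation, first in the vector slots and then in the covector slots. The
derivative is left existential because only its values are needed. -/
lemma hasFDerivAt_multilinear₂ {X V W : Type*} [NormedAddCommGroup X] [NormedSpace ℝ X]
    [NormedAddCommGroup V] [NormedSpace ℝ V] [NormedAddCommGroup W] [NormedSpace ℝ W]
    {T : X → V [×a]→L[ℝ] (W [×b]→L[ℝ] ℝ)} {T' : X →L[ℝ] V [×a]→L[ℝ] (W [×b]→L[ℝ] ℝ)}
    {p : Fin a → X → V} {q : Fin b → X → W} {p' : Fin a → X →L[ℝ] V} {q' : Fin b → X →L[ℝ] W}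
    {z : X} (hT : HasFDerivAt T T' z) (hp : ∀ s, HasFDerivAt (p s) (p' s) z)
    (hq : ∀ t, HasFDerivAt (q t) (q' t) z) :
    ∃ L : X →L[ℝ] ℝ, HasFDerivAt (fun z => T z (p · z) (q · z)) L z ∧ ∀ h, L h =
      T' h (p · z) (q · z) + (∑ s, T z (update (p · z) s (p' s h)) (q · z)) +
      ∑ t, T z (p · z) (update (q · z) t (q' t h)) := by
  refine ⟨_, (hT.continuousMultilinearMap_apply hp).continuousMultilinearMap_apply hq, fun h => ?_⟩
  simp

lemma hasFDerivAt_const_comp {X U V W : Type*} [NormedAddCommGroup X] [NormedSpace ℝ X]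
    [NormedAddCommGroup U] [NormedSpace ℝ U]
    [NormedAddCommGroup V] [NormedSpace ℝ V] [NormedAddCommGroup W] [NormedSpace ℝ W]
    (φ : V →L[ℝ] W) {B : X → U →L[ℝ] V} {B' : X →L[ℝ] U →L[ℝ] V} {z : X}
    (hB : HasFDerivAt B B' z) :
    HasFDerivAt (fun z => φ.comp (B z)) ((ContinuousLinearMap.compL ℝ U V W φ).comp B') z :=
  (ContinuousLinearMap.compL ℝ U V W φ).hasFDerivAt.comp z hB

lemma hasFDerivAt_pull {X : Type*} [NormedAddCommGroup X] [NormedSpace ℝ X]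
    {A B : X → EE n →L[ℝ] EE n} {T : X → Tensor n a b} {z : X}
    {A' B' : X →L[ℝ] EE n →L[ℝ] EE n} {T' : X →L[ℝ] Tensor n a b}
    (hA : HasFDerivAt A A' z) (hB : HasFDerivAt B B' z) (hT : HasFDerivAt T T' z) :
    ∃ L : X →L[ℝ] Tensor n a b, HasFDerivAt (fun z => (T z).pull (A z) (B z)) L z ∧ ∀ h v φ, L h v φ =
      T' h (fun s => A z (v s)) (fun t => (φ t).comp (B z)) +
      (∑ s, T z (update (fun s => A z (v s)) s (A' h (v s))) (fun t => (φ t).comp (B z))) +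
      ∑ t, T z (fun s => A z (v s))
        (update (fun t => (φ t).comp (B z)) t ((φ t).comp (B' h))) := by
  -- Differentiability comes from the smoothness of `pullL`; the formula is then found by evaluating
  -- at fixed arguments and using uniqueness of the derivative.
  have hd : DifferentiableAt ℝ (fun z => (T z).pull (A z) (B z)) z := by
    have h0 : DifferentiableAt ℝ (fun P : (EE n →L[ℝ] EE n) × (EE n →L[ℝ] EE n) =>
        Tensor.pullL (a := a) (b := b) P.1 P.2) (A z, B z) :=
      (contDiff_pullL n a b).differentiable (by simp) (A z, B z)
    have h1 : DifferentiableAt ℝ (fun z => Tensor.pullL (a := a) (b := b) (A z) (B z)) z := by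
      exact DifferentiableAt.comp (G := Tensor n a b →L[ℝ] Tensor n a b) z h0 (hA.differentiableAt.prodMk hB.differentiableAt)
    exact h1.clm_apply hT.differentiableAt
  refine ⟨_, hd.hasFDerivAt, fun h v φ => ?_⟩
  obtain ⟨M, hM, hMe⟩ := hasFDerivAt_multilinear₂ (W := EE n →L[ℝ] ℝ) hT
    (p := fun s z => A z (v s)) (q := fun t z => (φ t).comp (B z))
    (p' := fun s => A'.flip (v s)) (q' := fun t => (ContinuousLinearMap.compL ℝ (EE n) (EE n) ℝ (φ t)).comp B')
    (fun s => by simpa using hA.clm_apply (hasFDerivAt_const (v s) z))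
    (fun t => hasFDerivAt_const_comp (φ t) hB)
  have h2 : HasFDerivAt (fun z => (T z).pull (A z) (B z) v φ)
      ((ContinuousMultilinearMap.apply ℝ (fun _ : Fin b => EE n →L[ℝ] ℝ) ℝ φ).comp
        ((ContinuousMultilinearMap.apply ℝ (fun _ : Fin a => EE n) (ContraTensor n b) v).comp
        (fderiv ℝ (fun z => (T z).pull (A z) (B z)) z))) z := by
    have h3 : HasFDerivAt (fun z => (T z).pull (A z) (B z) v) _ z := 
      (ContinuousMultilinearMap.apply ℝ (fun _ : Fin a => EE n) (ContraTensor n b) 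
        v).hasFDerivAt.comp z hd.hasFDerivAt
    exact (ContinuousMultilinearMap.apply ℝ (fun _ : Fin b => EE n →L[ℝ] ℝ) ℝ φ).hasFDerivAt.comp z h3
  have h3 := DFunLike.congr_fun (h2.unique hM) h
  exact h3.trans (hMe h)

end TensorAlgebra

end WAH

end

noncomputable section

namespace WAH

open Filter Topology Function

/-! ### Naturality of Lie and covariant derivatives under local diffeomorphisms -/

section LocalDiffeo

variable {n a b : ℕ}

/-- The pullback of a tensor field on `ℝ^{n+1}` by a map. -/
def pbk (S : EE n → EE n) (T : EE n → Tensor n a b) (z : EE n) : Tensor n a b :=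
  (T (S z)).pull (fderiv ℝ S z) (fderiv ℝ S z).inverse

/-- The Lie derivative in coordinates. -/
def lieC (X : EE n → EE n) (u : EE n → Tensor n a b) (z : EE n) : Tensor n a b :=
  fderiv ℝ u z (X z) + (u z).act (fderiv ℝ X z)

/-- The covariant derivative in coordinates, with Christoffel symbols `Γ`. -/
def covC (Γ : EE n → EE n →L[ℝ] EE n →L[ℝ] EE n) (u : EE n → Tensor n a b) (z : EE n) :
    Tensor n (a + 1) b :=
  ContinuousLinearMap.uncurryLeft (fderiv ℝ u z - (u z).actL.comp (Γ z))

lemma IsInvertible.eventually {V W X : Type*} [NormedAddCommGroup V] [NormedSpace ℝ V]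
    [CompleteSpace V] [NormedAddCommGroup W] [NormedSpace ℝ W] [TopologicalSpace X]
    {A : X → V →L[ℝ] W} {z : X} (hA : ContinuousAt A z) (hi : (A z).IsInvertible) :
    ∀ᶠ y in 𝓝 z, (A y).IsInvertible := by
  obtain ⟨e, he⟩ := hi
  have h := ContinuousLinearEquiv.nhds e
  rw [he] at h
  filter_upwards [hA h] with y hy
  obtain ⟨e', he'⟩ := hy
  exact ⟨e', he'⟩

/-- The formula results from differentiating A⁻¹ A = 1 and composing with A⁻¹ on the right. -/
lemma hasFDerivAt_inverse {V W X : Type*} [NormedAddCommGroup V] [NormedSpace ℝ V]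
    [CompleteSpace V] [NormedAddCommGroup W] [NormedSpace ℝ W]
    [NormedAddCommGroup X] [NormedSpace ℝ X]
    {A : X → V →L[ℝ] W} {A' : X →L[ℝ] V →L[ℝ] W} {z : X} (hA : HasFDerivAt A A' z)
    (hi : (A z).IsInvertible) :
    ∃ B' : X →L[ℝ] W →L[ℝ] V, HasFDerivAt (fun y => (A y).inverse) B' z ∧
      ∀ h, B' h = -((A z).inverse.comp ((A' h).comp (A z).inverse)) := by
  have hd : DifferentiableAt ℝ (fun y => (A y).inverse) z := by
    have h1 : DifferentiableAt ℝ (ContinuousLinearMap.inverse : (V →L[ℝ] W) → _) (A z) :=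
      (hi.contDiffAt_map_inverse (n := 1)).differentiableAt (by simp)
    exact h1.comp z hA.differentiableAt
  refine ⟨_, hd.hasFDerivAt, fun h => ?_⟩
  have h1 := hd.hasFDerivAt.clm_comp hA
  have h2 : HasFDerivAt (fun y => (A y).inverse.comp (A y)) (0 : X →L[ℝ] V →L[ℝ] V) z := by
    refine (hasFDerivAt_const (ContinuousLinearMap.id ℝ V) z).congr_of_eventuallyEq ?_
    filter_upwards [IsInvertible.eventually hA.continuousAt hi] with y hy
    exact hy.inverse_comp_self
  have h3 := DFunLike.congr_fun (h1.unique h2) h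
  have h4 := congrArg (fun L => L.comp (A z).inverse) h3
  have h5 : ∀ L : W →L[ℝ] V, L.comp ((A z).comp (A z).inverse) = L := fun L => by
    rw [hi.self_comp_inverse, ContinuousLinearMap.comp_id]
  simp only [_root_.add_apply, ContinuousLinearMap.comp_apply, 
    ContinuousLinearMap.add_comp, ContinuousLinearMap.compL_apply,
    _root_.zero_apply, ContinuousLinearMap.zero_comp,
    ContinuousLinearMap.flip_apply] at h4
  rw [ContinuousLinearMap.comp_assoc, ContinuousLinearMap.comp_assoc, h5] at h4
  exact eq_neg_of_add_eq_zero_right h4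

variable {S : EE n → EE n} {z : EE n}

/-- Differentiating the factors S' gives the vector-slot terms of `act`, and the derivative -S'⁻¹
S'' S'⁻¹ of the inverse gives the covector-slot terms with the opposite sign. So the failure of D to
commute with pullback is exactly the action of S'⁻¹ S''. -/
lemma pbk_differentiable {T : EE n → Tensor n a b} (hS : ContDiffAt ℝ 2 S z)
    (hi : (fderiv ℝ S z).IsInvertible) (hT : DifferentiableAt ℝ T (S z)) :
    DifferentiableAt ℝ (pbk S T) z ∧ ∀ h, fderiv ℝ (pbk S T) z h =
      (fderiv ℝ T (S z) (fderiv ℝ S z h)).pull (fderiv ℝ S z) (fderiv ℝ S z).inverse +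
      (pbk S T z).act ((fderiv ℝ S z).inverse.comp (fderiv ℝ (fderiv ℝ S) z h)) := by
  have hA : HasFDerivAt (fderiv ℝ S) (fderiv ℝ (fderiv ℝ S) z) z :=
    ((hS.fderiv_right (m := 1) (by norm_num)).differentiableAt (by simp)).hasFDerivAt
  have hSd : HasFDerivAt S (fderiv ℝ S z) z := (hS.differentiableAt (by simp)).hasFDerivAt
  obtain ⟨B', hB, hB'⟩ := hasFDerivAt_inverse hA hi
  have hTS : HasFDerivAt (fun y => T (S y)) ((fderiv ℝ T (S z)).comp (fderiv ℝ S z)) z :=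
    hT.hasFDerivAt.comp z hSd
  obtain ⟨L, hL, hLe⟩ := hasFDerivAt_pull hA hB hTS
  have hL' : HasFDerivAt (pbk S T) L z := hL
  refine ⟨hL'.differentiableAt, fun h => ?_⟩
  rw [hL'.fderiv]
  apply Tensor.ext'
  intro v φ
  rw [hLe h v φ]
  simp only [hB', _root_.add_apply, ContraTensor.add_apply, Tensor.act_apply, pbk,
    Tensor.pull_apply]
  rw [add_assoc, sub_eq_add_neg, ← Finset.sum_neg_distrib]
  congr 2
  · refine Finset.sum_congr rfl fun s _ => ?_
    congr 2
    ext1 i; by_cases h : i = s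
    · subst h; simp [hi.self_apply_inverse]
    · simp [h]
  · refine Finset.sum_congr rfl fun t _ => ?_
    have e1 : (fun i => (update φ t ((φ t).comp ((fderiv ℝ S z).inverse.comp
        (fderiv ℝ (fderiv ℝ S) z h))) i).comp (fderiv ℝ S z).inverse) =
        update (fun t => (φ t).comp (fderiv ℝ S z).inverse) t
        ((φ t).comp ((fderiv ℝ S z).inverse.comp
          ((fderiv ℝ (fderiv ℝ S) z h).comp (fderiv ℝ S z).inverse))) := by
      ext1 i; by_cases h : i = t
      · subst h; simp [ContinuousLinearMap.comp_assoc]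
      · simp [h]
    have e2 : (φ t).comp (-((fderiv ℝ S z).inverse.comp ((fderiv ℝ (fderiv ℝ S) z h).comp
          (fderiv ℝ S z).inverse))) = (-1 : ℝ) • (φ t).comp ((fderiv ℝ S z).inverse.comp
          ((fderiv ℝ (fderiv ℝ S) z h).comp (fderiv ℝ S z).inverse)) := by
      ext y; simp
    rw [e1, e2, ContraTensor.map_update_smul]
    ring

/-- The derivative of the pulled back vector field contributes -S'⁻¹ S''(S'⁻¹ X, ·). By symmetry of
S'' this cancels the error term in the derivative of the pulled back tensor. -/
lemma lieC_pbk {T : EE n → Tensor n a b} {X : EE n → EE n} (hS : ContDiffAt ℝ 2 S z)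
    (hi : (fderiv ℝ S z).IsInvertible) (hT : DifferentiableAt ℝ T (S z))
    (hX : DifferentiableAt ℝ X (S z)) :
    lieC (fun y => (fderiv ℝ S y).inverse (X (S y))) (pbk S T) z = pbk S (lieC X T) z := by
  have hA : HasFDerivAt (fderiv ℝ S) (fderiv ℝ (fderiv ℝ S) z) z :=
    ((hS.fderiv_right (m := 1) (by norm_num)).differentiableAt (by simp)).hasFDerivAt
  have hSd : HasFDerivAt S (fderiv ℝ S z) z := (hS.differentiableAt (by simp)).hasFDerivAt
  obtain ⟨B', hB, hB'⟩ := hasFDerivAt_inverse hA hi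
  have hXS : HasFDerivAt (fun y => X (S y)) ((fderiv ℝ X (S z)).comp (fderiv ℝ S z)) z :=
    hX.hasFDerivAt.comp z hSd
  have hX' := hB.clm_apply hXS
  have hsymm : IsSymmSndFDerivAt ℝ S z := hS.isSymmSndFDerivAt (by simp)
  have e : fderiv ℝ (fun y => (fderiv ℝ S y).inverse (X (S y))) z =
      (fderiv ℝ S z).inverse.comp ((fderiv ℝ X (S z)).comp (fderiv ℝ S z)) -
      (fderiv ℝ S z).inverse.comp (fderiv ℝ (fderiv ℝ S) z ((fderiv ℝ S z).inverse (X (S z)))) := by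
    rw [hX'.fderiv]
    ext v
    simp [hB', hsymm.eq _ v, sub_eq_add_neg]
  rw [lieC, e, (pbk_differentiable hS hi hT).2, Tensor.act_sub, hi.self_apply_inverse]
  have e2 := Tensor.act_pull (hi.self_comp_inverse) (fderiv ℝ X (S z)) (T (S z))
  simp only [pbk, lieC] at e2 ⊢
  rw [e2]
  apply Tensor.ext'; intro v φ
  simp [Tensor.pull_apply]

/-- Here the S'' term in the transformation law of the Christoffel symbols cancels the error term in
the derivative of the pulled back tensor. -/
lemma covC_pbk {T : EE n → Tensor n a b} {Γ Γ' : EE n → EE n →L[ℝ] EE n →L[ℝ] EE n}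
    (hS : ContDiffAt ℝ 2 S z)
    (hi : (fderiv ℝ S z).IsInvertible) (hT : DifferentiableAt ℝ T (S z))
    (hΓ : ∀ v, fderiv ℝ S z ∘L Γ' z v = (Γ (S z) (fderiv ℝ S z v)) ∘L (fderiv ℝ S z) +
      fderiv ℝ (fderiv ℝ S) z v) :
    covC Γ' (pbk S T) z = pbk S (covC Γ T) z := by
  have hΓ2 : ∀ v, Γ' z v = (fderiv ℝ S z).inverse.comp ((Γ (S z) (fderiv ℝ S z v)) ∘L
      (fderiv ℝ S z)) + (fderiv ℝ S z).inverse.comp (fderiv ℝ (fderiv ℝ S) z v) := fun v => by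
    rw [← ContinuousLinearMap.comp_add, ← hΓ v, ← ContinuousLinearMap.comp_assoc,
      hi.inverse_comp_self, ContinuousLinearMap.id_comp]
  apply Tensor.ext'; intro v φ
  have e2 := Tensor.act_pull (hi.self_comp_inverse) (Γ (S z) (fderiv ℝ S z (v 0))) (T (S z))
  simp only [covC, pbk, ContinuousLinearMap.uncurryLeft_apply, Tensor.pull_apply,
    _root_.sub_apply, ContinuousLinearMap.comp_apply, Tensor.actL_apply] at e2 ⊢
  have e3 := (pbk_differentiable hS hi hT).2 (v 0)
  rw [e3, hΓ2, Tensor.act_add]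
  simp only [pbk, e2, _root_.add_apply, 
    ContraTensor.sub_apply, ContraTensor.add_apply, Tensor.pull_apply]
  have e4 : Fin.tail (fun s => fderiv ℝ S z (v s)) = fun s => fderiv ℝ S z (Fin.tail v s) := rfl
  rw [e4]
  ring

/-- The Christoffel symbols of a metric given in coordinates. -/
def chrisC (G : EE n → EE n →L[ℝ] EE n →L[ℝ] ℝ) (z : EE n) : EE n →L[ℝ] EE n →L[ℝ] EE n :=
  let DG : EE n →L[ℝ] EE n →L[ℝ] EE n →L[ℝ] ℝ := fderiv ℝ G z
  LinearMap.toContinuousLinearMap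
    { toFun := fun v => (G z).inverse.comp
        ((1 / 2 : ℝ) • (DG v + DG.flip v - (DG.flip v).flip))
      map_add' := by
        intro v w
        rw [← ContinuousLinearMap.comp_add]
        congr 1; ext y t; simp; ring
      map_smul' := by
        intro c v
        rw [RingHom.id_apply, ← ContinuousLinearMap.comp_smul, smul_comm c]
        congr 2; ext y t; simp [mul_add, mul_sub] }

lemma chrisC_apply (G : EE n → EE n →L[ℝ] EE n →L[ℝ] ℝ) (z : EE n) (v : EE n) :
    chrisC G z v = (G z).inverse.comp ((1 / 2 : ℝ) • (fderiv ℝ G z v + (fderiv ℝ G z).flip v -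
      ((fderiv ℝ G z).flip v).flip)) := rfl

lemma inner_chrisC {G : EE n → EE n →L[ℝ] EE n →L[ℝ] ℝ} {z : EE n} (hi : (G z).IsInvertible)
    (v w y : EE n) : G z (chrisC G z v w) y =
      (1 / 2 : ℝ) * (fderiv ℝ G z v w y + fderiv ℝ G z w v y - fderiv ℝ G z y v w) := by
  rw [chrisC_apply, ContinuousLinearMap.comp_apply, hi.self_apply_inverse]
  simp

/-- Both sides are tested with Koszul's formula. Differentiating the pulled back metric produces six
terms with S''; by symmetry of S'' and of the metric, four cancel and two add up to the
inhomogeneous term. -/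
lemma chrisC_pbk {G G' : EE n → EE n →L[ℝ] EE n →L[ℝ] ℝ} (hS : ContDiffAt ℝ 2 S z)
    (hi : (fderiv ℝ S z).IsInvertible) (hG : DifferentiableAt ℝ G (S z))
    (hGi : (G (S z)).IsInvertible) (hGi' : (G' z).IsInvertible)
    (hsym : ∀ v w, G (S z) v w = G (S z) w v)
    (hG' : ∀ᶠ y in 𝓝 z, ∀ v w, G' y v w = G (S y) (fderiv ℝ S y v) (fderiv ℝ S y w)) (v : EE n) :
    fderiv ℝ S z ∘L chrisC G' z v = (chrisC G (S z) (fderiv ℝ S z v)) ∘L (fderiv ℝ S z) +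
      fderiv ℝ (fderiv ℝ S) z v := by
  have hA : HasFDerivAt (fderiv ℝ S) (fderiv ℝ (fderiv ℝ S) z) z :=
    ((hS.fderiv_right (m := 1) (by norm_num)).differentiableAt (by simp)).hasFDerivAt
  have hSd : HasFDerivAt S (fderiv ℝ S z) z := (hS.differentiableAt (by simp)).hasFDerivAt
  have hGS : HasFDerivAt (fun y => G (S y)) ((fderiv ℝ G (S z)).comp (fderiv ℝ S z)) z :=
    HasFDerivAt.comp (G := EE n →L[ℝ] EE n →L[ℝ] ℝ) z hG.hasFDerivAt hSd
  have hsymm : IsSymmSndFDerivAt ℝ S z := hS.isSymmSndFDerivAt (by simp)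
  have hG'eq : G' =ᶠ[𝓝 z] fun y => (ContinuousLinearMap.compL ℝ _ _ _ 
      (ContinuousLinearMap.precomp ℝ (fderiv ℝ S y))) ((G (S y)).comp (fderiv ℝ S y)) := by
    filter_upwards [hG'] with y hy
    ext v w; simp [hy]
  have hd : DifferentiableAt ℝ G' z := by
    refine DifferentiableAt.congr_of_eventuallyEq ?_ hG'eq
    have h1 : DifferentiableAt ℝ (fun y => precompL n (fderiv ℝ S y)) z := by
      have := hasFDerivAt_precompL n (fderiv ℝ S z)
      exact (HasFDerivAt.comp (G := (EE n →L[ℝ] ℝ) →L[ℝ] (EE n →L[ℝ] ℝ)) z this hA).differentiableAt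
    exact h1.clm_comp (hGS.differentiableAt.clm_comp hA.differentiableAt)
  have hDG : ∀ u v w, fderiv ℝ G' z u v w =
      fderiv ℝ G (S z) (fderiv ℝ S z u) (fderiv ℝ S z v) (fderiv ℝ S z w) +
      G (S z) (fderiv ℝ (fderiv ℝ S) z u v) (fderiv ℝ S z w) +
      G (S z) (fderiv ℝ S z v) (fderiv ℝ (fderiv ℝ S) z u w) := by
    intro u v w
    have h1 := (hd.hasFDerivAt.clm_apply (hasFDerivAt_const v z)).clm_apply (hasFDerivAt_const w z)
    have h2 := (hGS.clm_apply (hA.clm_apply (hasFDerivAt_const v z))).clm_apply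
      (hA.clm_apply (hasFDerivAt_const w z))
    have h3 := h2.congr_of_eventuallyEq (f₁ := fun y => G' y v w) (hG'.mono fun y hy => hy v w)
    have h4 := DFunLike.congr_fun (h1.unique h3) u
    simp at h4
    rw [h4]; ring
  ext1 w
  -- The metric is nondegenerate and S' is onto, so it suffices to pair with vectors of the form S'
  -- y.
  apply hGi.injective
  ext1 y'
  obtain ⟨y, rfl⟩ := hi.surjective y'
  have h1 := hG'.self_of_nhds (chrisC G' z v w) y
  rw [inner_chrisC hGi'] at h1
  simp only [ContinuousLinearMap.comp_apply, _root_.add_apply, map_add]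
  rw [← h1, inner_chrisC hGi, hDG, hDG, hDG, hsymm.eq w v, hsymm.eq y v, hsymm.eq y w,
    hsym (fderiv ℝ (fderiv ℝ S) z v y)]
  ring

end LocalDiffeo

end WAH

end

noncomputable section

namespace WAH

open Filter Topology Function

set_option linter.unusedSectionVars false

/-! ### Charts at interior points, and the defining formulas in an arbitrary chart -/

section Charts

lemma natCast_le_infty (k : ℕ) : (k : WithTop ℕ∞) ≤ (∞ : WithTop ℕ∞) := by
  have h : ((k : ℕ∞) : WithTop ℕ∞) ≤ ((⊤ : ℕ∞) : WithTop ℕ∞) := WithTop.coe_le_coe.2 le_top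
  exact_mod_cast h

lemma two_le_infty : (2 : WithTop ℕ∞) ≤ (∞ : WithTop ℕ∞) := natCast_le_infty 2

variable {n : ℕ} {Mb : Type*} [TopologicalSpace Mb] [ChartedSpace (EuclideanHalfSpace (n + 1)) Mb]
  {a b : ℕ}

/-- The parametrization inverse to a chart. -/
def cpar (e : OpenPartialHomeomorph Mb (EuclideanHalfSpace (n + 1))) : EE n → Mb :=
  (e.extend (𝓡∂ (n + 1))).symm

/-- The coordinates given by a chart. -/
def ccoord (e : OpenPartialHomeomorph Mb (EuclideanHalfSpace (n + 1))) : Mb → EE n :=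
  e.extend (𝓡∂ (n + 1))

/-- The interior of the coordinate domain of a chart. -/
def cdom (e : OpenPartialHomeomorph Mb (EuclideanHalfSpace (n + 1))) : Set (EE n) :=
  (e.extend (𝓡∂ (n + 1))).target ∩ {z | 0 < z 0}

variable {e e' : OpenPartialHomeomorph Mb (EuclideanHalfSpace (n + 1))} {z : EE n}

/-- The coordinate change between two charts. -/
def ctrans (e e' : OpenPartialHomeomorph Mb (EuclideanHalfSpace (n + 1))) (z : EE n) : EE n :=
  ccoord e' (cpar e z)

lemma isOpen_cdom (e : OpenPartialHomeomorph Mb (EuclideanHalfSpace (n + 1))) :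
    IsOpen (cdom e) := by
  have h1 : cdom e = ((𝓡∂ (n + 1)).symm ⁻¹' e.target) ∩ {z | 0 < z 0} := by
    rw [cdom, e.extend_target, Set.inter_assoc, range_modelWithCornersEuclideanHalfSpace]
    congr 1
    ext z
    simp only [Set.mem_inter_iff, Set.mem_ofPred_eq, and_iff_right_iff_imp]
    exact fun h => h.le
  rw [h1]
  refine IsOpen.inter (e.open_target.preimage (𝓡∂ (n + 1)).continuous_symm) ?_
  exact isOpen_lt continuous_const (by fun_prop)

lemma cdom_mem_nhds (hz : z ∈ cdom e) : cdom e ∈ 𝓝 z := (isOpen_cdom e).mem_nhds hz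

lemma cpar_mem_source (hz : z ∈ cdom e) : cpar e z ∈ e.source := by
  have := (e.extend (𝓡∂ (n + 1))).map_target hz.1
  rwa [e.extend_source] at this

lemma ccoord_cpar (hz : z ∈ cdom e) : ccoord e (cpar e z) = z :=
  (e.extend (𝓡∂ (n + 1))).right_inv hz.1

lemma cpar_ccoord {p : Mb} (hp : p ∈ e.source) : cpar e (ccoord e p) = p :=
  e.extend_left_inv hp

lemma ccoord_mem_cdom_iff {p : Mb} (hp : p ∈ e.source) :
    ccoord e p ∈ cdom e ↔ 0 < ccoord e p 0 := by
  refine ⟨fun h => h.2, fun h => ⟨?_, h⟩⟩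
  exact (e.extend (𝓡∂ (n + 1))).map_source (by rwa [e.extend_source])

lemma continuousAt_cpar (hz : z ∈ cdom e) : ContinuousAt (cpar e) z :=
  e.continuousAt_extend_symm' hz.1

lemma continuousAt_ccoord {p : Mb} (hp : p ∈ e.source) : ContinuousAt (ccoord e) p :=
  e.continuousAt_extend hp

lemma eventually_cpar_mem_source (hz : z ∈ cdom e) (hz' : cpar e z ∈ e'.source) :
    ∀ᶠ y in 𝓝 z, cpar e y ∈ e'.source :=
  (continuousAt_cpar hz).eventually (e'.open_source.mem_nhds hz')

lemma mem_extendCoordChange_source (hz : z ∈ cdom e) (hz' : cpar e z ∈ e'.source) :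
    z ∈ ((𝓡∂ (n + 1)).extendCoordChange e e').source := by
  rw [← OpenPartialHomeomorph.extend_image_source_inter]
  exact ⟨cpar e z, ⟨cpar_mem_source hz, hz'⟩, ccoord_cpar hz⟩

lemma extendCoordChange_source_mem_nhds (hz : z ∈ cdom e) (hz' : cpar e z ∈ e'.source) :
    ((𝓡∂ (n + 1)).extendCoordChange e e').source ∈ 𝓝 z := by
  filter_upwards [cdom_mem_nhds hz, eventually_cpar_mem_source hz hz'] with y hy hy'
  exact mem_extendCoordChange_source hy hy'

open IsManifold in
lemma contDiffAt_ctrans (he : e ∈ maximalAtlas (𝓡∂ (n + 1)) ∞ Mb)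
    (he' : e' ∈ maximalAtlas (𝓡∂ (n + 1)) ∞ Mb) (hz : z ∈ cdom e) (hz' : cpar e z ∈ e'.source) :
    ContDiffAt ℝ ∞ (ctrans e e') z :=
  ((𝓡∂ (n + 1)).contDiffOn_extendCoordChange he he').contDiffAt
    (extendCoordChange_source_mem_nhds hz hz')

open IsManifold in
lemma isInvertible_fderiv_ctrans (he : e ∈ maximalAtlas (𝓡∂ (n + 1)) ∞ Mb)
    (he' : e' ∈ maximalAtlas (𝓡∂ (n + 1)) ∞ Mb) (hz : z ∈ cdom e) (hz' : cpar e z ∈ e'.source) :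
    (fderiv ℝ (ctrans e e') z).IsInvertible := by
  have h := (𝓡∂ (n + 1)).isInvertible_fderivWithin_extendCoordChange (n := ∞) (by simp) he he'
    (mem_extendCoordChange_source hz hz')
  rwa [fderivWithin_of_mem_nhds (extendCoordChange_source_mem_nhds hz hz')] at h

open IsManifold in
-- Invariance of interior points: the coordinate change takes values in the closed half-space and
-- has surjective derivative, so its value at an interior point cannot lie on the boundary
-- hyperplane.
lemma ctrans_mem_cdom (he : e ∈ maximalAtlas (𝓡∂ (n + 1)) ∞ Mb)
    (he' : e' ∈ maximalAtlas (𝓡∂ (n + 1)) ∞ Mb) (hz : z ∈ cdom e) (hz' : cpar e z ∈ e'.source) :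
    ctrans e e' z ∈ cdom e' := by
  refine (ccoord_mem_cdom_iff hz').2 ?_
  have h := ((contDiffAt_ctrans he he' hz hz').differentiableAt
    (by simp)).mem_interior_convex_of_surjective_fderiv
    (extendCoordChange_source_mem_nhds hz hz') (𝓡∂ (n + 1)).convex_range
    (𝓡∂ (n + 1)).isClosed_range (𝓡∂ (n + 1)).nonempty_interior
    (fun y hy => ⟨_, rfl⟩) (isInvertible_fderiv_ctrans he he' hz hz').surjective
  rw [interior_range_modelWithCornersEuclideanHalfSpace] at h
  exact h

lemma cpar_ctrans (hz' : cpar e z ∈ e'.source) : cpar e' (ctrans e e' z) = cpar e z :=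
  cpar_ccoord hz'

lemma ctrans_ctrans (hz : z ∈ cdom e) (hz' : cpar e z ∈ e'.source) :
    ctrans e' e (ctrans e e' z) = z := by
  rw [ctrans, cpar_ctrans hz', ccoord_cpar hz]

open IsManifold in
lemma isInteriorPoint_cpar (he : e ∈ maximalAtlas (𝓡∂ (n + 1)) ∞ Mb) [IsManifold (𝓡∂ (n + 1)) ∞ Mb]
    (hz : z ∈ cdom e) : cpar e z ∈ (𝓡∂ (n + 1)).interior Mb := by
  have h := ctrans_mem_cdom he (chart_mem_maximalAtlas (cpar e z)) hz (mem_chart_source _ _)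
  have h2 := h.2
  change ModelWithCorners.IsInteriorPoint _ _
  rw [ModelWithCorners.isInteriorPoint_iff, mem_interior_iff_mem_nhds]
  exact mem_of_superset ((isOpen_cdom _).mem_nhds h) Set.inter_subset_left

open IsManifold in
lemma contMDiffAt_cpar (he : e ∈ maximalAtlas (𝓡∂ (n + 1)) ∞ Mb) (hz : z ∈ cdom e) :
    ContMDiffAt 𝓘(ℝ, EE n) (𝓡∂ (n + 1)) ∞ (cpar e) z := by
  refine (contMDiffOn_extend_symm he).contMDiffAt ?_
  rw [← e.extend_target']
  exact mem_of_superset (cdom_mem_nhds hz) Set.inter_subset_left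

open IsManifold in
lemma mdifferentiableAt_cpar (he : e ∈ maximalAtlas (𝓡∂ (n + 1)) ∞ Mb) (hz : z ∈ cdom e) :
    MDifferentiableAt 𝓘(ℝ, EE n) (𝓡∂ (n + 1)) (cpar e) z :=
  (contMDiffAt_cpar he hz).mdifferentiableAt (by simp)

open IsManifold in
/-- In the preferred chart at the image point, `dParam` is the derivative of the coordinate
change. -/
lemma dParam_cpar_eq (he : e ∈ maximalAtlas (𝓡∂ (n + 1)) ∞ Mb) (hz : z ∈ cdom e) :
    dParam (cpar e) z = fderiv ℝ (ctrans e (chartAt _ (cpar e z))) z := by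
  refine (mdifferentiableAt_cpar he hz).mfderiv.trans ?_
  change fderivWithin ℝ (ctrans e (chartAt _ (cpar e z))) (Set.range id) z = _
  rw [Set.range_id, fderivWithin_univ]

open IsManifold in
lemma dParam_cpar (he : e ∈ maximalAtlas (𝓡∂ (n + 1)) ∞ Mb)
    (he' : e' ∈ maximalAtlas (𝓡∂ (n + 1)) ∞ Mb) (hz : z ∈ cdom e) (hz' : cpar e z ∈ e'.source) :
    dParam (cpar e) z = (dParam (cpar e') (ctrans e e' z)).comp (fderiv ℝ (ctrans e e') z) := by
  have h1 : cpar e =ᶠ[𝓝 z] cpar e' ∘ ctrans e e' := by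
    filter_upwards [eventually_cpar_mem_source hz hz'] with y hy
    exact (cpar_ctrans hy).symm
  have h2 : MDifferentiableAt 𝓘(ℝ, EE n) 𝓘(ℝ, EE n) (ctrans e e') z :=
    ((contDiffAt_ctrans he he' hz hz').differentiableAt (by simp)).mdifferentiableAt
  have h3 := mdifferentiableAt_cpar he' (ctrans_mem_cdom he he' hz hz')
  rw [dParam, h1.mfderiv_eq]
  have h4 := mfderiv_comp z h3 h2
  rw [mfderiv_eq_fderiv] at h4
  exact h4

open IsManifold in
lemma isInvertible_dParam [IsManifold (𝓡∂ (n + 1)) ∞ Mb] (he : e ∈ maximalAtlas (𝓡∂ (n + 1)) ∞ Mb) (hz : z ∈ cdom e) :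
    (dParam (cpar e) z).IsInvertible := by
  rw [dParam_cpar_eq he hz]
  exact isInvertible_fderiv_ctrans he (chart_mem_maximalAtlas _) hz (mem_chart_source _ _)

open IsManifold in
lemma pullback_cpar [IsManifold (𝓡∂ (n + 1)) ∞ Mb] (he : e ∈ maximalAtlas (𝓡∂ (n + 1)) ∞ Mb)
    (he' : e' ∈ maximalAtlas (𝓡∂ (n + 1)) ∞ Mb) (hz : z ∈ cdom e) (hz' : cpar e z ∈ e'.source)
    (u : TensorField n Mb a b) :
    pullback (cpar e) u z = pbk (ctrans e e') (pullback (cpar e') u) z := by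
  have hi := isInvertible_dParam he' (ctrans_mem_cdom he he' hz hz')
  rw [pullback, pbk, pullback, dParam_cpar he he' hz hz', cpar_ctrans hz', Tensor.pull_pull,
    hi.inverse_comp_of_left]

lemma eventually_mem_cdom_source (hz : z ∈ cdom e) (hz' : cpar e z ∈ e'.source) :
    ∀ᶠ y in 𝓝 z, y ∈ cdom e ∧ cpar e y ∈ e'.source :=
  Filter.Eventually.and (cdom_mem_nhds hz) (eventually_cpar_mem_source hz hz')

/-- A vector field in the coordinates of a chart. -/
def vfC [IsManifold (𝓡∂ (n + 1)) ∞ Mb] (e : OpenPartialHomeomorph Mb (EuclideanHalfSpace (n + 1)))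
    (X : VField n Mb) (z : EE n) : EE n :=
  (dParam (cpar e) z).inverse (X (cpar e z))

lemma lieC_congr {u u' : EE n → Tensor n a b} {X X' : EE n → EE n} (hu : u =ᶠ[𝓝 z] u')
    (hX : X =ᶠ[𝓝 z] X') : lieC X u z = lieC X' u' z := by
  rw [lieC, lieC, hu.fderiv_eq, hX.fderiv_eq, hu.self_of_nhds, hX.self_of_nhds]

lemma covC_congr {u u' : EE n → Tensor n a b} {Γ Γ' : EE n → EE n →L[ℝ] EE n →L[ℝ] EE n}
    (hu : u =ᶠ[𝓝 z] u') (hX : Γ z = Γ' z) : covC Γ u z = covC Γ' u' z := by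
  rw [covC, covC, hu.fderiv_eq, hu.self_of_nhds, hX]

open IsManifold in
lemma vfC_ctrans [IsManifold (𝓡∂ (n + 1)) ∞ Mb] (he : e ∈ maximalAtlas (𝓡∂ (n + 1)) ∞ Mb)
    (he' : e' ∈ maximalAtlas (𝓡∂ (n + 1)) ∞ Mb) (hz : z ∈ cdom e) (hz' : cpar e z ∈ e'.source)
    (X : VField n Mb) :
    vfC e X z = (fderiv ℝ (ctrans e e') z).inverse (vfC e' X (ctrans e e' z)) := by
  have hi := isInvertible_dParam he' (ctrans_mem_cdom he he' hz hz')
  -- `X p` and `X q` live in different tangent spaces, which are all the model space by definition;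
  -- the equality of base points has to be substituted rather than rewritten.
  have key : ∀ p q : Mb, p = q → (X p : EE n) = X q := by rintro p _ rfl; rfl
  rw [vfC, dParam_cpar he he' hz hz', hi.inverse_comp_of_left]
  change (fderiv ℝ (ctrans e e') z).inverse ((dParam (cpar e') (ctrans e e' z)).inverse _) = _
  rw [vfC, key _ _ (cpar_ctrans hz')]

open IsManifold in
-- The transformation law is used backwards, through the inverse coordinate change.
lemma differentiableAt_pullback_ctrans [IsManifold (𝓡∂ (n + 1)) ∞ Mb]
    (he : e ∈ maximalAtlas (𝓡∂ (n + 1)) ∞ Mb)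
    (he' : e' ∈ maximalAtlas (𝓡∂ (n + 1)) ∞ Mb) (hz : z ∈ cdom e) (hz' : cpar e z ∈ e'.source)
    {u : TensorField n Mb a b} (hu : DifferentiableAt ℝ (pullback (cpar e) u) z) :
    DifferentiableAt ℝ (pullback (cpar e') u) (ctrans e e' z) := by
  have hw := ctrans_mem_cdom he he' hz hz'
  have hw' : cpar e' (ctrans e e' z) ∈ e.source := by
    rw [cpar_ctrans hz']; exact cpar_mem_source hz
  have h1 := (pbk_differentiable (T := pullback (cpar e) u)
    ((contDiffAt_ctrans he' he hw hw').of_le two_le_infty)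
    (isInvertible_fderiv_ctrans he' he hw hw') (by rwa [ctrans_ctrans hz hz'])).1
  refine h1.congr_of_eventuallyEq ?_
  filter_upwards [eventually_mem_cdom_source hw hw'] with y hy
  exact pullback_cpar he' he hy.1 hy.2 u

open IsManifold in
-- Tangent spaces are identified with the model space by the preferred chart at the point. A tensor
-- field defined pointwise there is thus pulled back by the coordinate change to that chart, and
-- only its value at this one point enters.
lemma pullback_eq_pbk_preferred [IsManifold (𝓡∂ (n + 1)) ∞ Mb]
    (he : e ∈ maximalAtlas (𝓡∂ (n + 1)) ∞ Mb) (hz : z ∈ cdom e) (u : TensorField n Mb a b)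
    (v : EE n → Tensor n a b)
    (hv : u (cpar e z) = v (ctrans e (chartAt _ (cpar e z)) z)) :
    pullback (cpar e) u z = pbk (ctrans e (chartAt _ (cpar e z))) v z := by
  rw [pullback, pbk, hv, dParam_cpar_eq he hz]

open IsManifold in
-- The definition uses a chart that varies with the point; naturality of `lieC` under the coordinate
-- change allows any fixed chart instead.
lemma pullback_lieDeriv [IsManifold (𝓡∂ (n + 1)) ∞ Mb] (he : e ∈ maximalAtlas (𝓡∂ (n + 1)) ∞ Mb)
    (hz : z ∈ cdom e) (X : VField n Mb) {u : TensorField n Mb a b}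
    (hu : DifferentiableAt ℝ (pullback (cpar e) u) z)
    (hX : ∀ e' ∈ maximalAtlas (𝓡∂ (n + 1)) ∞ Mb, ∀ y ∈ cdom e', DifferentiableAt ℝ (vfC e' X) y) :
    pullback (cpar e) (lieDeriv X u) z = lieC (vfC e X) (pullback (cpar e) u) z := by
  set e' := chartAt (EuclideanHalfSpace (n + 1)) (cpar e z) with he'def
  have he' : e' ∈ maximalAtlas (𝓡∂ (n + 1)) ∞ Mb := chart_mem_maximalAtlas _
  have hz' : cpar e z ∈ e'.source := mem_chart_source _ _
  rw [pullback_eq_pbk_preferred he hz (lieDeriv X u) (lieC (vfC e' X) (pullback (cpar e') u)) rfl]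
  rw [← he'def, ← lieC_pbk ((contDiffAt_ctrans he he' hz hz').of_le two_le_infty)
    (isInvertible_fderiv_ctrans he he' hz hz') (differentiableAt_pullback_ctrans he he' hz hz' hu)
    (hX e' he' _ (ctrans_mem_cdom he he' hz hz'))]
  refine lieC_congr ?_ ?_
  · filter_upwards [eventually_mem_cdom_source hz hz'] with y hy
    exact (pullback_cpar he he' hy.1 hy.2 u).symm
  · filter_upwards [eventually_mem_cdom_source hz hz'] with y hy
    exact (vfC_ctrans he he' hy.1 hy.2 X).symm

lemma coeff_apply [IsManifold (𝓡∂ (n + 1)) ∞ Mb] (h : Metric n Mb) (Φ : EE n → Mb) (z v w : EE n) :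
    h.coeff Φ z v w = h.at (Φ z) (dParam Φ z v) (dParam Φ z w) := rfl

/-- Positivity gives injectivity, and a finite-dimensional space and its dual have the same
dimension. -/
lemma isInvertible_of_pos {G : EE n →L[ℝ] EE n →L[ℝ] ℝ} (hG : ∀ v ≠ 0, 0 < G v v) :
    G.IsInvertible := by
  have hinj : Function.Injective (G : EE n →ₗ[ℝ] EE n →L[ℝ] ℝ) := by
    rw [← LinearMap.ker_eq_bot, LinearMap.ker_eq_bot']
    intro v hv
    by_contra hne
    have h1 := hG v hne
    have h2 : G v = 0 := hv
    simp [h2] at h1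
  have hfr : Module.finrank ℝ (EE n) = Module.finrank ℝ (EE n →L[ℝ] ℝ) := by
    rw [(LinearMap.toContinuousLinearMap (E := EE n) (F' := ℝ) (𝕜 := ℝ)).symm.finrank_eq]
    exact (Subspace.dual_finrank_eq).symm
  let L := (LinearEquiv.ofInjectiveOfFinrankEq (G : EE n →ₗ[ℝ] EE n →L[ℝ] ℝ) hinj hfr)
  exact ⟨L.toContinuousLinearEquiv, by ext; rfl⟩

open IsManifold in
lemma coeff_pos [IsManifold (𝓡∂ (n + 1)) ∞ Mb] (h : Metric n Mb)
    (he : e ∈ maximalAtlas (𝓡∂ (n + 1)) ∞ Mb) (hz : z ∈ cdom e) (v : EE n) (hv : v ≠ 0) :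
    0 < h.coeff (cpar e) z v v := by
  rw [coeff_apply]
  refine h.pos _ _ fun h0 => hv ?_
  exact (isInvertible_dParam he hz).injective (by rw [map_zero]; exact h0)

open IsManifold in
lemma pullback_covDeriv [IsManifold (𝓡∂ (n + 1)) ∞ Mb] (h : Metric n Mb)
    (he : e ∈ maximalAtlas (𝓡∂ (n + 1)) ∞ Mb)
    (hz : z ∈ cdom e) {u : TensorField n Mb a b}
    (hu : DifferentiableAt ℝ (pullback (cpar e) u) z)
    (hh : ∀ e' ∈ maximalAtlas (𝓡∂ (n + 1)) ∞ Mb, ∀ y ∈ cdom e',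
      DifferentiableAt ℝ (h.coeff (cpar e')) y) :
    pullback (cpar e) (covDeriv h u) z =
      covC (h.christoffel (cpar e)) (pullback (cpar e) u) z := by
  set e' := chartAt (EuclideanHalfSpace (n + 1)) (cpar e z) with he'def
  have he' : e' ∈ maximalAtlas (𝓡∂ (n + 1)) ∞ Mb := chart_mem_maximalAtlas _
  have hz' : cpar e z ∈ e'.source := mem_chart_source _ _
  have hw := ctrans_mem_cdom he he' hz hz'
  rw [pullback_eq_pbk_preferred he hz (covDeriv h u)
    (covC (h.christoffel (cpar e')) (pullback (cpar e') u)) rfl]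
  rw [← he'def, ← covC_pbk (Γ' := h.christoffel (cpar e))
    ((contDiffAt_ctrans he he' hz hz').of_le two_le_infty)
    (isInvertible_fderiv_ctrans he he' hz hz') (differentiableAt_pullback_ctrans he he' hz hz' hu)]
  · refine covC_congr ?_ rfl
    filter_upwards [eventually_mem_cdom_source hz hz'] with y hy
    exact (pullback_cpar he he' hy.1 hy.2 u).symm
  -- `h.christoffel Φ` is `chrisC (h.coeff Φ)` by definition, so the transformation law applies.
  · refine chrisC_pbk ((contDiffAt_ctrans he he' hz hz').of_le two_le_infty)
      (isInvertible_fderiv_ctrans he he' hz hz') (hh e' he' _ hw)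
      (isInvertible_of_pos (coeff_pos h he' hw)) (isInvertible_of_pos (coeff_pos h he hz)) ?_ ?_
    · intro v w
      exact h.symm _ _ _
    · filter_upwards [eventually_mem_cdom_source hz hz'] with y hy v w
      rw [coeff_apply, coeff_apply, dParam_cpar he he' hy.1 hy.2, cpar_ctrans hy.2]
      rfl

end Charts

end WAH

end

noncomputable section

namespace WAH

open Filter Topology Function

/-! ### Pointwise estimates for derivatives of products and compositions -/

section Jets

variable {X V W G : Type*} [NormedAddCommGroup X] [NormedSpace ℝ X]
  [NormedAddCommGroup V] [NormedSpace ℝ V] [NormedAddCommGroup W] [NormedSpace ℝ W]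
  [NormedAddCommGroup G] [NormedSpace ℝ G]

lemma exists_isOpen_contDiffOn {f : X → V} {z : X} {k : ℕ} (hf : ContDiffAt ℝ k f z) :
    ∃ u, IsOpen u ∧ z ∈ u ∧ ContDiffOn ℝ k f u := by
  obtain ⟨u, hu, h⟩ := hf.contDiffOn (m := k) le_rfl (by simp)
  obtain ⟨v, hv, hvo, hz⟩ := mem_nhds_iff.1 (by simpa using hu)
  exact ⟨v, hvo, hz, h.mono hv⟩

lemma eventually_contDiffAt {f : X → V} {z : X} {k : ℕ} (hf : ContDiffAt ℝ k f z) :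
    ∀ᶠ y in 𝓝 z, ContDiffAt ℝ k f y := by
  obtain ⟨u, hu, hz, h⟩ := exists_isOpen_contDiffOn hf
  filter_upwards [hu.mem_nhds hz] with y hy
  exact h.contDiffAt (hu.mem_nhds hy)

lemma iteratedFDeriv_sub_at {f g : X → V} {z : X} {k : ℕ} (hf : ContDiffAt ℝ k f z)
    (hg : ContDiffAt ℝ k g z) : iteratedFDeriv ℝ k (fun y => f y - g y) z =
      iteratedFDeriv ℝ k f z - iteratedFDeriv ℝ k g z := by
  have h1 : (fun y => f y - g y) = f + (-g) := by ext y; simp [sub_eq_add_neg]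
  rw [h1, iteratedFDeriv_add_apply hf (show ContDiffAt ℝ k (-g) z from hg.neg),
    iteratedFDeriv_neg_apply, sub_eq_add_neg]

lemma iteratedFDeriv_comp_affine (f : X → V) (a : X) {t : ℝ} (ht : t ≠ 0) (j : ℕ) (x : X) :
    iteratedFDeriv ℝ j (fun y => f (a + t • y)) x = t ^ j • iteratedFDeriv ℝ j f (a + t • x) := by
  let e : X ≃L[ℝ] X := ContinuousLinearEquiv.smulLeft (Units.mk0 t ht)
  have h1 : (fun y => f (a + t • y)) = (fun y => f (a + y)) ∘ e := rfl
  have h2 := e.iteratedFDerivWithin_comp_right (fun y => f (a + y)) uniqueDiffOn_univ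
    (x := x) (Set.mem_univ _) j
  rw [Set.preimage_univ, iteratedFDerivWithin_univ, iteratedFDerivWithin_univ,
    iteratedFDeriv_comp_add_left] at h2
  rw [h1, h2]
  ext v
  have : ∀ y, e y = t • y := fun y => rfl
  simp [this, ContinuousMultilinearMap.map_smul_univ]

lemma norm_iteratedFDeriv_bilin (B : V →L[ℝ] W →L[ℝ] G) {f : X → V} {g : X → W} {z : X} {k q : ℕ}
    (hf : ContDiffAt ℝ k f z) (hg : ContDiffAt ℝ k g z) (hq : q ≤ k) :
    ‖iteratedFDeriv ℝ q (fun y => B (f y) (g y)) z‖ ≤ ‖B‖ * ∑ i ∈ Finset.range (q + 1),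
      (q.choose i : ℝ) * ‖iteratedFDeriv ℝ i f z‖ * ‖iteratedFDeriv ℝ (q - i) g z‖ := by
  obtain ⟨u, hu, hz, h⟩ := exists_isOpen_contDiffOn hf
  obtain ⟨u', hu', hz', h'⟩ := exists_isOpen_contDiffOn hg
  have ho := hu.inter hu'
  have := B.norm_iteratedFDerivWithin_le_of_bilinear (h.mono Set.inter_subset_left)
    (h'.mono Set.inter_subset_right) ho.uniqueDiffOn ⟨hz, hz'⟩ (n := q) (by exact_mod_cast hq)
  simpa only [iteratedFDerivWithin_of_isOpen _ ho (show z ∈ u ∩ u' from ⟨hz, hz'⟩)] using this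

/-- The order-dependent weights are left abstract because the Leibniz estimate is needed with
constant weights, with powers of a scale and with truncated powers; the factor 2 ^ q is the sum of
the binomial coefficients. -/
lemma norm_iteratedFDeriv_bilin_weighted (B : V →L[ℝ] W →L[ℝ] G) {f : X → V} {g : X → W} {z : X}
    {k q : ℕ} (hf : ContDiffAt ℝ k f z) (hg : ContDiffAt ℝ k g z) (hq : q ≤ k)
    {w₁ w₂ : ℕ → ℝ} {w A A' : ℝ} (hA : 0 ≤ A) (hA' : 0 ≤ A')
    (h1 : ∀ j ≤ q, ‖iteratedFDeriv ℝ j f z‖ ≤ A * w₁ j)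
    (h2 : ∀ j ≤ q, ‖iteratedFDeriv ℝ j g z‖ ≤ A' * w₂ j)
    (hw : ∀ j ≤ q, w₁ j * w₂ (q - j) ≤ w) :
    ‖iteratedFDeriv ℝ q (fun y => B (f y) (g y)) z‖ ≤ ‖B‖ * 2 ^ q * A * A' * w := by
  refine (norm_iteratedFDeriv_bilin B hf hg hq).trans ?_
  have : ∑ i ∈ Finset.range (q + 1), (q.choose i : ℝ) * ‖iteratedFDeriv ℝ i f z‖ *
      ‖iteratedFDeriv ℝ (q - i) g z‖ ≤ ∑ i ∈ Finset.range (q + 1), (q.choose i : ℝ) * (A * A' * w) := by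
    refine Finset.sum_le_sum fun i hi => ?_
    have hi' : i ≤ q := Nat.lt_succ_iff.1 (Finset.mem_range.1 hi)
    rw [mul_assoc]
    refine mul_le_mul_of_nonneg_left ?_ (by positivity)
    calc ‖iteratedFDeriv ℝ i f z‖ * ‖iteratedFDeriv ℝ (q - i) g z‖
        ≤ (A * w₁ i) * (A' * w₂ (q - i)) :=
          mul_le_mul (h1 i hi') (h2 _ (Nat.sub_le _ _)) (norm_nonneg _)
            ((norm_nonneg _).trans (h1 i hi'))
      _ = A * A' * (w₁ i * w₂ (q - i)) := by ring
      _ ≤ A * A' * w := mul_le_mul_of_nonneg_left (hw i hi') (by positivity)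
  calc ‖B‖ * _ ≤ ‖B‖ * ∑ i ∈ Finset.range (q + 1), (q.choose i : ℝ) * (A * A' * w) :=
        mul_le_mul_of_nonneg_left this (norm_nonneg B)
    _ = ‖B‖ * 2 ^ q * A * A' * w := by
        rw [← Finset.sum_mul]
        have : (∑ i ∈ Finset.range (q + 1), (q.choose i : ℝ)) = 2 ^ q := by
          exact_mod_cast Nat.sum_range_choose q
        rw [this]; ring

lemma norm_iteratedFDeriv_comp {f : V → G} {T : X → V} {z : X} {k q : ℕ}
    (hf : ContDiffAt ℝ k f (T z)) (hT : ContDiffAt ℝ k T z) (hq : q ≤ k) {C D : ℝ}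
    (hC : ∀ j ≤ q, ‖iteratedFDeriv ℝ j f (T z)‖ ≤ C)
    (hD : ∀ j, 1 ≤ j → j ≤ q → ‖iteratedFDeriv ℝ j T z‖ ≤ D ^ j) :
    ‖iteratedFDeriv ℝ q (fun y => f (T y)) z‖ ≤ q.factorial * C * D ^ q := by
  obtain ⟨u, hu, hz, h⟩ := exists_isOpen_contDiffOn hf
  obtain ⟨u', hu', hz', h'⟩ := exists_isOpen_contDiffOn hT
  have ho : IsOpen (u' ∩ T ⁻¹' u) := h'.continuousOn.isOpen_inter_preimage hu' hu
  have hz2 : z ∈ u' ∩ T ⁻¹' u := ⟨hz', hz⟩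
  have := norm_iteratedFDerivWithin_comp_le (n := q) h (h'.mono Set.inter_subset_left)
    (by exact_mod_cast hq) hu.uniqueDiffOn ho.uniqueDiffOn (fun y hy => hy.2) hz2 (C := C) (D := D)
    (fun i hi => by rw [iteratedFDerivWithin_of_isOpen _ hu hz]; exact hC i hi)
    (fun i hi hi' => by rw [iteratedFDerivWithin_of_isOpen _ ho hz2]; exact hD i hi hi')
  rwa [iteratedFDerivWithin_of_isOpen _ ho hz2] at this

/-- Bounds for the derivatives of a composition, with derivatives measured at the scale `ε`. -/
lemma norm_iteratedFDeriv_comp_scale {f : V → G} {T : X → V} {z : X} {k q : ℕ}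
    (hf : ContDiffAt ℝ k f (T z)) (hT : ContDiffAt ℝ k T z) (hq : q ≤ k) {C D ε : ℝ} (hε : 0 < ε)
    (hC : ∀ j ≤ q, ε ^ j * ‖iteratedFDeriv ℝ j f (T z)‖ ≤ C)
    (hD : ∀ j, 1 ≤ j → j ≤ q → ε ^ j * ‖iteratedFDeriv ℝ j T z‖ ≤ ε * D ^ j) :
    ε ^ q * ‖iteratedFDeriv ℝ q (fun y => f (T y)) z‖ ≤ q.factorial * C * D ^ q := by
  have hne : ε ≠ 0 := hε.ne'
  have haff : ContDiff ℝ k (fun y : X => z + ε • y) := by fun_prop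
  have hT0 : ContDiffAt ℝ k (fun y : X => T (z + ε • y)) 0 := by
    refine ContDiffAt.comp (0 : X) (g := T) ?_ haff.contDiffAt
    simpa using hT
  have hT1 : ContDiffAt ℝ k (fun y : X => ε⁻¹ • (T (z + ε • y) - T z)) 0 :=
    (hT0.sub contDiffAt_const).const_smul ε⁻¹
  -- Both maps are rescaled by ε around z and T z. The composition of the rescaled maps is the
  -- rescaled composition, so the unscaled estimate applies at the origin.
  have h1 := norm_iteratedFDeriv_comp (f := fun w => f (T z + ε • w))
    (T := fun y : X => ε⁻¹ • (T (z + ε • y) - T z)) (z := 0) (k := k) (q := q) (C := C) (D := D)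
    ?_ hT1 hq ?_ ?_
  · have h2 : (fun y : X => f (T z + ε • (ε⁻¹ • (T (z + ε • y) - T z)))) =
        fun y => f (T (z + ε • y)) := by
      ext y; rw [smul_smul, mul_inv_cancel₀ hne, one_smul, add_sub_cancel]
    rw [h2, iteratedFDeriv_comp_affine (fun y => f (T y)) z hne, smul_zero, add_zero, norm_smul,
      norm_pow, Real.norm_of_nonneg hε.le] at h1
    exact h1
  · refine ContDiffAt.comp _ (g := f) ?_ (by fun_prop)
    simpa using hf
  · intro j hj
    rw [iteratedFDeriv_comp_affine f (T z) hne, norm_smul, norm_pow, Real.norm_of_nonneg hε.le]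
    simpa using hC j hj
  · intro j hj1 hj
    have h3 : ContDiffAt ℝ j (fun y : X => T (z + ε • y) - T z) 0 :=
      (hT0.sub contDiffAt_const).of_le (by exact_mod_cast hj.trans hq)
    rw [iteratedFDeriv_const_smul_apply' h3,
      iteratedFDeriv_sub_at (hT0.of_le (by exact_mod_cast hj.trans hq)) contDiffAt_const,
      iteratedFDeriv_const_of_ne (by omega),
      iteratedFDeriv_comp_affine T z hne, norm_smul]
    simp only [smul_zero, add_zero, Pi.zero_apply, sub_zero, norm_smul, norm_pow,
      Real.norm_of_nonneg hε.le, norm_inv]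
    rw [inv_mul_le_iff₀ hε]
    exact hD j hj1 hj

end Jets

/-! ### Taylor polynomials and their remainders -/

section Taylor

variable {X V : Type*} [NormedAddCommGroup X] [NormedSpace ℝ X]
  [NormedAddCommGroup V] [NormedSpace ℝ V]

lemma hasFDerivAt_clm_comp {W : Type*} [NormedAddCommGroup W] [NormedSpace ℝ W] (L : V →L[ℝ] W)
    {g : X → V} {x : X} (hg : DifferentiableAt ℝ g x) :
    HasFDerivAt (L ∘ g) (L.comp (fderiv ℝ g x)) x :=
  L.hasFDerivAt.comp x hg.hasFDerivAt

/-- Swapping the first two arguments is the symmetry of a second derivative, applied to the iterated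
derivative of order two less. The other adjacent swaps come from differentiating the identity of one
order lower, which holds in a neighborhood. -/
lemma iteratedFDeriv_comp_swap {k : ℕ} : ∀ {f : X → V} {x : X}, ContDiffAt ℝ (k + 1 : ℕ) f x →
    ∀ (i : Fin k) (v : Fin (k + 1) → X),
    iteratedFDeriv ℝ (k + 1) f x (v ∘ Equiv.swap i.castSucc i.succ) =
      iteratedFDeriv ℝ (k + 1) f x v := by
  induction k with
  | zero => intro f x _ i; exact i.elim0
  | succ k ih =>
    intro f x hf i v
    have hd : DifferentiableAt ℝ (iteratedFDeriv ℝ (k + 1) f) x :=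
      hf.differentiableAt_iteratedFDeriv (by exact_mod_cast Nat.lt_succ_self _)
    refine Fin.cases ?_ (fun i => ?_) i
    · have h2 : ContDiffAt ℝ 2 (iteratedFDeriv ℝ k f) x := by
        refine hf.iteratedFDeriv_right (m := 2) ?_
        norm_cast
        omega
      have hs : IsSymmSndFDerivAt ℝ (iteratedFDeriv ℝ k f) x := h2.isSymmSndFDerivAt (by simp)
      have key : ∀ w : Fin (k + 1 + 1) → X, iteratedFDeriv ℝ (k + 1 + 1) f x w =
          fderiv ℝ (fderiv ℝ (iteratedFDeriv ℝ k f)) x (w 0) (w 1) (fun i => w i.succ.succ) := by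
        intro w
        have h3 : HasFDerivAt (iteratedFDeriv ℝ (k + 1) f)
            (((continuousMultilinearCurryLeftEquiv ℝ (fun _ : Fin (k + 1) => X)
              V).symm.toContinuousLinearEquiv.toContinuousLinearMap).comp
              (fderiv ℝ (fderiv ℝ (iteratedFDeriv ℝ k f)) x)) x := by
          rw [iteratedFDeriv_succ_eq_comp_left]
          have h4 : DifferentiableAt ℝ (fderiv ℝ (iteratedFDeriv ℝ k f)) x :=
            (h2.fderiv_right (m := 1) (by norm_num)).differentiableAt (by simp)
          exact hasFDerivAt_clm_comp (X := X) (V := X →L[ℝ] X [×k]→L[ℝ] V)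
            (W := X [×(k + 1)]→L[ℝ] V) (continuousMultilinearCurryLeftEquiv ℝ
              (fun _ : Fin (k + 1) => X) V).symm.toContinuousLinearEquiv.toContinuousLinearMap h4
        rw [iteratedFDeriv_succ_apply_left, h3.fderiv]
        rfl
      rw [key, key]
      simp only [comp_apply]
      have e0 : Equiv.swap (Fin.castSucc (0 : Fin (k + 1))) (Fin.succ 0) 0 = 1 := by
        simp
      have e1 : Equiv.swap (Fin.castSucc (0 : Fin (k + 1))) (Fin.succ 0) 1 = 0 := by
        simp
      have e2 : ∀ j : Fin k, Equiv.swap (Fin.castSucc (0 : Fin (k + 1))) (Fin.succ 0) j.succ.succ =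
          j.succ.succ := fun j => by
        refine Equiv.swap_apply_of_ne_of_ne ?_ ?_
        · simp [Fin.ext_iff]
        · simp [Fin.ext_iff]
      rw [e0, e1, hs.eq]
      simp only [e2]
    · have hev : ∀ᶠ y in 𝓝 x, ∀ w, iteratedFDeriv ℝ (k + 1) f y
          (w ∘ Equiv.swap i.castSucc i.succ) = iteratedFDeriv ℝ (k + 1) f y w := by
        filter_upwards [eventually_contDiffAt (hf.of_le (m := (k + 1 : ℕ)) (by
          exact_mod_cast Nat.le_succ _))] with y hy w
        exact ih hy i w
      rw [iteratedFDeriv_succ_apply_left, iteratedFDeriv_succ_apply_left]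
      have e0 : Equiv.swap i.succ.castSucc i.succ.succ 0 = 0 := by
        refine Equiv.swap_apply_of_ne_of_ne ?_ ?_
        · simp [Fin.ext_iff]
        · simp [Fin.ext_iff]
      have e1 : Fin.tail (v ∘ Equiv.swap i.succ.castSucc i.succ.succ) =
          Fin.tail v ∘ Equiv.swap i.castSucc i.succ := by
        ext j
        simp only [Fin.tail, comp_apply]
        congr 1
        rw [show i.succ.castSucc = i.castSucc.succ from rfl]
        exact (Function.Injective.swap_apply (Fin.succ_injective _) _ _ _)
      rw [e1, comp_apply, e0]
      have h5 : ∀ w : Fin (k + 1) → X, fderiv ℝ (iteratedFDeriv ℝ (k + 1) f) x (v 0) w =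
          fderiv ℝ (fun y => iteratedFDeriv ℝ (k + 1) f y w) x (v 0) := by
        intro w
        have := (ContinuousMultilinearMap.apply ℝ (fun _ : Fin (k + 1) => X) V
          w).hasFDerivAt.comp x hd.hasFDerivAt
        have h6 : HasFDerivAt (fun y => iteratedFDeriv ℝ (k + 1) f y w) _ x := this
        rw [h6.fderiv]; rfl
      rw [h5, h5]
      have h7 : (fun y => iteratedFDeriv ℝ (k + 1) f y (Fin.tail v ∘ Equiv.swap i.castSucc i.succ))
          =ᶠ[𝓝 x] fun y => iteratedFDeriv ℝ (k + 1) f y (Fin.tail v) :=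
        hev.mono fun y hy => hy _
      rw [h7.fderiv_eq]

/-- The iterated derivative of a `C^k` function is symmetric. -/
lemma iteratedFDeriv_symm {k : ℕ} {f : X → V} {x : X} (hf : ContDiffAt ℝ k f x)
    (σ : Equiv.Perm (Fin k)) (v : Fin k → X) :
    iteratedFDeriv ℝ k f x (v ∘ σ) = iteratedFDeriv ℝ k f x v := by
  cases k with
  | zero => congr 1; ext i; exact i.elim0
  | succ k =>
    -- Adjacent transpositions generate the symmetric group, already as a monoid.
    have hσ : σ ∈ Submonoid.closure (Set.range fun i : Fin k => Equiv.swap i.castSucc i.succ) := by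
      rw [Equiv.Perm.mclosure_swap_castSucc_succ]; trivial
    induction hσ using Submonoid.closure_induction generalizing v with
    | mem τ hτ =>
      obtain ⟨i, rfl⟩ := hτ
      exact iteratedFDeriv_comp_swap hf i v
    | one => rfl
    | mul σ τ _ _ h1 h2 =>
      rw [Equiv.Perm.coe_mul, ← comp_assoc, h2, h1]

/-- The Taylor polynomial of degree less than `m`. -/
def taylorPoly (m : ℕ) (g : X → V) (c z : X) : V :=
  ∑ j ∈ Finset.range m, ((j.factorial : ℝ))⁻¹ • iteratedFDeriv ℝ j g c (fun _ => z - c)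

/-- The Taylor series, truncated. -/
def taylorSer (m : ℕ) (g : X → V) (c : X) : FormalMultilinearSeries ℝ X V := fun j =>
  if j < m then ((j.factorial : ℝ))⁻¹ • iteratedFDeriv ℝ j g c else 0

lemma hasFiniteFPowerSeries_taylorPoly (m : ℕ) (g : X → V) (c : X) :
    HasFiniteFPowerSeriesOnBall (taylorPoly m g c) (taylorSer m g c) c m ⊤ := by
  refine HasFiniteFPowerSeriesOnBall.mk' ?_ (by simp) ?_
  · intro j hj; simp [taylorSer, hj]
  · intro y _
    simp only [taylorPoly, add_sub_cancel_left]
    refine Finset.sum_congr rfl fun i hi => ?_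
    simp [taylorSer, Finset.mem_range.1 hi]

variable [CompleteSpace V]

lemma contDiff_taylorPoly (m : ℕ) (g : X → V) (c : X) (N : WithTop ℕ∞) :
    ContDiff ℝ N (taylorPoly m g c) := by
  have h := (hasFiniteFPowerSeries_taylorPoly m g c).toHasFPowerSeriesOnBall.analyticOnNhd
  rw [contDiff_iff_contDiffAt]
  exact fun x => (h x (by simp)).contDiffAt

/-- A derivative of a power series at its center is the sum of the coefficient over all permutations
of the arguments. By symmetry the q! summands agree, which cancels the 1/q!. -/
lemma iteratedFDeriv_taylorPoly_center {m q : ℕ} {g : X → V} {c : X} (hg : ContDiffAt ℝ q g c)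
    (hq : q < m) : iteratedFDeriv ℝ q (taylorPoly m g c) c = iteratedFDeriv ℝ q g c := by
  ext v
  rw [(hasFiniteFPowerSeries_taylorPoly m g
    c).toHasFPowerSeriesOnBall.iteratedFDeriv_eq_sum_of_completeSpace]
  have : ∀ σ : Equiv.Perm (Fin q), taylorSer m g c q (fun i => v (σ i)) =
      ((q.factorial : ℝ))⁻¹ • iteratedFDeriv ℝ q g c v := by
    intro σ
    have := iteratedFDeriv_symm hg σ v
    simp only [taylorSer, hq, if_true, _root_.smul_apply]
    rw [← this]; rfl
  simp only [this, Finset.sum_const, Finset.card_univ, Fintype.card_perm, Fintype.card_fin]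
  rw [← Nat.cast_smul_eq_nsmul ℝ, smul_smul, mul_inv_cancel₀ (by positivity), one_smul]

/-- The polynomial is re-expanded around z, where it still has degree less than m. -/
lemma iteratedFDeriv_taylorPoly_of_le {m q : ℕ} (g : X → V) (c z : X)
    (hq : m ≤ q) : iteratedFDeriv ℝ q (taylorPoly m g c) z = 0 := by
  ext v
  have h := (hasFiniteFPowerSeries_taylorPoly m g c).changeOrigin (y := z - c) (by simp)
  rw [add_sub_cancel] at h
  rw [h.toHasFPowerSeriesOnBall.iteratedFDeriv_eq_sum_of_completeSpace]
  simp [h.finite q hq]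

/-- The polynomial has degree less than m, so the derivative of order m of the remainder is that of
g. Its lower derivatives vanish at c, and each mean value inequality on the convex set costs one
factor R. -/
lemma norm_iteratedFDeriv_sub_taylorPoly {m : ℕ} {g : X → V} {B : Set X} {c : X} {M R : ℝ}
    (hB : IsOpen B) (hBc : Convex ℝ B) (hc : c ∈ B) (hg : ContDiffOn ℝ m g B)
    (hR : ∀ z ∈ B, ‖z - c‖ ≤ R) (hM : ∀ z ∈ B, ‖iteratedFDeriv ℝ m g z‖ ≤ M) {q : ℕ} (hq : q ≤ m) :
    ∀ z ∈ B, ‖iteratedFDeriv ℝ q (fun y => g y - taylorPoly m g c y) z‖ ≤ M * R ^ (m - q) := by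
  have hgc : ∀ z ∈ B, ContDiffAt ℝ m g z := fun z hz => hg.contDiffAt (hB.mem_nhds hz)
  have he : ∀ z ∈ B, ContDiffAt ℝ m (fun y => g y - taylorPoly m g c y) z := fun z hz =>
    (hgc z hz).sub (contDiff_taylorPoly m g c m).contDiffAt
  have hM0 : 0 ≤ M := (norm_nonneg _).trans (hM c hc)
  have hR0 : 0 ≤ R := (norm_nonneg _).trans (hR c hc)
  -- Downward induction on the order m - p.
  have main : ∀ p ≤ m, ∀ z ∈ B,
      ‖iteratedFDeriv ℝ (m - p) (fun y => g y - taylorPoly m g c y) z‖ ≤ M * R ^ p := by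
    intro p
    induction p with
    | zero =>
      intro _ z hz
      simp only [Nat.sub_zero, pow_zero, mul_one]
      rw [iteratedFDeriv_sub_at (hgc z hz) (contDiff_taylorPoly m g c m).contDiffAt,
        iteratedFDeriv_taylorPoly_of_le g c z le_rfl, sub_zero]
      exact hM z hz
    | succ p ih =>
      intro hp z hz
      have hlt : m - (p + 1) < m := by omega
      have hd : ∀ y ∈ B, DifferentiableAt ℝ (iteratedFDeriv ℝ (m - (p + 1))
          (fun y => g y - taylorPoly m g c y)) y := fun y hy =>
        (he y hy).differentiableAt_iteratedFDeriv (by exact_mod_cast hlt)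
      have h0 : iteratedFDeriv ℝ (m - (p + 1)) (fun y => g y - taylorPoly m g c y) c = 0 := by
        have hle : ((m - (p + 1) : ℕ) : WithTop ℕ∞) ≤ m := by exact_mod_cast hlt.le
        rw [iteratedFDeriv_sub_at ((hgc c hc).of_le hle) (contDiff_taylorPoly m g c _).contDiffAt,
          iteratedFDeriv_taylorPoly_center ((hgc c hc).of_le hle) hlt, sub_self]
      have hb : ∀ y ∈ B, ‖fderiv ℝ (iteratedFDeriv ℝ (m - (p + 1))
          (fun y => g y - taylorPoly m g c y)) y‖ ≤ M * R ^ p := fun y hy => by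
        rw [norm_fderiv_iteratedFDeriv, show m - (p + 1) + 1 = m - p by omega]
        exact ih (by omega) y hy
      have := hBc.norm_image_sub_le_of_norm_fderiv_le hd hb hc hz
      rw [h0, sub_zero] at this
      refine this.trans ?_
      rw [pow_succ, ← mul_assoc]
      exact mul_le_mul_of_nonneg_left (hR z hz) (by positivity)
  intro z hz
  have := main (m - q) (Nat.sub_le _ _) z hz
  rwa [Nat.sub_sub_self hq] at this

end Taylor

end WAH

end

noncomputable section

namespace WAH

open Filter Topology Function

/-! ### Functions with all derivatives bounded on a set -/

section BddJets

variable {X V W G : Type*} [NormedAddCommGroup X] [NormedSpace ℝ X]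
  [NormedAddCommGroup V] [NormedSpace ℝ V] [NormedAddCommGroup W] [NormedSpace ℝ W]
  [NormedAddCommGroup G] [NormedSpace ℝ G]

/-- `f` is smooth at the points of `S`, with all derivatives bounded on `S`. -/
structure BddJets (f : X → V) (S : Set X) : Prop where
  contDiffAt : ∀ z ∈ S, ContDiffAt ℝ (∞ : WithTop ℕ∞) f z
  bound : ∀ k : ℕ, ∃ C : ℝ, 0 ≤ C ∧ ∀ z ∈ S, ∀ j ≤ k, ‖iteratedFDeriv ℝ j f z‖ ≤ C

variable {f : X → V} {S S' : Set X}

lemma BddJets.contDiffAt_nat (h : BddJets f S) {z : X} (hz : z ∈ S) (k : ℕ) :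
    ContDiffAt ℝ k f z := (h.contDiffAt z hz).of_le (natCast_le_infty k)

lemma bddJets_of_forall (h : ∀ z ∈ S, ContDiffAt ℝ (∞ : WithTop ℕ∞) f z)
    (h' : ∀ k : ℕ, ∃ C : ℝ, ∀ z ∈ S, ‖iteratedFDeriv ℝ k f z‖ ≤ C) : BddJets f S := by
  refine ⟨h, fun k => ?_⟩
  choose C hC using h'
  refine ⟨∑ j ∈ Finset.range (k + 1), |C j|, Finset.sum_nonneg fun _ _ => abs_nonneg _,
    fun z hz j hj => (hC j z hz).trans ((le_abs_self _).trans ?_)⟩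
  exact Finset.single_le_sum (f := fun j => |C j|) (fun _ _ => abs_nonneg _)
    (Finset.mem_range.2 (Nat.lt_succ_of_le hj))

lemma BddJets.congr {g : X → V} (h : BddJets f S) (hfg : ∀ z ∈ S, g =ᶠ[𝓝 z] f) : BddJets g S := by
  refine ⟨fun z hz => (h.contDiffAt z hz).congr_of_eventuallyEq (hfg z hz), fun k => ?_⟩
  obtain ⟨C, hC, h1⟩ := h.bound k
  refine ⟨C, hC, fun z hz j hj => ?_⟩
  rw [((hfg z hz).iteratedFDeriv ℝ j).self_of_nhds]
  exact h1 z hz j hj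

/-- This is how smoothness up to the boundary becomes a uniform bound: derivatives within s are
continuous on the compact set L, which may touch the boundary, and agree with the full derivatives
on S, near whose points s is a neighborhood. -/
lemma ContDiffOn.bddJets {s L : Set X} (h : ContDiffOn ℝ (∞ : WithTop ℕ∞) f s)
    (hs : UniqueDiffOn ℝ s) (hL : IsCompact L) (hLs : L ⊆ s) (hS : S ⊆ L) (hS' : ∀ z ∈ S, s ∈ 𝓝 z) :
    BddJets f S := by
  have h0 : ∀ z ∈ S, ContDiffAt ℝ (∞ : WithTop ℕ∞) f z := fun z hz => h.contDiffAt (hS' z hz)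
  refine bddJets_of_forall h0 fun k => ?_
  have hc : ContinuousOn (iteratedFDerivWithin ℝ k f s) L :=
    (h.continuousOn_iteratedFDerivWithin (natCast_le_infty k) hs).mono hLs
  obtain ⟨C, hC⟩ := hL.exists_bound_of_continuousOn hc
  refine ⟨C, fun z hz => ?_⟩
  rw [← iteratedFDerivWithin_eq_iteratedFDeriv hs ((h0 z hz).of_le (natCast_le_infty k))
    (mem_of_mem_nhds (hS' z hz))]
  exact hC z (hS hz)

lemma BddJets.fderiv (h : BddJets f S) : BddJets (fderiv ℝ f) S := by
  refine ⟨fun z hz => (h.contDiffAt z hz).fderiv_right (m := (∞ : WithTop ℕ∞)) (by simp), fun k => ?_⟩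
  obtain ⟨C, hC, h1⟩ := h.bound (k + 1)
  refine ⟨C, hC, fun z hz j hj => ?_⟩
  rw [norm_iteratedFDeriv_fderiv]
  exact h1 z hz _ (by omega)

lemma BddJets.bilin {g : X → W} (B : V →L[ℝ] W →L[ℝ] G) (hf : BddJets f S) (hg : BddJets g S) :
    BddJets (fun z => B (f z) (g z)) S := by
  refine bddJets_of_forall (fun z hz => ?_) fun k => ?_
  · exact B.isBoundedBilinearMap.contDiff.contDiffAt.comp₂ (hf.contDiffAt z hz) (hg.contDiffAt z hz)
  · obtain ⟨C, hC, h1⟩ := hf.bound k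
    obtain ⟨C', hC', h2⟩ := hg.bound k
    refine ⟨‖B‖ * 2 ^ k * C * C' * 1, fun z hz => ?_⟩
    exact norm_iteratedFDeriv_bilin_weighted B (hf.contDiffAt_nat hz k) (hg.contDiffAt_nat hz k)
      le_rfl hC hC' (w₁ := fun _ => 1) (w₂ := fun _ => 1)
      (fun j hj => by simpa using h1 z hz j hj) (fun j hj => by simpa using h2 z hz j hj)
      (fun _ _ => by norm_num)

lemma BddJets.comp {g : V → W} {S' : Set V} (hg : BddJets g S') (hf : BddJets f S)
    (hS : Set.MapsTo f S S') : BddJets (fun z => g (f z)) S := by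
  refine bddJets_of_forall (fun z hz => ?_) fun k => ?_
  · exact (hg.contDiffAt _ (hS hz)).comp z (hf.contDiffAt z hz)
  · obtain ⟨C, hC, h1⟩ := hf.bound k
    obtain ⟨C', hC', h2⟩ := hg.bound k
    refine ⟨k.factorial * C' * (max 1 C) ^ k, fun z hz => ?_⟩
    refine norm_iteratedFDeriv_comp (hg.contDiffAt_nat (hS hz) k) (hf.contDiffAt_nat hz k) le_rfl
      (h2 _ (hS hz)) fun j hj1 hj => (h1 z hz j hj).trans ((le_max_right 1 C).trans ?_)
    exact le_self_pow₀ (le_max_left _ _) (by omega)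

lemma BddJets.prodMk {g : X → W} (hf : BddJets f S) (hg : BddJets g S) :
    BddJets (fun z => (f z, g z)) S := by
  refine bddJets_of_forall (fun z hz => (hf.contDiffAt z hz).prodMk (hg.contDiffAt z hz)) fun k => ?_
  obtain ⟨C, hC, h1⟩ := hf.bound k
  obtain ⟨C', hC', h2⟩ := hg.bound k
  refine ⟨max C C', fun z hz => ?_⟩
  have h3 := iteratedFDeriv_prodMk (hf.contDiffAt_nat hz k) (hg.contDiffAt_nat hz k) (i := k) le_rfl
  rw [h3, ContinuousMultilinearMap.opNorm_prod]
  exact max_le_max (h1 z hz k le_rfl) (h2 z hz k le_rfl)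

lemma bddJets_of_isBounded [FiniteDimensional ℝ X] (h : ContDiff ℝ (∞ : WithTop ℕ∞) f)
    (hS : Bornology.IsBounded S) : BddJets f S := by
  have := FiniteDimensional.proper ℝ X
  exact ContDiffOn.bddJets h.contDiffOn uniqueDiffOn_univ hS.isCompact_closure (Set.subset_univ _)
    subset_closure (fun _ _ => univ_mem)

lemma BddJets.isBounded_image (h : BddJets f S) : Bornology.IsBounded (f '' S) := by
  obtain ⟨C, -, h1⟩ := h.bound 0
  refine isBounded_iff_forall_norm_le.2 ⟨C, ?_⟩
  rintro _ ⟨z, hz, rfl⟩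
  simpa using h1 z hz 0 le_rfl

lemma BddJets.contDiff_comp [FiniteDimensional ℝ V] {g : V → W}
    (hg : ContDiff ℝ (∞ : WithTop ℕ∞) g) (hf : BddJets f S) : BddJets (fun z => g (f z)) S :=
  (bddJets_of_isBounded hg hf.isBounded_image).comp hf (Set.mapsTo_image f S)

lemma BddJets.clm (L : V →L[ℝ] W) (hf : BddJets f S) : BddJets (fun z => L (f z)) S := by
  refine bddJets_of_forall (fun z hz => L.contDiff.contDiffAt.comp z (hf.contDiffAt z hz)) fun k => ?_
  obtain ⟨C, hC, h1⟩ := hf.bound k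
  refine ⟨‖L‖ * C, fun z hz => ?_⟩
  exact (L.norm_iteratedFDeriv_comp_left (hf.contDiffAt_nat hz k) le_rfl).trans
    (mul_le_mul_of_nonneg_left (h1 z hz k le_rfl) (norm_nonneg _))

end BddJets

end WAH

end

noncomputable section

namespace WAH

open Filter Topology Function IsManifold

set_option linter.unusedSectionVars false

lemma inverse_eq_of_comp_eq_id {V W : Type*} [NormedAddCommGroup V] [NormedSpace ℝ V]
    [NormedAddCommGroup W] [NormedSpace ℝ W] {A : V →L[ℝ] W} {B : W →L[ℝ] V} (hA : A.IsInvertible)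
    (h : B.comp A = ContinuousLinearMap.id ℝ V) : A.inverse = B := by
  have h3 := congrArg (fun C => C.comp A.inverse) h
  rw [ContinuousLinearMap.comp_assoc, hA.self_comp_inverse] at h3
  simpa using h3.symm

/-! ### Uniform bounds for coordinate changes -/

section ChartJets

variable {n : ℕ} {Mb : Type*} [TopologicalSpace Mb] [ChartedSpace (EuclideanHalfSpace (n + 1)) Mb]
  {a b : ℕ} {e e' : OpenPartialHomeomorph Mb (EuclideanHalfSpace (n + 1))} {z : EE n}

/-- The interior coordinate points of a chart whose image lies in `K`. -/
def cset (e : OpenPartialHomeomorph Mb (EuclideanHalfSpace (n + 1))) (K : Set Mb) : Set (EE n) :=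
  {z | z ∈ cdom e ∧ cpar e z ∈ K}

lemma isCompact_ccoord_image {K : Set Mb} (hK : IsCompact K) (hKe : K ⊆ e.source) :
    IsCompact (ccoord e '' K) :=
  hK.image_of_continuousOn fun _ hp => (continuousAt_ccoord (hKe hp)).continuousWithinAt

lemma cset_subset {K : Set Mb} : cset e K ⊆ ccoord e '' K :=
  fun z hz => ⟨cpar e z, hz.2, ccoord_cpar hz.1⟩

lemma bddJets_ctrans (he : e ∈ maximalAtlas (𝓡∂ (n + 1)) ∞ Mb)
    (he' : e' ∈ maximalAtlas (𝓡∂ (n + 1)) ∞ Mb) {K : Set Mb} (hK : IsCompact K)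
    (hKe : K ⊆ e.source) (hKe' : K ⊆ e'.source) : BddJets (ctrans e e') (cset e K) := by
  refine ContDiffOn.bddJets ((𝓡∂ (n + 1)).contDiffOn_extendCoordChange he he')
    ModelWithCorners.uniqueDiffOn_extendCoordChange_source (isCompact_ccoord_image hK hKe) ?_
    cset_subset (fun z hz => extendCoordChange_source_mem_nhds hz.1 (hKe' hz.2))
  rw [← OpenPartialHomeomorph.extend_image_source_inter]
  exact Set.image_mono fun p hp => ⟨hKe hp, hKe' hp⟩

lemma fderiv_ctrans_inverse (he : e ∈ maximalAtlas (𝓡∂ (n + 1)) ∞ Mb)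
    (he' : e' ∈ maximalAtlas (𝓡∂ (n + 1)) ∞ Mb) (hz : z ∈ cdom e) (hz' : cpar e z ∈ e'.source) :
    (fderiv ℝ (ctrans e e') z).inverse = fderiv ℝ (ctrans e' e) (ctrans e e' z) := by
  have hw := ctrans_mem_cdom he he' hz hz'
  have hw' : cpar e' (ctrans e e' z) ∈ e.source := by
    rw [cpar_ctrans hz']; exact cpar_mem_source hz
  have h1 : ctrans e' e ∘ ctrans e e' =ᶠ[𝓝 z] id := by
    filter_upwards [eventually_mem_cdom_source hz hz'] with y hy
    exact ctrans_ctrans hy.1 hy.2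
  have h2 := h1.fderiv_eq (𝕜 := ℝ)
  rw [fderiv_comp z ((contDiffAt_ctrans he' he hw hw').differentiableAt (by simp))
    ((contDiffAt_ctrans he he' hz hz').differentiableAt (by simp)), fderiv_id] at h2
  have hi := isInvertible_fderiv_ctrans he he' hz hz'
  exact inverse_eq_of_comp_eq_id (V := EE n) (W := EE n) hi h2

/-- The transformation of the components of tensor fields under a coordinate change. -/
def ctens (a b : ℕ) (e e' : OpenPartialHomeomorph Mb (EuclideanHalfSpace (n + 1))) (z : EE n) :
    Tensor n a b →L[ℝ] Tensor n a b :=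
  Tensor.pullL (fderiv ℝ (ctrans e e') z) (fderiv ℝ (ctrans e e') z).inverse

lemma pbk_ctrans (T : EE n → Tensor n a b) :
    pbk (ctrans e e') T z = ctens a b e e' z (T (ctrans e e' z)) := rfl

/-- The inverse of the derivative is the derivative of the inverse coordinate change, so its bounds
need no lower bound on a determinant; `pullL` is a smooth function of the pair. -/
lemma bddJets_ctens (he : e ∈ maximalAtlas (𝓡∂ (n + 1)) ∞ Mb)
    (he' : e' ∈ maximalAtlas (𝓡∂ (n + 1)) ∞ Mb) {K : Set Mb} (hK : IsCompact K)
    (hKe : K ⊆ e.source) (hKe' : K ⊆ e'.source) : BddJets (ctens a b e e') (cset e K) := by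
  have h1 := (bddJets_ctrans he he' hK hKe hKe').fderiv
  have h2 := (bddJets_ctrans he' he hK hKe' hKe).fderiv.comp (bddJets_ctrans he he' hK hKe hKe')
    (fun z hz => ⟨ctrans_mem_cdom he he' hz.1 (hKe' hz.2), by
      rw [cpar_ctrans (hKe' hz.2)]; exact hz.2⟩)
  have h3 := BddJets.contDiff_comp (contDiff_pullL n a b) (h1.prodMk h2)
  refine h3.congr fun z hz => ?_
  filter_upwards [eventually_mem_cdom_source hz.1 (hKe' hz.2)] with y hy
  rw [ctens, fderiv_ctrans_inverse he he' hy.1 hy.2]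

end ChartJets

/-! ### Vector fields, metrics and Christoffel symbols up to the boundary -/

section Geometry

variable {n : ℕ} {Mb : Type*} [TopologicalSpace Mb] [ChartedSpace (EuclideanHalfSpace (n + 1)) Mb]
  [IsManifold (𝓡∂ (n + 1)) ∞ Mb]
  {a b : ℕ} {e e' : OpenPartialHomeomorph Mb (EuclideanHalfSpace (n + 1))} {z : EE n}

lemma extend_target_mem_nhds (hz : z ∈ cdom e) : (e.extend (𝓡∂ (n + 1))).target ∈ 𝓝 z :=
  mem_of_superset (cdom_mem_nhds hz) Set.inter_subset_left

lemma uniqueDiffOn_extend_target :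
    UniqueDiffOn ℝ (e.extend (𝓡∂ (n + 1))).target := by
  have := e.extend_target (I := 𝓡∂ (n + 1))
  rw [this]
  exact (𝓡∂ (n + 1)).uniqueDiffOn_preimage e.open_target

lemma contMDiffOn_cpar (he : e ∈ maximalAtlas (𝓡∂ (n + 1)) ∞ Mb) :
    ContMDiffOn 𝓘(ℝ, EE n) (𝓡∂ (n + 1)) ∞ (cpar e) (e.extend (𝓡∂ (n + 1))).target := by
  rw [e.extend_target']
  exact contMDiffOn_extend_symm he

lemma mapsTo_cpar : Set.MapsTo (cpar e) (e.extend (𝓡∂ (n + 1))).target e.source := fun z hz => by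
  have := (e.extend (𝓡∂ (n + 1))).map_target hz
  rwa [e.extend_source] at this

lemma ccoord_image_subset {K : Set Mb} (hKe : K ⊆ e.source) :
    ccoord e '' K ⊆ (e.extend (𝓡∂ (n + 1))).target := by
  rintro _ ⟨p, hp, rfl⟩
  exact (e.extend (𝓡∂ (n + 1))).map_source (by rw [e.extend_source]; exact hKe hp)

/-- A vector field in the coordinates of a chart, up to the boundary. -/
def vfCW (e : OpenPartialHomeomorph Mb (EuclideanHalfSpace (n + 1))) (X : VField n Mb)
    (z : EE n) : EE n :=
  (mfderivWithin (𝓡∂ (n + 1)) 𝓘(ℝ, EE n) (ccoord e) e.source (cpar e z) :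
    EE n →L[ℝ] EE n) (X (cpar e z))

/-- The coordinate expression is the fiber part of the tangent map of the chart applied to the
section X, so it is smooth on the whole target, boundary points included. -/
lemma contDiffOn_vfCW (he : e ∈ maximalAtlas (𝓡∂ (n + 1)) ∞ Mb) (X : VField n Mb) :
    ContDiffOn ℝ (∞ : WithTop ℕ∞) (vfCW e X) (e.extend (𝓡∂ (n + 1))).target := by
  have : IsManifold (𝓡∂ (n + 1)) 1 Mb := IsManifold.of_le (n := ∞) (by simp)
  have h1 : ContMDiffOn (𝓡∂ (n + 1)) 𝓘(ℝ, EE n) ∞ (ccoord e) e.source :=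
    OpenPartialHomeomorph.contMDiffOn_extend he
  have h2 := h1.contMDiffOn_tangentMapWithin (m := ∞) (by simp) e.open_source.uniqueMDiffOn
  have h3 : ContMDiffOn 𝓘(ℝ, EE n) (𝓡∂ (n + 1)).tangent ∞
      (fun z => (⟨cpar e z, X (cpar e z)⟩ : TangentBundle (𝓡∂ (n + 1)) Mb))
      (e.extend (𝓡∂ (n + 1))).target :=
    X.contMDiff.comp_contMDiffOn (contMDiffOn_cpar he)
  have h4 := h2.comp h3 (fun z hz => mapsTo_cpar hz)
  have h5 := (contMDiff_snd_tangentBundle_modelSpace (EE n) 𝓘(ℝ, EE n) (n := ∞)).comp_contMDiffOn h4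
  exact contMDiffOn_iff_contDiffOn.1 h5

lemma vfCW_eq (he : e ∈ maximalAtlas (𝓡∂ (n + 1)) ∞ Mb) (X : VField n Mb) (hz : z ∈ cdom e) :
    vfCW e X z = vfC e X z := by
  have h1 : MDifferentiableAt (𝓡∂ (n + 1)) 𝓘(ℝ, EE n) (ccoord e) (cpar e z) :=
    ((OpenPartialHomeomorph.contMDiffOn_extend he).contMDiffAt
      (e.open_source.mem_nhds (cpar_mem_source hz))).mdifferentiableAt (by simp)
  have h2 : ccoord e ∘ cpar e =ᶠ[𝓝 z] id := by
    filter_upwards [cdom_mem_nhds hz] with y hy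
    exact ccoord_cpar hy
  have h3 : (mfderiv (𝓡∂ (n + 1)) 𝓘(ℝ, EE n) (ccoord e) (cpar e z) : EE n →L[ℝ] EE n).comp
      (dParam (cpar e) z) = ContinuousLinearMap.id ℝ (EE n) := by
    have h4 := mfderiv_comp (I := 𝓘(ℝ, EE n)) z h1 (mdifferentiableAt_cpar he hz)
    rw [h2.mfderiv_eq, mfderiv_id] at h4
    exact h4.symm
  have hi := isInvertible_dParam he hz
  rw [vfCW, vfC, mfderivWithin_of_mem_nhds (e.open_source.mem_nhds (cpar_mem_source hz))]
  rw [inverse_eq_of_comp_eq_id hi h3]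
  rfl

lemma bddJets_vfC (he : e ∈ maximalAtlas (𝓡∂ (n + 1)) ∞ Mb) (X : VField n Mb) {K : Set Mb}
    (hK : IsCompact K) (hKe : K ⊆ e.source) : BddJets (vfC e X) (cset e K) := by
  refine (ContDiffOn.bddJets (contDiffOn_vfCW he X) uniqueDiffOn_extend_target
    (isCompact_ccoord_image hK hKe) (ccoord_image_subset hKe) cset_subset
    (fun z hz => extend_target_mem_nhds hz.1)).congr fun z hz => ?_
  filter_upwards [cdom_mem_nhds hz.1] with y hy
  exact (vfCW_eq he X hy).symm

lemma differentiableAt_vfC (X : VField n Mb) (e' : OpenPartialHomeomorph Mb _)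
    (he : e' ∈ maximalAtlas (𝓡∂ (n + 1)) ∞ Mb) (y : EE n) (hz : y ∈ cdom e') :
    DifferentiableAt ℝ (vfC e' X) y :=
  ((bddJets_vfC he X (K := {cpar e' y}) isCompact_singleton (by simpa using cpar_mem_source hz)
    ).contDiffAt y ⟨hz, rfl⟩).differentiableAt (by simp)

/-- The differential of a parametrization, up to the boundary. -/
def dParamW (e : OpenPartialHomeomorph Mb (EuclideanHalfSpace (n + 1))) (z : EE n) :
    EE n →L[ℝ] EE n :=
  mfderivWithin 𝓘(ℝ, EE n) (𝓡∂ (n + 1)) (cpar e) (e.extend (𝓡∂ (n + 1))).target z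

lemma dParamW_eq (hz : z ∈ cdom e) : dParamW e z = dParam (cpar e) z := by
  rw [dParamW, mfderivWithin_of_mem_nhds (extend_target_mem_nhds hz)]
  rfl

/-- Needed at boundary points as well, where derivatives are taken within the target: the chain rule
for chart after parametrization still gives a left inverse. -/
lemma dParamW_injective (he : e ∈ maximalAtlas (𝓡∂ (n + 1)) ∞ Mb)
    (hz : z ∈ (e.extend (𝓡∂ (n + 1))).target) : Injective (dParamW e z) := by
  have h1 : MDifferentiableWithinAt (𝓡∂ (n + 1)) 𝓘(ℝ, EE n) (ccoord e) e.source (cpar e z) :=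
    ((OpenPartialHomeomorph.contMDiffOn_extend he) _ (mapsTo_cpar hz)).mdifferentiableWithinAt
      (by simp)
  have h2 : MDifferentiableWithinAt 𝓘(ℝ, EE n) (𝓡∂ (n + 1)) (cpar e)
      (e.extend (𝓡∂ (n + 1))).target z :=
    (contMDiffOn_cpar he _ hz).mdifferentiableWithinAt (by simp)
  have hu : UniqueMDiffWithinAt 𝓘(ℝ, EE n) (e.extend (𝓡∂ (n + 1))).target z :=
    uniqueDiffOn_extend_target.uniqueMDiffOn z hz
  have h3 := mfderivWithin_comp z h1 h2 mapsTo_cpar hu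
  have h4 : mfderivWithin 𝓘(ℝ, EE n) 𝓘(ℝ, EE n) (ccoord e ∘ cpar e)
      (e.extend (𝓡∂ (n + 1))).target z = ContinuousLinearMap.id ℝ (TangentSpace 𝓘(ℝ, EE n) z) :=
    (mfderivWithin_congr (I := 𝓘(ℝ, EE n)) (I' := 𝓘(ℝ, EE n)) (f := id)
      (f₁ := ccoord e ∘ cpar e) (fun y hy => (e.extend (𝓡∂ (n + 1))).right_inv hy)
      ((e.extend (𝓡∂ (n + 1))).right_inv hz)).trans (mfderivWithin_id hu)
  have h7 := h4.symm.trans h3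
  intro v w hvw
  have h5 := DFunLike.congr_fun h7 v
  have h6 := DFunLike.congr_fun h7 w
  refine h5.trans (Eq.trans ?_ h6.symm)
  exact congrArg (mfderivWithin (𝓡∂ (n + 1)) 𝓘(ℝ, EE n) (ccoord e) e.source (cpar e z)) hvw

/-- The coefficients of the metric, up to the boundary. -/
def coeffW (h : Metric n Mb) (e : OpenPartialHomeomorph Mb (EuclideanHalfSpace (n + 1)))
    (z : EE n) : EE n →L[ℝ] EE n →L[ℝ] ℝ :=
  (h.at (cpar e z)).bilinearComp (dParamW e z) (dParamW e z)

lemma contDiffOn_coeffW (h : Metric n Mb) (he : e ∈ maximalAtlas (𝓡∂ (n + 1)) ∞ Mb) :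
    ContDiffOn ℝ (∞ : WithTop ℕ∞) (coeffW h e) (e.extend (𝓡∂ (n + 1))).target := by
  have : IsManifold (𝓡∂ (n + 1)) 1 Mb := IsManifold.of_le (n := ∞) (by simp)
  have h2 := (contMDiffOn_cpar he).contMDiffOn_tangentMapWithin (m := ∞) (by simp)
    uniqueDiffOn_extend_target.uniqueMDiffOn
  have h3 : ∀ v : EE n, ContMDiffOn 𝓘(ℝ, EE n) (𝓡∂ (n + 1)).tangent ∞
      (fun z => (⟨cpar e z, dParamW e z v⟩ : TangentBundle (𝓡∂ (n + 1)) Mb))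
      (e.extend (𝓡∂ (n + 1))).target := fun v => by
    have h4 : ContMDiffOn 𝓘(ℝ, EE n) 𝓘(ℝ, EE n).tangent ∞
        (fun z => (⟨z, v⟩ : TangentBundle 𝓘(ℝ, EE n) (EE n)))
        (e.extend (𝓡∂ (n + 1))).target :=
      contMDiffOn_vectorSpace_iff_contDiffOn.2 contDiffOn_const
    exact h2.comp h4 (fun z hz => hz)
  refine contDiffOn_clm_apply.2 fun v => contDiffOn_clm_apply.2 fun w => ?_
  have h5 := ContMDiffOn.clm_bundle_apply₂ (E₁ := fun x : Mb => TangentSpace (𝓡∂ (n + 1)) x)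
    (E₂ := fun x : Mb => TangentSpace (𝓡∂ (n + 1)) x) (E₃ := Bundle.Trivial Mb ℝ)
    (h.contMDiff.comp_contMDiffOn (contMDiffOn_cpar he)) (h3 v) (h3 w)
  exact fun z hz => contMDiffWithinAt_iff_contDiffWithinAt.1
    (Bundle.contMDiffWithinAt_totalSpace.1 (h5 z hz)).2

lemma coeffW_pos (h : Metric n Mb) (he : e ∈ maximalAtlas (𝓡∂ (n + 1)) ∞ Mb)
    (hz : z ∈ (e.extend (𝓡∂ (n + 1))).target) (v : EE n) (hv : v ≠ 0) : 0 < coeffW h e z v v :=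
  h.pos _ _ fun h0 => hv (dParamW_injective he hz (by rw [map_zero]; exact h0))

lemma coeffW_eventuallyEq (h : Metric n Mb) (hz : z ∈ cdom e) :
    h.coeff (cpar e) =ᶠ[𝓝 z] coeffW h e := by
  filter_upwards [cdom_mem_nhds hz] with y hy
  rw [coeffW, dParamW_eq hy]
  rfl

lemma bddJets_coeff (h : Metric n Mb) (he : e ∈ maximalAtlas (𝓡∂ (n + 1)) ∞ Mb) {K : Set Mb}
    (hK : IsCompact K) (hKe : K ⊆ e.source) : BddJets (h.coeff (cpar e)) (cset e K) :=
  (ContDiffOn.bddJets (contDiffOn_coeffW h he) uniqueDiffOn_extend_target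
    (isCompact_ccoord_image hK hKe) (ccoord_image_subset hKe) cset_subset
    (fun _ hz => extend_target_mem_nhds hz.1)).congr fun _ hz => coeffW_eventuallyEq h hz.1

/-- The coefficients remain positive definite at boundary points, so inversion is smooth on all of
the compact coordinate image, not just at its interior points. -/
lemma bddJets_coeff_inverse (h : Metric n Mb) (he : e ∈ maximalAtlas (𝓡∂ (n + 1)) ∞ Mb)
    {K : Set Mb} (hK : IsCompact K) (hKe : K ⊆ e.source) :
    BddJets (fun z => (h.coeff (cpar e) z).inverse) (cset e K) := by
  have h1 : ContDiffOn ℝ (∞ : WithTop ℕ∞) (fun z => (coeffW h e z).inverse)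
      (e.extend (𝓡∂ (n + 1))).target := fun z hz => by
    have hi : (coeffW h e z).IsInvertible := isInvertible_of_pos (coeffW_pos h he hz)
    exact (ContDiffAt.comp_contDiffWithinAt (F := EE n →L[ℝ] EE n →L[ℝ] ℝ) z
      hi.contDiffAt_map_inverse (contDiffOn_coeffW h he z hz))
  refine (ContDiffOn.bddJets h1 uniqueDiffOn_extend_target
    (isCompact_ccoord_image hK hKe) (ccoord_image_subset hKe) cset_subset
    (fun _ hz => extend_target_mem_nhds hz.1)).congr fun z hz => ?_
  filter_upwards [coeffW_eventuallyEq h hz.1] with y hy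
  rw [hy]

lemma differentiableAt_coeff (h : Metric n Mb) (e' : OpenPartialHomeomorph Mb _)
    (he : e' ∈ maximalAtlas (𝓡∂ (n + 1)) ∞ Mb) (y : EE n) (hz : y ∈ cdom e') :
    DifferentiableAt ℝ (h.coeff (cpar e')) y :=
  ((bddJets_coeff h he (K := {cpar e' y}) isCompact_singleton (by simpa using cpar_mem_source hz)
    ).contDiffAt y ⟨hz, rfl⟩).differentiableAt (by simp)

set_option maxSynthPendingDepth 3 in
/-- The Koszul combination of the derivatives of a metric. -/
def koszulL (V : Type*) [NormedAddCommGroup V] [NormedSpace ℝ V] :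
    (V →L[ℝ] V →L[ℝ] V →L[ℝ] ℝ) →L[ℝ] (V →L[ℝ] V →L[ℝ] V →L[ℝ] ℝ) :=
  let F₁ : (V →L[ℝ] V →L[ℝ] V →L[ℝ] ℝ) →L[ℝ] (V →L[ℝ] V →L[ℝ] V →L[ℝ] ℝ) :=
    (ContinuousLinearMap.flipₗᵢ ℝ V V (V →L[ℝ] ℝ)).toContinuousLinearEquiv
  let F₂ : (V →L[ℝ] V →L[ℝ] ℝ) →L[ℝ] (V →L[ℝ] V →L[ℝ] ℝ) :=
    (ContinuousLinearMap.flipₗᵢ ℝ V V ℝ).toContinuousLinearEquiv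
  (1 / 2 : ℝ) • (ContinuousLinearMap.id ℝ _ + F₁ -
    (ContinuousLinearMap.compL ℝ V (V →L[ℝ] V →L[ℝ] ℝ) (V →L[ℝ] V →L[ℝ] ℝ) F₂).comp F₁)

set_option maxSynthPendingDepth 3 in
-- The Christoffel symbols are bilinear in the inverse metric and the derivative of the metric.
lemma BddJets.koszul {X V : Type*} [NormedAddCommGroup V] [NormedSpace ℝ V]
    [NormedAddCommGroup X] [NormedSpace ℝ X] {J : X → (V →L[ℝ] ℝ) →L[ℝ] V}
    {D : X → V →L[ℝ] V →L[ℝ] V →L[ℝ] ℝ} {S : Set X} (hJ : BddJets J S) (hD : BddJets D S) :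
    BddJets (fun z => (ContinuousLinearMap.compL ℝ V (V →L[ℝ] ℝ) V (J z)).comp (koszulL V (D z))) S :=
  BddJets.bilin ((ContinuousLinearMap.compL ℝ V (V →L[ℝ] V →L[ℝ] ℝ)
    (V →L[ℝ] V)).comp (ContinuousLinearMap.compL ℝ V (V →L[ℝ] ℝ) V)) hJ (hD.clm (koszulL V))

set_option maxSynthPendingDepth 3 in
lemma bddJets_chrisC {G : EE n → EE n →L[ℝ] EE n →L[ℝ] ℝ} {S : Set (EE n)} (hG : BddJets G S)
    (hG' : BddJets (fun z => (G z).inverse) S) : BddJets (chrisC G) S := by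
  exact (BddJets.koszul (V := EE n) hG' hG.fderiv).congr fun z _ => Eventually.of_forall fun y => rfl

lemma bddJets_christoffel (h : Metric n Mb) (he : e ∈ maximalAtlas (𝓡∂ (n + 1)) ∞ Mb) {K : Set Mb}
    (hK : IsCompact K) (hKe : K ⊆ e.source) :
    BddJets (chrisC (h.coeff (cpar e))) (cset e K) :=
  bddJets_chrisC (bddJets_coeff h he hK hKe) (bddJets_coeff_inverse h he hK hKe)

end Geometry

end WAH

end

noncomputable section

namespace WAH

open Filter Topology Function

/-! ### Hyperbolic balls as Euclidean balls -/

section HypBall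

variable {n : ℕ}

@[simp] lemma basePt_zero : basePt n 0 = 1 := by simp [basePt]

lemma norm_sub_smul_basePt_sq (z : EE n) (t : ℝ) :
    ‖z - t • basePt n‖ ^ 2 = ‖z‖ ^ 2 - 2 * t * z 0 + t ^ 2 := by
  rw [norm_sub_sq_real, inner_smul_right, norm_smul]
  have h1 : inner ℝ z (basePt n) = z 0 := by
    simp [basePt, EuclideanSpace.inner_single_right]
  have h2 : ‖basePt n‖ = 1 := by simp [basePt]
  rw [h1, h2, mul_one, Real.norm_eq_abs, sq_abs]
  ring

lemma abs_coord_le (z : EE n) (i : Fin (n + 1)) : |z i| ≤ ‖z‖ := by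
  simpa using PiLp.norm_apply_le z i

/-- Squaring sinh(d/2) < sinh(s/2) and using cosh s = 1 + 2 sinh²(s/2) turns the condition into that
of a Euclidean ball with center (0, cosh s) and radius sinh s. Convexity and compactness of
hyperbolic balls follow. -/
lemma hypDist_basePt_lt_iff {z : EE n} (hz : 0 < z 0) {s : ℝ} (hs : 0 < s) :
    hypDist z (basePt n) < s ↔ ‖z - Real.cosh s • basePt n‖ < Real.sinh s := by
  have hsq : 0 < √(z 0) := Real.sqrt_pos.2 hz
  have hsh : 0 < Real.sinh (s / 2) := Real.sinh_pos_iff.2 (by positivity)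
  have hc : Real.cosh s = 1 + 2 * Real.sinh (s / 2) ^ 2 := by
    have h1 := Real.cosh_two_mul (s / 2)
    have h2 := Real.cosh_sq (s / 2)
    rw [mul_div_cancel₀ s (two_ne_zero' ℝ)] at h1
    rw [h1, h2]; ring
  have h1 : hypDist z (basePt n) < s ↔ dist z (basePt n) < 2 * √(z 0) * Real.sinh (s / 2) := by
    rw [hypDist, basePt_zero, mul_one, ← lt_div_iff₀' (by norm_num : (0 : ℝ) < 2),
      ← Real.sinh_lt_sinh, Real.sinh_arsinh, div_lt_iff₀' (by positivity)]
  rw [h1, ← sq_lt_sq₀ dist_nonneg (by positivity), ← sq_lt_sq₀ (norm_nonneg _)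
    (Real.sinh_pos_iff.2 hs).le, norm_sub_smul_basePt_sq, dist_eq_norm]
  have h3 := norm_sub_smul_basePt_sq z 1
  rw [one_smul] at h3
  rw [h3, mul_pow, mul_pow, Real.sq_sqrt hz.le]
  have h4 := Real.cosh_sq s
  rw [show Real.sinh s ^ 2 = Real.cosh s ^ 2 - 1 by linarith, hc]
  constructor <;> intro h <;> nlinarith

lemma hypDist_basePt_le_iff {z : EE n} (hz : 0 < z 0) {s : ℝ} (hs : 0 < s) :
    hypDist z (basePt n) ≤ s ↔ ‖z - Real.cosh s • basePt n‖ ≤ Real.sinh s := by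
  have hsq : 0 < √(z 0) := Real.sqrt_pos.2 hz
  have hsh : 0 < Real.sinh (s / 2) := Real.sinh_pos_iff.2 (by positivity)
  have hc : Real.cosh s = 1 + 2 * Real.sinh (s / 2) ^ 2 := by
    have h1 := Real.cosh_two_mul (s / 2)
    have h2 := Real.cosh_sq (s / 2)
    rw [mul_div_cancel₀ s (two_ne_zero' ℝ)] at h1
    rw [h1, h2]; ring
  have h1 : hypDist z (basePt n) ≤ s ↔ dist z (basePt n) ≤ 2 * √(z 0) * Real.sinh (s / 2) := by
    rw [hypDist, basePt_zero, mul_one, ← le_div_iff₀' (by norm_num : (0 : ℝ) < 2),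
      ← Real.sinh_le_sinh, Real.sinh_arsinh, div_le_iff₀' (by positivity)]
  rw [h1, ← sq_le_sq₀ dist_nonneg (by positivity), ← sq_le_sq₀ (norm_nonneg _)
    (Real.sinh_pos_iff.2 hs).le, norm_sub_smul_basePt_sq, dist_eq_norm]
  have h3 := norm_sub_smul_basePt_sq z 1
  rw [one_smul] at h3
  rw [h3, mul_pow, mul_pow, Real.sq_sqrt hz.le]
  have h4 := Real.cosh_sq s
  rw [show Real.sinh s ^ 2 = Real.cosh s ^ 2 - 1 by linarith, hc]
  constructor <;> intro h <;> nlinarith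

lemma abs_sub_cosh_le (z : EE n) (s : ℝ) :
    |z 0 - Real.cosh s| ≤ ‖z - Real.cosh s • basePt n‖ := by
  simpa using abs_coord_le (z - Real.cosh s • basePt n) 0

lemma exp_neg_le_of_norm_le {z : EE n} {s : ℝ}
    (h : ‖z - Real.cosh s • basePt n‖ ≤ Real.sinh s) : Real.exp (-s) ≤ z 0 := by
  have h1 := (abs_le.1 ((abs_sub_cosh_le z s).trans h)).1
  have h2 := Real.cosh_sub_sinh s
  linarith

lemma hypBall_eq {s : ℝ} (hs : 0 < s) :
    hypBall n s = Metric.ball (Real.cosh s • basePt n) (Real.sinh s) := by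
  ext z
  rw [Metric.mem_ball, dist_eq_norm]
  constructor
  · rintro ⟨h0, h1⟩
    exact (hypDist_basePt_lt_iff h0 hs).1 h1
  · intro h
    have h0 : 0 < z 0 := (Real.exp_pos _).trans_le (exp_neg_le_of_norm_le h.le)
    exact ⟨h0, (hypDist_basePt_lt_iff h0 hs).2 h⟩

lemma hypClosedBall_eq {s : ℝ} (hs : 0 < s) :
    hypClosedBall n s = Metric.closedBall (Real.cosh s • basePt n) (Real.sinh s) := by
  ext z
  rw [Metric.mem_closedBall, dist_eq_norm]
  constructor
  · rintro ⟨h0, h1⟩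
    exact (hypDist_basePt_le_iff h0 hs).1 h1
  · intro h
    have h0 : 0 < z 0 := (Real.exp_pos _).trans_le (exp_neg_le_of_norm_le h)
    exact ⟨h0, (hypDist_basePt_le_iff h0 hs).2 h⟩

lemma isOpen_hypBall {s : ℝ} (hs : 0 < s) : IsOpen (hypBall n s) := by
  rw [hypBall_eq hs]; exact Metric.isOpen_ball

lemma convex_hypBall {s : ℝ} (hs : 0 < s) : Convex ℝ (hypBall n s) := by
  rw [hypBall_eq hs]; exact convex_ball _ _

lemma isCompact_hypClosedBall {s : ℝ} (hs : 0 < s) : IsCompact (hypClosedBall n s) := by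
  rw [hypClosedBall_eq hs]; exact isCompact_closedBall _ _

lemma hypBall_subset_hypClosedBall {s : ℝ} : hypBall n s ⊆ hypClosedBall n s :=
  fun _ h => ⟨h.1, h.2.le⟩

lemma hypClosedBall_subset_hypBall {s t : ℝ} (hst : s < t) : hypClosedBall n s ⊆ hypBall n t :=
  fun _ h => ⟨h.1, h.2.trans_lt hst⟩

lemma basePt_mem_hypBall {s : ℝ} (hs : 0 < s) : basePt n ∈ hypBall n s := by
  refine ⟨by simp, ?_⟩
  simpa [hypDist] using hs

/-- The diameter of the hyperbolic ball of radius `2`. -/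
def diamB : ℝ := 2 * Real.sinh 2

lemma diamB_pos : 0 < diamB := mul_pos two_pos (Real.sinh_pos_iff.2 two_pos)

lemma norm_sub_le_diamB {z w : EE n} (hz : z ∈ hypBall n 2) (hw : w ∈ hypBall n 2) :
    ‖z - w‖ ≤ diamB := by
  rw [hypBall_eq two_pos, Metric.mem_ball, dist_eq_norm] at hz hw
  calc ‖z - w‖ = ‖(z - Real.cosh 2 • basePt n) - (w - Real.cosh 2 • basePt n)‖ := by
        rw [sub_sub_sub_cancel_right]
    _ ≤ ‖z - Real.cosh 2 • basePt n‖ + ‖w - Real.cosh 2 • basePt n‖ := norm_sub_le _ _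
    _ ≤ diamB := by rw [diamB]; linarith

end HypBall

/-! ### Hölder bounds on the ball of radius two -/

section Holder

variable {n : ℕ} {V W G : Type*} [NormedAddCommGroup V] [NormedSpace ℝ V]
  [NormedAddCommGroup W] [NormedSpace ℝ W] [NormedAddCommGroup G] [NormedSpace ℝ G]

/-- Functions of class `C^{k,α}` on `B₂`, with all the seminorms bounded by `A`. -/
structure HolderB (k : ℕ) (α A : ℝ) (f : EE n → V) : Prop where
  contDiffAt : ∀ z ∈ hypBall n 2, ContDiffAt ℝ k f z
  bound : ∀ z ∈ hypBall n 2, ∀ j ≤ k, ‖iteratedFDeriv ℝ j f z‖ ≤ A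
  holder : α ≠ 0 → ∀ z ∈ hypBall n 2, ∀ w ∈ hypBall n 2,
    ‖iteratedFDeriv ℝ k f z - iteratedFDeriv ℝ k f w‖ ≤ A * ‖z - w‖ ^ α

variable {k : ℕ} {α A : ℝ} {f : EE n → V}

lemma HolderB.nonneg (h : HolderB k α A f) : 0 ≤ A :=
  (norm_nonneg _).trans (h.bound _ (basePt_mem_hypBall two_pos) 0 (Nat.zero_le _))

lemma HolderB.mono {A' : ℝ} (h : HolderB k α A f) (hA : A ≤ A') : HolderB k α A' f :=
  ⟨h.contDiffAt, fun z hz j hj => (h.bound z hz j hj).trans hA,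
    fun hα z hz w hw => (h.holder hα z hz w hw).trans
      (mul_le_mul_of_nonneg_right hA (Real.rpow_nonneg (norm_nonneg _) _))⟩

lemma HolderB.congr {g : EE n → V} (h : HolderB k α A f) (hfg : Set.EqOn g f (hypBall n 2)) :
    HolderB k α A g := by
  have h1 : ∀ z ∈ hypBall n 2, g =ᶠ[𝓝 z] f := fun z hz =>
    hfg.eventuallyEq_of_mem ((isOpen_hypBall two_pos).mem_nhds hz)
  have h2 : ∀ z ∈ hypBall n 2, ∀ j, iteratedFDeriv ℝ j g z = iteratedFDeriv ℝ j f z :=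
    fun z hz j => ((h1 z hz).iteratedFDeriv ℝ j).self_of_nhds
  refine ⟨fun z hz => (h.contDiffAt z hz).congr_of_eventuallyEq (h1 z hz), fun z hz j hj => ?_,
    fun hα z hz w hw => ?_⟩
  · rw [h2 z hz]; exact h.bound z hz j hj
  · rw [h2 z hz, h2 w hw]; exact h.holder hα z hz w hw

lemma HolderB.holderNormOn_le (h : HolderB k α A f) (hα : 0 ≤ α) :
    holderNormOn (hypBall n 2) k α f ≤ ENNReal.ofReal ((k + 2) * A) := by
  have hA := h.nonneg
  have h1 : (∑ j ∈ Finset.range (k + 1), ⨆ z ∈ hypBall n 2, ‖iteratedFDeriv ℝ j f z‖ₑ) ≤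
      ENNReal.ofReal ((k + 1) * A) := by
    calc _ ≤ ∑ j ∈ Finset.range (k + 1), ENNReal.ofReal A := by
          refine Finset.sum_le_sum fun j hj => iSup₂_le fun z hz => ?_
          rw [← ofReal_norm]
          exact ENNReal.ofReal_le_ofReal (h.bound z hz j (Nat.lt_succ_iff.1 (Finset.mem_range.1 hj)))
      _ = ENNReal.ofReal ((k + 1) * A) := by
          rw [Finset.sum_const, Finset.card_range, nsmul_eq_mul, ENNReal.ofReal_mul (by positivity)]
          congr 1
          rw [← Nat.cast_succ, ENNReal.ofReal_natCast]
  rw [holderNormOn, show ((k : ℝ) + 2) * A = (k + 1) * A + A by ring,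
    ENNReal.ofReal_add (by positivity) hA]
  refine add_le_add h1 ?_
  split_ifs with h0
  · exact zero_le
  refine iSup₂_le fun z hz => iSup₂_le fun w hw => ?_
  have hα' : 0 < α := lt_of_le_of_ne hα (Ne.symm h0)
  refine ENNReal.div_le_of_le_mul ?_
  rw [← ofReal_norm, edist_dist, dist_eq_norm, ENNReal.ofReal_rpow_of_nonneg (norm_nonneg _) hα,
    ← ENNReal.ofReal_mul hA]
  exact ENNReal.ofReal_le_ofReal (h.holder h0 z hz w hw)

lemma holderB_of_holderNormOn_lt_top (hf : ContDiffOn ℝ k f (hypBall n 2)) (hα : 0 ≤ α)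
    (h : holderNormOn (hypBall n 2) k α f ≤ ENNReal.ofReal A) (hA : 0 ≤ A) : HolderB k α A f := by
  refine ⟨fun z hz => hf.contDiffAt ((isOpen_hypBall two_pos).mem_nhds hz), fun z hz j hj => ?_,
    fun h0 z hz w hw => ?_⟩
  · have h1 : ‖iteratedFDeriv ℝ j f z‖ₑ ≤ ENNReal.ofReal A := by
      refine le_trans ?_ (le_trans le_self_add h)
      refine le_trans ?_ (Finset.single_le_sum (f := fun j => ⨆ z ∈ hypBall n 2,
        ‖iteratedFDeriv ℝ j f z‖ₑ) (fun _ _ => zero_le) (Finset.mem_range.2 (Nat.lt_succ_of_le hj)))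
      exact le_iSup₂ (f := fun z (_ : z ∈ hypBall n 2) => ‖iteratedFDeriv ℝ j f z‖ₑ) z hz
    rwa [← ofReal_norm, ENNReal.ofReal_le_ofReal_iff hA] at h1
  · have hα' : 0 < α := lt_of_le_of_ne hα (Ne.symm h0)
    rcases eq_or_ne z w with rfl | hzw
    · simp only [sub_self, norm_zero]; positivity
    have h1 : ‖iteratedFDeriv ℝ k f z - iteratedFDeriv ℝ k f w‖ₑ / edist z w ^ α ≤
        ENNReal.ofReal A := by
      refine le_trans ?_ (le_trans le_add_self h)
      rw [if_neg h0]
      refine le_trans ?_ (le_iSup₂ (f := fun z (_ : z ∈ hypBall n 2) => ⨆ w ∈ hypBall n 2,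
        ‖iteratedFDeriv ℝ k f z - iteratedFDeriv ℝ k f w‖ₑ / edist z w ^ α) z hz)
      exact le_iSup₂ (f := fun w (_ : w ∈ hypBall n 2) =>
        ‖iteratedFDeriv ℝ k f z - iteratedFDeriv ℝ k f w‖ₑ / edist z w ^ α) w hw
    have hpos : 0 < ‖z - w‖ := norm_pos_iff.2 (sub_ne_zero.2 hzw)
    rw [← ofReal_norm, edist_dist, dist_eq_norm, ENNReal.ofReal_rpow_of_pos hpos,
      ← ENNReal.ofReal_div_of_pos (by positivity), ENNReal.ofReal_le_ofReal_iff hA,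
      div_le_iff₀ (by positivity)] at h1
    exact h1

/-- Comparison of `|z - w|` and `|z - w|^α` on `B₂`. -/
def diamC : ℝ := max 1 diamB

lemma norm_sub_le_rpow (hα0 : 0 ≤ α) (hα1 : α < 1) {z w : EE n} (hz : z ∈ hypBall n 2)
    (hw : w ∈ hypBall n 2) : ‖z - w‖ ≤ diamC * ‖z - w‖ ^ α := by
  rcases eq_or_ne z w with rfl | hzw
  · simp only [sub_self, norm_zero]
    exact mul_nonneg (zero_le_one.trans (le_max_left _ _)) (Real.rpow_nonneg le_rfl _)
  have hpos : 0 < ‖z - w‖ := norm_pos_iff.2 (sub_ne_zero.2 hzw)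
  have h1 : ‖z - w‖ ^ (1 - α) ≤ diamC := by
    calc ‖z - w‖ ^ (1 - α) ≤ diamC ^ (1 - α) :=
          Real.rpow_le_rpow hpos.le ((norm_sub_le_diamB hz hw).trans (le_max_right _ _)) (by linarith)
      _ ≤ diamC ^ (1 : ℝ) := Real.rpow_le_rpow_of_exponent_le (le_max_left _ _) (by linarith)
      _ = diamC := Real.rpow_one _
  calc ‖z - w‖ = ‖z - w‖ ^ (1 - α) * ‖z - w‖ ^ α := by
        rw [← Real.rpow_add hpos]; simp
    _ ≤ _ := mul_le_mul_of_nonneg_right h1 (by positivity)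

lemma one_le_diamC : 1 ≤ diamC := le_max_left _ _

lemma norm_iteratedFDeriv_sub_le {j : ℕ} (h : ∀ z ∈ hypBall n 2, ContDiffAt ℝ (j + 1 : ℕ) f z)
    (hA : ∀ z ∈ hypBall n 2, ‖iteratedFDeriv ℝ (j + 1) f z‖ ≤ A) {z w : EE n}
    (hz : z ∈ hypBall n 2) (hw : w ∈ hypBall n 2) :
    ‖iteratedFDeriv ℝ j f z - iteratedFDeriv ℝ j f w‖ ≤ A * ‖z - w‖ := by
  refine (convex_hypBall two_pos).norm_image_sub_le_of_norm_fderiv_le (𝕜 := ℝ) (fun y hy => ?_)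
    (fun y hy => ?_) hw hz
  · exact (h y hy).differentiableAt_iteratedFDeriv (by exact_mod_cast Nat.lt_succ_self j)
  · rw [norm_fderiv_iteratedFDeriv]; exact hA y hy

/-- One more bounded derivative gives a Lipschitz bound on the convex ball, hence a Hölder bound
because the ball has finite diameter. Smooth objects can thus be handled without Hölder seminorms.
-/
lemma holderB_of_bound (hα0 : 0 ≤ α) (hα1 : α < 1)
    (h : ∀ z ∈ hypBall n 2, ContDiffAt ℝ (k + 1 : ℕ) f z)
    (hA : ∀ z ∈ hypBall n 2, ∀ j ≤ k + 1, ‖iteratedFDeriv ℝ j f z‖ ≤ A) :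
    HolderB k α (diamC * A) f := by
  have hA0 : 0 ≤ A := (norm_nonneg _).trans (hA _ (basePt_mem_hypBall two_pos) 0 (Nat.zero_le _))
  refine ⟨fun z hz => (h z hz).of_le (by exact_mod_cast Nat.le_succ k), fun z hz j hj =>
    (hA z hz j (hj.trans (Nat.le_succ k))).trans (le_mul_of_one_le_left hA0 one_le_diamC),
    fun _ z hz w hw => ?_⟩
  calc _ ≤ A * ‖z - w‖ := norm_iteratedFDeriv_sub_le h (fun y hy => hA y hy _ le_rfl) hz hw
    _ ≤ A * (diamC * ‖z - w‖ ^ α) :=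
        mul_le_mul_of_nonneg_left (norm_sub_le_rpow hα0 hα1 hz hw) hA0
    _ = diamC * A * ‖z - w‖ ^ α := by ring

lemma iteratedFDeriv_shift {X : Type*} [NormedAddCommGroup X] [NormedSpace ℝ X] {h z w : X}
    (hw : z + h = w) (f : X → V) (j : ℕ) :
    iteratedFDeriv ℝ j (fun y => f (y + h)) z = iteratedFDeriv ℝ j f w := by
  rw [iteratedFDeriv_comp_add_right, hw]

lemma contDiffAt_shift {X : Type*} [NormedAddCommGroup X] [NormedSpace ℝ X] {h z w : X}
    (hw : z + h = w) {f : X → V} {j : ℕ} (hf : ContDiffAt ℝ j f w) :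
    ContDiffAt ℝ j (fun y => f (y + h)) z := by
  rw [← hw] at hf
  exact ContDiffAt.comp z hf (by fun_prop)

lemma HolderB.bilin (B : V →L[ℝ] W →L[ℝ] G) {C : ℝ} {g : EE n → V} {f : EE n → W}
    (hα0 : 0 ≤ α) (hα1 : α < 1)
    (hg : ∀ z ∈ hypBall n 2, ContDiffAt ℝ (k + 1 : ℕ) g z)
    (hC : ∀ z ∈ hypBall n 2, ∀ j ≤ k + 1, ‖iteratedFDeriv ℝ j g z‖ ≤ C)
    (hf : HolderB k α A f) :
    HolderB k α (‖B‖ * 2 ^ k * 2 * diamC * C * A) (fun z => B (g z) (f z)) := by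
  have hA0 := hf.nonneg
  have hC0 : 0 ≤ C := (norm_nonneg _).trans (hC _ (basePt_mem_hypBall two_pos) 0 (Nat.zero_le _))
  have hg' : ∀ z ∈ hypBall n 2, ContDiffAt ℝ k g z := fun z hz =>
    (hg z hz).of_le (by exact_mod_cast Nat.le_succ k)
  have hcd : ∀ z ∈ hypBall n 2, ContDiffAt ℝ k (fun z => B (g z) (f z)) z := fun z hz =>
    (B.isBoundedBilinearMap.contDiff (n := (k : WithTop ℕ∞))).contDiffAt.comp₂ (hg' z hz) (hf.contDiffAt z hz)
  refine ⟨hcd, fun z hz j hj => ?_, fun h0 z hz w hw => ?_⟩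
  · have h1 := norm_iteratedFDeriv_bilin_weighted B (hg' z hz) (hf.contDiffAt z hz) hj hC0 hA0
      (w₁ := fun _ => 1) (w₂ := fun _ => 1) (w := 1)
      (fun i hi => by simpa using hC z hz i (by omega))
      (fun i hi => by simpa using hf.bound z hz i (by omega)) (fun _ _ => by norm_num)
    refine h1.trans ?_
    have h2 : (2 : ℝ) ^ j ≤ 2 ^ k := pow_le_pow_right₀ (by norm_num) hj
    have h3 : 1 ≤ 2 * diamC := by linarith [one_le_diamC]
    calc ‖B‖ * 2 ^ j * C * A * 1 ≤ ‖B‖ * 2 ^ k * C * A * (2 * diamC) := by gcongr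
      _ = _ := by ring
  · set h := w - z with hh
    have hw' : z + h = w := by rw [hh]; abel
    have hc1 : ContDiffAt ℝ k (fun y => g (y + h) - g y) z := (contDiffAt_shift hw' (hg' w hw)).sub (hg' z hz)
    have hc2 : ContDiffAt ℝ k (fun y => f (y + h) - f y) z :=
      (contDiffAt_shift hw' (hf.contDiffAt w hw)).sub (hf.contDiffAt z hz)
    -- The difference of the values at w and z is the derivative at z of a difference of translates,
    -- to which the usual splitting g'f' - gf = (g' - g)f' + g(f' - f) applies.
    have hsplit : iteratedFDeriv ℝ k (fun z => B (g z) (f z)) w -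
        iteratedFDeriv ℝ k (fun z => B (g z) (f z)) z =
        iteratedFDeriv ℝ k (fun y => B (g (y + h) - g y) (f (y + h))) z +
        iteratedFDeriv ℝ k (fun y => B (g y) (f (y + h) - f y)) z := by
      rw [← iteratedFDeriv_shift hw' (fun z => B (g z) (f z)), ← iteratedFDeriv_sub_at (contDiffAt_shift hw' (hcd w hw)) (hcd z hz)]
      have hc3 : ContDiffAt ℝ k (fun y => B (g (y + h) - g y) (f (y + h))) z :=
        (B.isBoundedBilinearMap.contDiff (n := (k : WithTop ℕ∞))).contDiffAt.comp₂ hc1 (contDiffAt_shift hw' (hf.contDiffAt w hw))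
      have hc4 : ContDiffAt ℝ k (fun y => B (g y) (f (y + h) - f y)) z :=
        (B.isBoundedBilinearMap.contDiff (n := (k : WithTop ℕ∞))).contDiffAt.comp₂ (hg' z hz) hc2
      rw [← iteratedFDeriv_add_apply hc3 hc4]
      congr 1
      ext y
      simp
    have hd0 : 0 ≤ diamC := zero_le_one.trans one_le_diamC
    set s := ‖z - w‖ ^ α with hs
    have hs0 : 0 ≤ s := Real.rpow_nonneg (norm_nonneg _) _
    have hlip : ‖w - z‖ ≤ diamC * s := by
      rw [hs, norm_sub_rev]; exact norm_sub_le_rpow hα0 hα1 hz hw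
    have b1 : ∀ j ≤ k, ‖iteratedFDeriv ℝ j (fun y => g (y + h) - g y) z‖ ≤ (C * diamC) * s := by
      intro j hj
      have hjk : (j : WithTop ℕ∞) ≤ k := by exact_mod_cast hj
      rw [iteratedFDeriv_sub_at (contDiffAt_shift hw' ((hg' w hw).of_le hjk)) ((hg' z hz).of_le hjk), iteratedFDeriv_shift hw']
      refine (norm_iteratedFDeriv_sub_le (fun y hy => (hg y hy).of_le ?_)
        (fun y hy => hC y hy (j + 1) (by omega)) hw hz).trans ?_
      · exact_mod_cast Nat.succ_le_succ hj
      · rw [mul_assoc]; exact mul_le_mul_of_nonneg_left hlip hC0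
    have b2 : ∀ j ≤ k, ‖iteratedFDeriv ℝ j (fun y => f (y + h) - f y) z‖ ≤ (A * diamC) * s := by
      intro j hj
      have hjk : (j : WithTop ℕ∞) ≤ k := by exact_mod_cast hj
      rw [iteratedFDeriv_sub_at (contDiffAt_shift hw' ((hf.contDiffAt w hw).of_le hjk)) ((hf.contDiffAt z hz).of_le hjk),
        iteratedFDeriv_shift hw']
      rcases hj.eq_or_lt with rfl | hlt
      · have := hf.holder h0 z hz w hw
        rw [norm_sub_rev] at this
        refine this.trans ?_
        rw [mul_assoc]
        exact mul_le_mul_of_nonneg_left (le_mul_of_one_le_left hs0 one_le_diamC) hA0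
      · refine (norm_iteratedFDeriv_sub_le (fun y hy => (hf.contDiffAt y hy).of_le ?_)
          (fun y hy => hf.bound y hy (j + 1) (by omega)) hw hz).trans ?_
        · exact_mod_cast hlt
        · rw [mul_assoc]; exact mul_le_mul_of_nonneg_left hlip hA0
    have t1 := norm_iteratedFDeriv_bilin_weighted B hc1 (contDiffAt_shift hw' (hf.contDiffAt w hw)) le_rfl
      (mul_nonneg hC0 hd0) hA0 (w₁ := fun _ => s) (w₂ := fun _ => 1) (w := s) b1
      (fun i hi => by rw [iteratedFDeriv_shift hw', mul_one]; exact hf.bound w hw i hi) (fun _ _ => by simp)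
    have t2 := norm_iteratedFDeriv_bilin_weighted B (hg' z hz) hc2 le_rfl
      hC0 (mul_nonneg hA0 hd0) (w₁ := fun _ => 1) (w₂ := fun _ => s) (w := s)
      (fun i hi => by rw [mul_one]; exact hC z hz i (by omega)) b2 (fun _ _ => by simp)
    rw [norm_sub_rev, hsplit]
    refine (norm_add_le _ _).trans ((add_le_add t1 t2).trans (le_of_eq ?_))
    ring

lemma HolderB.clm (L : V →L[ℝ] W) (hf : HolderB k α A f) :
    HolderB k α (‖L‖ * A) (fun z => L (f z)) := by
  have e : ∀ z ∈ hypBall n 2, iteratedFDeriv ℝ k (fun z => L (f z)) z =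
      L.compContinuousMultilinearMap (iteratedFDeriv ℝ k f z) := fun z hz =>
    L.iteratedFDeriv_comp_left (hf.contDiffAt z hz) le_rfl
  refine ⟨fun z hz => L.contDiff.contDiffAt.comp z (hf.contDiffAt z hz), fun z hz j hj => ?_,
    fun h0 z hz w hw => ?_⟩
  · exact (L.norm_iteratedFDeriv_comp_left (hf.contDiffAt z hz) (by exact_mod_cast hj)).trans
      (mul_le_mul_of_nonneg_left (hf.bound z hz j hj) (norm_nonneg _))
  · rw [e z hz, e w hw]
    have : L.compContinuousMultilinearMap (iteratedFDeriv ℝ k f z) -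
        L.compContinuousMultilinearMap (iteratedFDeriv ℝ k f w) =
        L.compContinuousMultilinearMap (iteratedFDeriv ℝ k f z - iteratedFDeriv ℝ k f w) := by
      ext v; simp
    rw [this, mul_assoc]
    exact (L.norm_compContinuousMultilinearMap_le _).trans
      (mul_le_mul_of_nonneg_left (hf.holder h0 z hz w hw) (norm_nonneg _))

end Holder

end WAH

end

noncomputable section

namespace WAH

open Filter Topology Function IsManifold

set_option linter.unusedSectionVars false

/-! ### Charts, scales and weights of the Möbius cover -/

lemma inverse_smul_id {n : ℕ} {t : ℝ} (ht : t ≠ 0) :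
    (t • ContinuousLinearMap.id ℝ (EE n)).IsInvertible ∧
    (t • ContinuousLinearMap.id ℝ (EE n)).inverse = t⁻¹ • ContinuousLinearMap.id ℝ (EE n) := by
  have h : (t • ContinuousLinearMap.id ℝ (EE n)).IsInvertible :=
    ⟨ContinuousLinearEquiv.smulLeft (Units.mk0 t ht), rfl⟩
  refine ⟨h, inverse_eq_of_comp_eq_id h ?_⟩
  ext1 v
  simp [smul_smul, mul_inv_cancel₀ ht]

/-- With s = t⁻¹ the factor is t to the power of the weight; this is why the weight is the natural
decay rate of a tensor with bounded chart components. -/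
lemma Tensor.pull_smul_id {n a b : ℕ} (A B : EE n →L[ℝ] EE n) (t s : ℝ) (T : Tensor n a b) :
    T.pull (A.comp (t • ContinuousLinearMap.id ℝ (EE n)))
      ((s • ContinuousLinearMap.id ℝ (EE n)).comp B) = (t ^ a * s ^ b) • T.pull A B := by
  apply Tensor.ext'
  intro v φ
  have h1 : (fun i => (A.comp (t • ContinuousLinearMap.id ℝ (EE n))) (v i)) =
      fun i => t • A (v i) := by ext1 i; simp
  have h2 : (fun i => (φ i).comp ((s • ContinuousLinearMap.id ℝ (EE n)).comp B)) =
      fun i => s • (φ i).comp B := by ext1 i; ext1 w; simp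
  rw [Tensor.pull_apply, h1, h2]
  have h3 := ContinuousMultilinearMap.map_smul_univ T (fun _ => t) (fun i => A (v i))
  rw [h3]
  simp only [Finset.prod_const, Finset.card_univ, Fintype.card_fin]
  have h4 := ContinuousMultilinearMap.map_smul_univ
    (T (fun i => A (v i)) : (EE n →L[ℝ] ℝ) [×b]→L[ℝ] ℝ) (fun _ => s) (fun i => (φ i).comp B)
  simp only [Finset.prod_const, Finset.card_univ, Fintype.card_fin] at h4
  rw [_root_.smul_apply, ContraTensor.smul_apply, ContraTensor.smul_apply, Tensor.pull_apply, mul_assoc]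
  congr 1

variable {n : ℕ} {Mb : Type*} [TopologicalSpace Mb] [ChartedSpace (EuclideanHalfSpace (n + 1)) Mb]
  {ρ : Mb → ℝ} (𝒜 : MobiusCover n Mb ρ)

namespace MobiusCover

/-- The indices of the parametrizations. -/
abbrev Ix := 𝒜.ι ⊕ 𝒜.ι₀

/-- The indices of the charts. -/
abbrev Cx := 𝒜.κ ⊕ 𝒜.ι₀

/-- The charts used by the parametrizations. -/
def bchart : 𝒜.Cx → OpenPartialHomeomorph Mb (EuclideanHalfSpace (n + 1)) :=
  Sum.elim 𝒜.chart 𝒜.intChart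

/-- The compact sets that contain the images of the parametrizations. -/
def bK : 𝒜.Cx → Set Mb :=
  Sum.elim 𝒜.K fun i => cpar (𝒜.intChart i) '' hypClosedBall n 2

/-- The chart used by a parametrization. -/
def ci : 𝒜.Ix → 𝒜.Cx := Sum.map 𝒜.idx id

/-- The center of a parametrization, in coordinates. -/
def ctr : 𝒜.Ix → EE n := Sum.elim 𝒜.center fun _ => basePt n

/-- The chart of a parametrization. -/
abbrev ech (i : 𝒜.Ix) := 𝒜.bchart (𝒜.ci i)

/-- The scale of a parametrization. -/
abbrev sc (i : 𝒜.Ix) : ℝ := 𝒜.ctr i 0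

/-- The components of a tensor field in a chart, in the coordinates of the parametrization. -/
def crep {a b : ℕ} (u : TensorField n Mb a b) (i : 𝒜.Ix) (z : EE n) : Tensor n a b :=
  pullback (cpar (𝒜.ech i)) u (mobius (𝒜.ctr i) z)

instance : Finite 𝒜.Cx := by
  have := 𝒜.finite_κ
  have := 𝒜.finite_ι₀
  infer_instance

lemma bchart_mem (c : 𝒜.Cx) : 𝒜.bchart c ∈ maximalAtlas (𝓡∂ (n + 1)) ∞ Mb := by
  cases c with
  | inl c => exact 𝒜.chart_mem c
  | inr c => exact 𝒜.intChart_mem c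

lemma sc_pos (i : 𝒜.Ix) : 0 < 𝒜.sc i := by
  cases i with
  | inl i => exact 𝒜.center_pos i
  | inr i => simp [sc, ctr]

end MobiusCover

lemma mobius_basePt (z : EE n) : mobius (basePt n) z = z := by
  simp [mobius]

lemma hypClosedBall_subset_cdom (i : 𝒜.ι₀) : hypClosedBall n 2 ⊆ cdom (𝒜.intChart i) :=
  fun _ hz => ⟨𝒜.ball_subset i hz, hz.1⟩

namespace MobiusCover

lemma bK_compact (c : 𝒜.Cx) : IsCompact (𝒜.bK c) := by
  cases c with
  | inl c => exact 𝒜.K_compact c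
  | inr c =>
    exact (isCompact_hypClosedBall two_pos).image_of_continuousOn fun z hz =>
      (continuousAt_cpar (hypClosedBall_subset_cdom 𝒜 c hz)).continuousWithinAt

lemma bK_subset (c : 𝒜.Cx) : 𝒜.bK c ⊆ (𝒜.bchart c).source := by
  cases c with
  | inl c => exact 𝒜.K_subset c
  | inr c =>
    rintro _ ⟨z, hz, rfl⟩
    exact cpar_mem_source (hypClosedBall_subset_cdom 𝒜 c hz)

lemma param_eq (i : 𝒜.Ix) (z : EE n) :
    𝒜.param i z = cpar (𝒜.ech i) (mobius (𝒜.ctr i) z) := by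
  cases i with
  | inl i => rfl
  | inr i => exact (congrArg (cpar (𝒜.intChart i)) (mobius_basePt z)).symm

/-- The interior coordinate points whose image lies in the compact set of the chart. -/
abbrev dset (c : 𝒜.Cx) : Set (EE n) := cset (𝒜.bchart c) (𝒜.bK c)

lemma mobius_mem_dset (i : 𝒜.Ix) {z : EE n} (hz : z ∈ hypBall n 2) :
    mobius (𝒜.ctr i) z ∈ 𝒜.dset (𝒜.ci i) := by
  cases i with
  | inl i =>
    obtain ⟨p, hp, h⟩ := 𝒜.image_subset i z hz
    have hps := 𝒜.K_subset _ hp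
    have h0 : 0 < mobius (𝒜.center i) z 0 := by
      rw [mobius_zero]; exact mul_pos (𝒜.center_pos i) hz.1
    change mobius (𝒜.center i) z ∈ cset (𝒜.chart (𝒜.idx i)) (𝒜.K (𝒜.idx i))
    rw [← h]
    rw [← h] at h0
    exact ⟨(ccoord_mem_cdom_iff hps).2 h0, by
      have := cpar_ccoord hps
      rw [ccoord] at this
      rwa [this]⟩
  | inr i =>
    have h1 : z ∈ cset (𝒜.intChart i) (cpar (𝒜.intChart i) '' hypClosedBall n 2) :=
      ⟨hypClosedBall_subset_cdom 𝒜 i (hypBall_subset_hypClosedBall hz),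
        z, hypBall_subset_hypClosedBall hz, rfl⟩
    rw [← mobius_basePt z] at h1
    exact h1

lemma mobius_mem_cdom (i : 𝒜.Ix) {z : EE n} (hz : z ∈ hypBall n 2) :
    mobius (𝒜.ctr i) z ∈ cdom (𝒜.ech i) := (𝒜.mobius_mem_dset i hz).1

variable [IsManifold (𝓡∂ (n + 1)) ∞ Mb]

lemma param_mem_interior (i : 𝒜.Ix) {z : EE n} (hz : z ∈ hypBall n 2) :
    𝒜.param i z ∈ (𝓡∂ (n + 1)).interior Mb := by
  rw [param_eq]
  exact isInteriorPoint_cpar (𝒜.bchart_mem _) (𝒜.mobius_mem_cdom i hz)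

lemma exists_param {p : Mb} (hp : p ∈ (𝓡∂ (n + 1)).interior Mb) :
    ∃ i, ∃ z ∈ hypBall n 1, 𝒜.param i z = p := by
  rcases 𝒜.cover p hp with ⟨i, z, hz, h⟩ | ⟨i, z, hz, h⟩
  · exact ⟨Sum.inl i, z, hz, h⟩
  · exact ⟨Sum.inr i, z, hz, h⟩

/-- The parametrizations whose image contains `p`. -/
def around (p : Mb) : Set 𝒜.Ix := {i | ∃ z ∈ hypBall n 2, 𝒜.param i z = p}

lemma exists_encard_around_le : ∃ N : ℕ, ∀ p ∈ (𝓡∂ (n + 1)).interior Mb,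
    (𝒜.around p).encard ≤ N := by
  obtain ⟨N, hN⟩ := 𝒜.locallyFinite
  have := 𝒜.finite_ι₀
  refine ⟨N + Nat.card 𝒜.ι₀, fun p hp => ?_⟩
  have h1 : 𝒜.around p ⊆ Sum.inl '' {i | ∃ z ∈ hypBall n 2,
      ((𝒜.chart (𝒜.idx i)).extend (𝓡∂ (n + 1))).symm (mobius (𝒜.center i) z) = p} ∪
      Sum.inr '' Set.univ := by
    rintro (i | i) hi
    · exact Or.inl ⟨i, hi, rfl⟩
    · exact Or.inr ⟨i, trivial, rfl⟩
  refine (Set.encard_le_encard h1).trans ((Set.encard_union_le _ _).trans ?_)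
  rw [Sum.inl_injective.encard_image, Sum.inr_injective.encard_image, Set.encard_univ,
    Nat.cast_add]
  refine add_le_add (hN p hp) ?_
  simp [ENat.card_eq_coe_natCard]

lemma finite_around {p : Mb} (hp : p ∈ (𝓡∂ (n + 1)).interior Mb) : (𝒜.around p).Finite := by
  obtain ⟨N, hN⟩ := 𝒜.exists_encard_around_le
  exact Set.finite_of_encard_le_coe (hN p hp)

lemma dParam_param (i : 𝒜.Ix) {z : EE n} (hz : z ∈ hypBall n 2) :
    dParam (𝒜.param i) z = (dParam (cpar (𝒜.ech i)) (mobius (𝒜.ctr i) z)).comp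
      (𝒜.sc i • ContinuousLinearMap.id ℝ (EE n)) := by
  have h1 : 𝒜.param i = cpar (𝒜.ech i) ∘ mobius (𝒜.ctr i) := funext fun y => 𝒜.param_eq i y
  have h2 : HasFDerivAt (mobius (𝒜.ctr i)) (𝒜.sc i • ContinuousLinearMap.id ℝ (EE n)) z := by
    unfold mobius
    exact (((hasFDerivAt_id z).sub_const (basePt n)).const_smul (𝒜.ctr i 0)).const_add _
  have h3 : MDifferentiableAt 𝓘(ℝ, EE n) 𝓘(ℝ, EE n) (mobius (𝒜.ctr i)) z :=
    h2.differentiableAt.mdifferentiableAt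
  have h4 := mfderiv_comp (I := 𝓘(ℝ, EE n)) z
    (mdifferentiableAt_cpar (𝒜.bchart_mem _) (𝒜.mobius_mem_cdom i hz)) h3
  rw [mfderiv_eq_fderiv, h2.fderiv] at h4
  rw [h1]
  exact h4

/-- The ratio of the defining function to the scale of the parametrization. -/
def wt (δ : ℝ) (i : 𝒜.Ix) (z : EE n) : ℝ := (ρ (𝒜.param i z) / 𝒜.sc i) ^ (-δ)

lemma rho_pos (hρ : IsDefiningFunction n ρ) {p : Mb} (hp : p ∈ (𝓡∂ (n + 1)).interior Mb) :
    0 < ρ p := by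
  refine lt_of_le_of_ne (hρ.nonneg p) fun h => ?_
  have h1 := (hρ.eq_zero_iff p).1 h.symm
  rw [← ModelWithCorners.compl_interior] at h1
  exact h1 hp

lemma rho_param_pos (hρ : IsDefiningFunction n ρ) (i : 𝒜.Ix) {z : EE n} (hz : z ∈ hypBall n 2) :
    0 < ρ (𝒜.param i z) := rho_pos hρ (𝒜.param_mem_interior i hz)

/-- The differential of a parametrization is `sc i` times that of the chart parametrization, which
gives `sc i` ^ r; writing ρ as `sc i` times a ratio gives `sc i` ^ (-δ) and leaves `wt`. -/
lemma rep_eq (hρ : IsDefiningFunction n ρ) {a b : ℕ} (δ : ℝ) (u : TensorField n Mb a b) (i : 𝒜.Ix)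
    {z : EE n} (hz : z ∈ hypBall n 2) :
    𝒜.rep δ u i z = (𝒜.sc i) ^ (weight a b - δ) • 𝒜.wt δ i z • 𝒜.crep u i z := by
  have ht := 𝒜.sc_pos i
  have hr := 𝒜.rho_param_pos hρ i hz
  have hi := isInvertible_dParam (𝒜.bchart_mem _) (𝒜.mobius_mem_cdom i hz)
  have hs := inverse_smul_id (n := n) ht.ne'
  rw [rep, pullback, 𝒜.dParam_param i hz, hi.inverse_comp_of_left, hs.2, Tensor.pull_smul_id, wt,
    crep, pullback, ← 𝒜.param_eq i z, ← Tensor.pullL_apply, ← Tensor.pullL_apply, map_smul,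
    smul_smul, smul_smul]
  congr 1
  rw [Real.div_rpow hr.le ht.le, Real.rpow_sub ht, weight, Real.rpow_sub ht, Real.rpow_natCast,
    Real.rpow_natCast, Real.rpow_neg ht.le, inv_pow]
  have h1 : 𝒜.sc i ^ δ ≠ 0 := (Real.rpow_pos_of_pos ht _).ne'
  have h2 : 𝒜.sc i ^ b ≠ 0 := (pow_pos ht _).ne'
  field_simp

lemma wt_inl (δ : ℝ) (i : 𝒜.ι) {z : EE n} (hz : z ∈ hypBall n 2) :
    𝒜.wt δ (Sum.inl i) z = (z 0) ^ (-δ) := by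
  have h1 := 𝒜.mobius_mem_cdom (Sum.inl i) hz
  have h2 : ρ (𝒜.param (Sum.inl i) z) = 𝒜.sc (Sum.inl i) * z 0 := by
    rw [param_eq, ← mobius_zero]
    have h3 := 𝒜.chart_rho (𝒜.idx i) _ (cpar_mem_source (e := 𝒜.chart (𝒜.idx i)) h1)
    exact h3.symm.trans (congrArg (fun y : EE n => y 0) (ccoord_cpar h1))
  rw [wt, h2, mul_div_cancel_left₀ _ (𝒜.sc_pos _).ne']

lemma wt_inr (δ : ℝ) (i : 𝒜.ι₀) (z : EE n) :
    𝒜.wt δ (Sum.inr i) z = (ρ (cpar (𝒜.intChart i) z)) ^ (-δ) := by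
  rw [wt, show 𝒜.sc (Sum.inr i) = 1 by simp [sc, ctr], div_one]
  rfl

/-- For a Möbius parametrization ρ is `sc i` times the last half-space coordinate, so the weight is
one fixed function for all of them; the remaining parametrizations are finite in number. -/
lemma exists_wt_bound (hρ : IsDefiningFunction n ρ) (δ : ℝ) (k : ℕ) :
    ∃ C : ℝ, 0 ≤ C ∧ ∀ i, ∀ z ∈ hypBall n 2, ContDiffAt ℝ k (𝒜.wt δ i) z ∧
      ∀ j ≤ k, ‖iteratedFDeriv ℝ j (𝒜.wt δ i) z‖ ≤ C := by
  have hB := isOpen_hypBall (n := n) two_pos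
  have hcoord : ContDiff ℝ (∞ : WithTop ℕ∞) (fun z : EE n => z 0) := by fun_prop
  have h1 : BddJets (fun z : EE n => (z 0) ^ (-δ)) (hypBall n 2) := by
    refine ContDiffOn.bddJets (s := {z : EE n | 0 < z 0}) (fun z hz => ?_) ?_
      (isCompact_hypClosedBall two_pos) (fun z hz => hz.1) hypBall_subset_hypClosedBall
      (fun z hz => ?_)
    · exact (hcoord.contDiffAt.rpow_const_of_ne (ne_of_gt hz)).contDiffWithinAt
    · exact (isOpen_lt continuous_const (by fun_prop)).uniqueDiffOn
    · exact (isOpen_lt continuous_const (by fun_prop)).mem_nhds hz.1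
  have h2 : ∀ i : 𝒜.ι₀, BddJets (fun z : EE n => (ρ (cpar (𝒜.intChart i) z)) ^ (-δ))
      (hypBall n 2) := by
    intro i
    refine ContDiffOn.bddJets (s := cdom (𝒜.intChart i)) (fun z hz => ?_)
      (isOpen_cdom _).uniqueDiffOn
      (isCompact_hypClosedBall two_pos) (hypClosedBall_subset_cdom 𝒜 i) hypBall_subset_hypClosedBall
      (fun z hz => cdom_mem_nhds (hypClosedBall_subset_cdom 𝒜 i (hypBall_subset_hypClosedBall hz)))
    have h3 : ContDiffAt ℝ (∞ : WithTop ℕ∞) (fun z => ρ (cpar (𝒜.intChart i) z)) z :=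
      contMDiffAt_iff_contDiffAt.1
        (hρ.smooth.contMDiffAt.comp z (contMDiffAt_cpar (𝒜.intChart_mem i) hz))
    refine (h3.rpow_const_of_ne (ne_of_gt ?_)).contDiffWithinAt
    exact rho_pos hρ (isInteriorPoint_cpar (𝒜.intChart_mem i) hz)
  obtain ⟨C, hC, hC1⟩ := h1.bound k
  choose D hD hD1 using fun i => (h2 i).bound k
  have := 𝒜.finite_ι₀
  have := Fintype.ofFinite 𝒜.ι₀
  refine ⟨C + ∑ i, D i, add_nonneg hC (Finset.sum_nonneg fun i _ => hD i), fun i z hz => ?_⟩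
  cases i with
  | inl i =>
    have he : 𝒜.wt δ (Sum.inl i) =ᶠ[𝓝 z] fun z : EE n => (z 0) ^ (-δ) := by
      filter_upwards [hB.mem_nhds hz] with y hy
      exact 𝒜.wt_inl δ i hy
    refine ⟨(h1.contDiffAt_nat hz k).congr_of_eventuallyEq he, fun j hj => ?_⟩
    rw [(he.iteratedFDeriv ℝ j).self_of_nhds]
    exact (hC1 z hz j hj).trans (le_add_of_nonneg_right (Finset.sum_nonneg fun i _ => hD i))
  | inr i =>
    have he : 𝒜.wt δ (Sum.inr i) = fun z : EE n => (ρ (cpar (𝒜.intChart i) z)) ^ (-δ) :=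
      funext (𝒜.wt_inr δ i)
    rw [he]
    refine ⟨(h2 i).contDiffAt_nat hz k, fun j hj => (hD1 i z hz j hj).trans ?_⟩
    exact (Finset.single_le_sum (f := D) (fun i _ => hD i) (Finset.mem_univ i)).trans
      (le_add_of_nonneg_left hC)

lemma wt_mul_wt_neg (hρ : IsDefiningFunction n ρ) (δ : ℝ) (i : 𝒜.Ix) {z : EE n}
    (hz : z ∈ hypBall n 2) : 𝒜.wt (-δ) i z * 𝒜.wt δ i z = 1 := by
  have h := div_pos (𝒜.rho_param_pos hρ i hz) (𝒜.sc_pos i)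
  rw [wt, wt, ← Real.rpow_add h]
  simp

/-- The defining function is comparable to the scale on the image of a parametrization. -/
lemma exists_rho_compare (hρ : IsDefiningFunction n ρ) : ∃ C : ℝ, 1 ≤ C ∧ ∀ i, ∀ z ∈ hypBall n 2,
    ρ (𝒜.param i z) ≤ C * 𝒜.sc i ∧ 𝒜.sc i ≤ C * ρ (𝒜.param i z) := by
  obtain ⟨C, hC, h1⟩ := 𝒜.exists_wt_bound hρ (-1) 0
  obtain ⟨D, hD, h2⟩ := 𝒜.exists_wt_bound hρ 1 0
  refine ⟨1 + C + D, by linarith, fun i z hz => ?_⟩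
  have ht := 𝒜.sc_pos i
  have hr := 𝒜.rho_param_pos hρ i hz
  have h3 := (h1 i z hz).2 0 le_rfl
  have h4 := (h2 i z hz).2 0 le_rfl
  rw [norm_iteratedFDeriv_zero, wt, neg_neg, Real.rpow_one, Real.norm_of_nonneg (by positivity),
    div_le_iff₀ ht] at h3
  rw [norm_iteratedFDeriv_zero, wt, Real.rpow_neg_one, Real.norm_of_nonneg (by positivity), inv_div,
    div_le_iff₀ hr] at h4
  constructor
  · nlinarith
  · nlinarith

/-- Scales are comparable to values of ρ, which is bounded on the compact manifold. -/
lemma exists_sc_le [CompactSpace Mb] (hρ : IsDefiningFunction n ρ) :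
    ∃ E : ℝ, 1 ≤ E ∧ ∀ i, 𝒜.sc i ≤ E := by
  obtain ⟨C, hC, h1⟩ := 𝒜.exists_rho_compare hρ
  obtain ⟨R, hR⟩ := isCompact_univ.exists_bound_of_continuousOn hρ.smooth.continuous.continuousOn
  refine ⟨1 + C * |R|, by nlinarith [abs_nonneg R], fun i => ?_⟩
  have h2 := (h1 i _ (basePt_mem_hypBall two_pos)).2
  have h3 := (le_abs_self _).trans ((hR (𝒜.param i (basePt n)) trivial).trans (le_abs_self R))
  nlinarith

lemma exists_sc_compare (hρ : IsDefiningFunction n ρ) : ∃ C : ℝ, 1 ≤ C ∧ ∀ i i', ∀ z ∈ hypBall n 2,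
    ∀ z' ∈ hypBall n 2, 𝒜.param i z = 𝒜.param i' z' → 𝒜.sc i ≤ C * 𝒜.sc i' := by
  obtain ⟨C, hC, h1⟩ := 𝒜.exists_rho_compare hρ
  refine ⟨C * C, by nlinarith, fun i i' z hz z' hz' h => ?_⟩
  have h2 := (h1 i z hz).2
  have h3 := (h1 i' z' hz').1
  rw [h] at h2
  nlinarith

end MobiusCover

end WAH

end

noncomputable section

namespace WAH

open Filter Topology Function IsManifold

set_option linter.unusedSectionVars false

/-! ### Derivatives measured at a given scale -/

section SJet

variable {X V W G : Type*} [NormedAddCommGroup X] [NormedSpace ℝ X]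
  [NormedAddCommGroup V] [NormedSpace ℝ V] [NormedAddCommGroup W] [NormedSpace ℝ W]
  [NormedAddCommGroup G] [NormedSpace ℝ G]

/-- The derivatives of `f` at `z` up to order `k`, measured at the scale `ε`, are bounded by `A`. -/
structure SJet (ε : ℝ) (k : ℕ) (A : ℝ) (f : X → V) (z : X) : Prop where
  contDiffAt : ContDiffAt ℝ k f z
  bound : ∀ j ≤ k, ε ^ j * ‖iteratedFDeriv ℝ j f z‖ ≤ A

variable {ε A A' : ℝ} {k : ℕ} {f : X → V} {z : X}

lemma SJet.nonneg (h : SJet ε k A f z) : 0 ≤ A := by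
  have := h.bound 0 (Nat.zero_le _)
  rw [pow_zero, one_mul] at this
  exact (norm_nonneg _).trans this

lemma SJet.mono (h : SJet ε k A f z) (hA : A ≤ A') : SJet ε k A' f z :=
  ⟨h.contDiffAt, fun j hj => (h.bound j hj).trans hA⟩

lemma SJet.congr {g : X → V} (h : SJet ε k A f z) (hfg : g =ᶠ[𝓝 z] f) : SJet ε k A g z :=
  ⟨h.contDiffAt.congr_of_eventuallyEq hfg, fun j hj => by
    rw [(hfg.iteratedFDeriv ℝ j).self_of_nhds]; exact h.bound j hj⟩

lemma SJet.bilin {g : X → W} (B : V →L[ℝ] W →L[ℝ] G) (hε : 0 < ε) (hf : SJet ε k A f z)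
    (hg : SJet ε k A' g z) : SJet ε k (‖B‖ * 2 ^ k * A * A') (fun y => B (f y) (g y)) z := by
  have hA := hf.nonneg
  have hA' := hg.nonneg
  refine ⟨(B.isBoundedBilinearMap.contDiff (n := (k : WithTop ℕ∞))).contDiffAt.comp₂ hf.contDiffAt
    hg.contDiffAt, fun q hq => ?_⟩
  have h1 := norm_iteratedFDeriv_bilin_weighted B hf.contDiffAt hg.contDiffAt hq hA hA'
    (w₁ := fun j => (ε ^ j)⁻¹) (w₂ := fun j => (ε ^ j)⁻¹) (w := (ε ^ q)⁻¹)
    (fun j hj => by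
      rw [← div_eq_mul_inv, le_div_iff₀' (by positivity)]; exact hf.bound j (hj.trans hq))
    (fun j hj => by
      rw [← div_eq_mul_inv, le_div_iff₀' (by positivity)]; exact hg.bound j (hj.trans hq))
    (fun j hj => by rw [← mul_inv, ← pow_add, Nat.add_sub_cancel' hj])
  rw [← div_eq_mul_inv, le_div_iff₀' (by positivity)] at h1
  refine h1.trans ?_
  have h2 : (2 : ℝ) ^ q ≤ 2 ^ k := pow_le_pow_right₀ (by norm_num) hq
  gcongr

set_option maxSynthPendingDepth 3 in
lemma SJet.apply {F : X → V →L[ℝ] W} {g : X → V} (hε : 0 < ε) (hF : SJet ε k A F z)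
    (hg : SJet ε k A' g z) : SJet ε k (2 ^ k * A * A') (fun y => F y (g y)) z := by
  refine (hF.bilin (ContinuousLinearMap.id ℝ (V →L[ℝ] W)) hε hg).mono ?_
  have h1 := ContinuousLinearMap.norm_id_le (𝕜 := ℝ) (E := V →L[ℝ] W)
  have hA := hF.nonneg
  have hA' := hg.nonneg
  calc _ ≤ 1 * 2 ^ k * A * A' := by gcongr
    _ = _ := by ring

set_option maxSynthPendingDepth 3 in
lemma SJet.smul {c : X → ℝ} {g : X → V} (hε : 0 < ε) (hc : SJet ε k A c z)
    (hg : SJet ε k A' g z) : SJet ε k (2 ^ k * A * A') (fun y => c y • g y) z := by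
  refine (hc.bilin (ContinuousLinearMap.lsmul ℝ ℝ) hε hg).mono ?_
  have h1 := ContinuousLinearMap.opNorm_lsmul_le (𝕜 := ℝ) (R := ℝ) (E := V)
  have hA := hc.nonneg
  have hA' := hg.nonneg
  calc _ ≤ 1 * 2 ^ k * A * A' := by gcongr
    _ = _ := by ring

lemma SJet.sub {g : X → V} (hε : 0 < ε) (hf : SJet ε k A f z) (hg : SJet ε k A' g z) :
    SJet ε k (A + A') (fun y => f y - g y) z := by
  refine ⟨hf.contDiffAt.sub hg.contDiffAt, fun j hj => ?_⟩
  have hjk : (j : WithTop ℕ∞) ≤ k := by exact_mod_cast hj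
  rw [iteratedFDeriv_sub_at (hf.contDiffAt.of_le hjk) (hg.contDiffAt.of_le hjk)]
  calc _ ≤ ε ^ j * (‖iteratedFDeriv ℝ j f z‖ + ‖iteratedFDeriv ℝ j g z‖) :=
        mul_le_mul_of_nonneg_left (norm_sub_le _ _) (by positivity)
    _ ≤ A + A' := by rw [mul_add]; exact add_le_add (hf.bound j hj) (hg.bound j hj)

lemma SJet.add {g : X → V} (hε : 0 < ε) (hf : SJet ε k A f z) (hg : SJet ε k A' g z) :
    SJet ε k (A + A') (fun y => f y + g y) z := by
  refine ⟨hf.contDiffAt.add hg.contDiffAt, fun j hj => ?_⟩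
  have hjk : (j : WithTop ℕ∞) ≤ k := by exact_mod_cast hj
  have h1 : iteratedFDeriv ℝ j (fun y => f y + g y) z =
      iteratedFDeriv ℝ j f z + iteratedFDeriv ℝ j g z :=
    iteratedFDeriv_add_apply (hf.contDiffAt.of_le hjk) (hg.contDiffAt.of_le hjk)
  rw [h1]
  calc _ ≤ ε ^ j * (‖iteratedFDeriv ℝ j f z‖ + ‖iteratedFDeriv ℝ j g z‖) :=
        mul_le_mul_of_nonneg_left (norm_add_le _ _) (by positivity)
    _ ≤ A + A' := by rw [mul_add]; exact add_le_add (hf.bound j hj) (hg.bound j hj)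

lemma SJet.zero (hA : 0 ≤ A) : SJet ε k A (fun _ : X => (0 : V)) z :=
  ⟨contDiffAt_const, fun j _ => by
    have : iteratedFDeriv ℝ j (fun _ : X => (0 : V)) z = 0 :=
      congrFun (iteratedFDeriv_fun_zero (𝕜 := ℝ) (n := j)) z
    rw [this]; simpa using hA⟩

lemma SJet.sum {ι : Type*} (s : Finset ι) {f : ι → X → V} (hε : 0 < ε)
    (hf : ∀ i ∈ s, SJet ε k A (f i) z) :
    SJet ε k (s.card * A) (fun y => ∑ i ∈ s, f i y) z := by
  classical
  induction s using Finset.induction_on with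
  | empty => simpa using SJet.zero (X := X) (V := V) (ε := ε) (k := k) (z := z) le_rfl
  | insert i s hi ih =>
    have h1 := (hf i (Finset.mem_insert_self i s)).add hε
      (ih fun j hj => hf j (Finset.mem_insert_of_mem hj))
    simp only [Finset.sum_insert hi, Finset.card_insert_of_notMem hi]
    exact h1.mono (by push_cast; linarith)

/-- Composition with a map whose derivatives are bounded at the scale `1`, where `ε ≤ E`. -/
lemma SJet.comp {g : V → W} {C E : ℝ} (hε : 0 < ε) (hE : 1 ≤ E) (hεE : ε ≤ E) (hC : 1 ≤ C)
    (hg : SJet ε k A g (f z)) (hf : ContDiffAt ℝ k f z)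
    (hfC : ∀ j ≤ k, ‖iteratedFDeriv ℝ j f z‖ ≤ C) :
    SJet ε k (k.factorial * A * (E * C) ^ k) (fun y => g (f y)) z := by
  have hA := hg.nonneg
  refine ⟨hg.contDiffAt.comp z hf, fun q hq => ?_⟩
  have hEC : 1 ≤ E * C := one_le_mul_of_one_le_of_one_le hE hC
  have h1 := norm_iteratedFDeriv_comp_scale hg.contDiffAt hf hq hε (C := A) (D := E * C)
    (fun j hj => hg.bound j (hj.trans hq)) (fun j hj1 hj => by
      -- One factor ε is split off, as the rescaled chain rule demands; the remaining powers of ε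
      -- are absorbed by E.
      obtain ⟨i, rfl⟩ := Nat.exists_eq_add_of_le' hj1
      calc ε ^ (i + 1) * ‖iteratedFDeriv ℝ (i + 1) f z‖ ≤ ε ^ (i + 1) * C :=
            mul_le_mul_of_nonneg_left (hfC _ (hj.trans hq)) (by positivity)
        _ = ε * (ε ^ i * C) := by ring
        _ ≤ ε * (E ^ (i + 1) * C ^ (i + 1)) := by
            gcongr
            · calc ε ^ i ≤ E ^ i := pow_le_pow_left₀ hε.le hεE i
                _ ≤ E ^ (i + 1) := pow_le_pow_right₀ hE (Nat.le_succ i)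
            · exact le_self_pow₀ hC (Nat.succ_ne_zero i)
        _ = ε * (E * C) ^ (i + 1) := by rw [mul_pow])
  refine h1.trans ?_
  have h2 : (q.factorial : ℝ) ≤ k.factorial := by exact_mod_cast Nat.factorial_le hq
  have h3 : (E * C) ^ q ≤ (E * C) ^ k := pow_le_pow_right₀ hEC hq
  gcongr

/-- Composition with a function all of whose derivatives are bounded at the scale `1`. -/
lemma SJet.outer {g : V → W} {C : ℝ} (hε : 0 < ε) (hA : 1 ≤ A) (hf : SJet ε k A f z)
    (hg : ContDiffAt ℝ k g (f z)) (hgC : ∀ j ≤ k, ‖iteratedFDeriv ℝ j g (f z)‖ ≤ C) :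
    SJet ε k (k.factorial * C * A ^ k) (fun y => g (f y)) z := by
  have hC : 0 ≤ C := (norm_nonneg _).trans (hgC 0 (Nat.zero_le _))
  refine ⟨hg.comp z hf.contDiffAt, fun q hq => ?_⟩
  have h1 := norm_iteratedFDeriv_comp hg hf.contDiffAt hq (C := C) (D := A / ε)
    (fun j hj => hgC j (hj.trans hq)) (fun j hj1 hj => by
      rw [div_pow, le_div_iff₀' (by positivity)]
      exact (hf.bound j (hj.trans hq)).trans (le_self_pow₀ hA (by omega)))
  calc _ ≤ ε ^ q * (q.factorial * C * (A / ε) ^ q) := mul_le_mul_of_nonneg_left h1 (by positivity)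
    _ = q.factorial * C * A ^ q := by rw [div_pow]; field_simp
    _ ≤ k.factorial * C * A ^ k := by
        have h2 : (q.factorial : ℝ) ≤ k.factorial := by exact_mod_cast Nat.factorial_le hq
        have h3 : A ^ q ≤ A ^ k := pow_le_pow_right₀ hA hq
        gcongr

lemma SJet.of_bound {C E : ℝ} (hε : 0 < ε) (hE : 1 ≤ E) (hεE : ε ≤ E)
    (hf : ContDiffAt ℝ k f z) (hfC : ∀ j ≤ k, ‖iteratedFDeriv ℝ j f z‖ ≤ C) :
    SJet ε k (E ^ k * C) f z := by
  have hC : 0 ≤ C := (norm_nonneg _).trans (hfC 0 (Nat.zero_le _))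
  refine ⟨hf, fun j hj => ?_⟩
  have h1 : ε ^ j ≤ E ^ k := (pow_le_pow_left₀ hε.le hεE j).trans (pow_le_pow_right₀ hE hj)
  exact mul_le_mul h1 (hfC j hj) (norm_nonneg _) (by positivity)

lemma SJet.scale {ε' c : ℝ} (hε : 0 < ε) (hε' : 0 < ε') (hc : 1 ≤ c) (h : ε' ≤ c * ε)
    (hf : SJet ε k A f z) : SJet ε' k (c ^ k * A) f z := by
  refine ⟨hf.contDiffAt, fun j hj => ?_⟩
  calc ε' ^ j * _ ≤ (c * ε) ^ j * ‖iteratedFDeriv ℝ j f z‖ := by gcongr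
    _ = c ^ j * (ε ^ j * ‖iteratedFDeriv ℝ j f z‖) := by rw [mul_pow, mul_assoc]
    _ ≤ c ^ k * A := mul_le_mul (pow_le_pow_right₀ hc hj) (hf.bound j hj) (by positivity)
        (by positivity)

/-- Uniformity over infinitely many balls rests on this: all estimates are made in finitely many
charts. -/
lemma exists_uniform_bound {ι : Type*} [Finite ι] {f : ι → X → V} {S : ι → Set X}
    (h : ∀ i, BddJets (f i) (S i)) (k : ℕ) : ∃ C : ℝ, 1 ≤ C ∧ ∀ i, ∀ z ∈ S i, ∀ j ≤ k,
      ‖iteratedFDeriv ℝ j (f i) z‖ ≤ C := by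
  have := Fintype.ofFinite ι
  choose C hC h1 using fun i => (h i).bound k
  refine ⟨1 + ∑ i, C i, le_add_of_nonneg_right (Finset.sum_nonneg fun i _ => hC i),
    fun i z hz j hj => (h1 i z hz j hj).trans ?_⟩
  exact (Finset.single_le_sum (fun i _ => hC i) (Finset.mem_univ i)).trans
    (le_add_of_nonneg_left zero_le_one)

end SJet

/-! ### A bump function on the model ball -/

section Bump

variable {n : ℕ}

lemma exists_bumpB (n : ℕ) : ∃ φ : EE n → ℝ, ContDiff ℝ (∞ : WithTop ℕ∞) φ ∧
    (∀ z ∈ hypBall n 1, φ z = 1) ∧ (∀ z ∉ hypClosedBall n (3 / 2), φ z = 0) ∧ ∀ z, 0 ≤ φ z := by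
  have h1 : hypClosedBall n 1 ⊆ interior (hypClosedBall n (3 / 2)) :=
    (hypClosedBall_subset_hypBall (by norm_num)).trans
      (interior_maximal hypBall_subset_hypClosedBall (isOpen_hypBall (by norm_num)))
  obtain ⟨f, hf1, hf2, hf3⟩ := exists_contMDiffMap_one_nhds_of_subset_interior 𝓘(ℝ, EE n) (n := ⊤)
    (isCompact_hypClosedBall one_pos).isClosed h1
  exact ⟨f, contMDiff_iff_contDiff.1 f.contMDiff, fun z hz =>
    hf1.self_of_nhdsSet z (hypBall_subset_hypClosedBall hz), hf2, fun z => (hf3 z).1⟩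

/-- A smooth bump function, equal to one on `B₁` and supported in `B₂`. -/
def bumpB (n : ℕ) : EE n → ℝ := (exists_bumpB n).choose

lemma contDiff_bumpB : ContDiff ℝ (∞ : WithTop ℕ∞) (bumpB n) := (exists_bumpB n).choose_spec.1

lemma bumpB_eq_one {z : EE n} (hz : z ∈ hypBall n 1) : bumpB n z = 1 :=
  (exists_bumpB n).choose_spec.2.1 z hz

lemma mem_of_bumpB_ne_zero {z : EE n} (hz : bumpB n z ≠ 0) : z ∈ hypClosedBall n (3 / 2) := by
  by_contra h
  exact hz ((exists_bumpB n).choose_spec.2.2.1 z h)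

lemma bumpB_nonneg (z : EE n) : 0 ≤ bumpB n z := (exists_bumpB n).choose_spec.2.2.2 z

lemma bddJets_bumpB : BddJets (bumpB n) (hypBall n 2) :=
  bddJets_of_isBounded contDiff_bumpB
    ((isCompact_hypClosedBall two_pos).isBounded.subset hypBall_subset_hypClosedBall)

end Bump

/-! ### Möbius maps as affine rescalings -/

section Mobius

variable {n : ℕ} {V : Type*} [NormedAddCommGroup V] [NormedSpace ℝ V]

/-- The inverse of `mobius`. -/
def minv (p w : EE n) : EE n := basePt n + (p 0)⁻¹ • (w - p)

lemma mobius_minv {p : EE n} (hp : 0 < p 0) (w : EE n) : mobius p (minv p w) = w := by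
  simp [mobius, minv, smul_smul, mul_inv_cancel₀ hp.ne']

lemma minv_mobius {p : EE n} (hp : 0 < p 0) (w : EE n) : minv p (mobius p w) = w := by
  simp [mobius, minv, smul_smul, inv_mul_cancel₀ hp.ne']

lemma mobius_eq (p : EE n) : mobius p = fun z => (p - p 0 • basePt n) + p 0 • z := by
  ext1 z
  rw [mobius, smul_sub]
  abel

lemma minv_eq (p : EE n) : minv p = fun z => (basePt n - (p 0)⁻¹ • p) + (p 0)⁻¹ • z := by
  ext1 z
  rw [minv, smul_sub]
  abel

lemma contDiff_mobius (p : EE n) (k : WithTop ℕ∞) : ContDiff ℝ k (mobius p) := by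
  rw [mobius_eq]; fun_prop

lemma contDiff_minv (p : EE n) (k : WithTop ℕ∞) : ContDiff ℝ k (minv p) := by
  rw [minv_eq]; fun_prop

lemma iteratedFDeriv_comp_mobius {p : EE n} (hp : 0 < p 0) (f : EE n → V) (j : ℕ) (z : EE n) :
    iteratedFDeriv ℝ j (fun y => f (mobius p y)) z = p 0 ^ j • iteratedFDeriv ℝ j f (mobius p z) := by
  simp only [mobius_eq]
  exact iteratedFDeriv_comp_affine f _ hp.ne' j z

lemma iteratedFDeriv_comp_minv {p : EE n} (hp : 0 < p 0) (f : EE n → V) (j : ℕ) (z : EE n) :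
    iteratedFDeriv ℝ j (fun y => f (minv p y)) z =
      (p 0)⁻¹ ^ j • iteratedFDeriv ℝ j f (minv p z) := by
  simp only [minv_eq]
  exact iteratedFDeriv_comp_affine f _ (inv_ne_zero hp.ne') j z

lemma contDiffAt_comp_mobius_iff {p : EE n} (hp : 0 < p 0) {f : EE n → V} {k : WithTop ℕ∞}
    {z : EE n} : ContDiffAt ℝ k (fun y => f (mobius p y)) z ↔ ContDiffAt ℝ k f (mobius p z) := by
  constructor
  · intro h
    have h1 : f = fun y => (fun y => f (mobius p y)) (minv p y) := by
      ext1 y; simp only [mobius_minv hp]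
    rw [h1]
    refine ContDiffAt.comp (mobius p z) (g := fun y => f (mobius p y)) ?_
      (contDiff_minv p k).contDiffAt
    rwa [minv_mobius hp]
  · intro h
    exact h.comp z (contDiff_mobius p k).contDiffAt

lemma norm_iteratedFDeriv_comp_mobius {p : EE n} (hp : 0 < p 0) (f : EE n → V) (j : ℕ) (z : EE n) :
    ‖iteratedFDeriv ℝ j (fun y => f (mobius p y)) z‖ =
      p 0 ^ j * ‖iteratedFDeriv ℝ j f (mobius p z)‖ := by
  rw [iteratedFDeriv_comp_mobius hp, norm_smul, norm_pow, Real.norm_of_nonneg hp.le]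

lemma mobius_image_hypBall {p : EE n} (hp : 0 < p 0) {s : ℝ} :
    mobius p '' hypBall n s = minv p ⁻¹' hypBall n s := by
  ext w
  constructor
  · rintro ⟨z, hz, rfl⟩
    rwa [Set.mem_preimage, minv_mobius hp]
  · intro hw
    exact ⟨minv p w, hw, mobius_minv hp w⟩

lemma isOpen_mobius_image {p : EE n} (hp : 0 < p 0) : IsOpen (mobius p '' hypBall n 2) := by
  rw [mobius_image_hypBall hp]
  exact (isOpen_hypBall two_pos).preimage (contDiff_minv p 0).continuous

lemma convex_mobius_image (p : EE n) : Convex ℝ (mobius p '' hypBall n 2) := by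
  have h := ((convex_hypBall (n := n) two_pos).smul (p 0)).translate (p - p 0 • basePt n)
  rw [← Set.image_smul, Set.image_image] at h
  rw [mobius_eq]
  exact h

lemma mobius_basePt_self (p : EE n) : mobius p (basePt n) = p := by simp [mobius]

lemma norm_mobius_sub {p : EE n} (hp : 0 < p 0) (z w : EE n) :
    ‖mobius p z - mobius p w‖ = p 0 * ‖z - w‖ := by
  rw [mobius_eq, add_sub_add_left_eq_sub, ← smul_sub, norm_smul, Real.norm_of_nonneg hp.le]

end Mobius

end WAH

end

noncomputable section

namespace WAH

open Filter Topology Function IsManifold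

set_option linter.unusedSectionVars false

/-! ### Taylor polynomials at the centers and their comparison on overlaps -/

namespace MobiusCover

variable {n : ℕ} {Mb : Type*} [TopologicalSpace Mb] [ChartedSpace (EuclideanHalfSpace (n + 1)) Mb]
  {ρ : Mb → ℝ} (𝒜 : MobiusCover n Mb ρ) [IsManifold (𝓡∂ (n + 1)) ∞ Mb] {a b : ℕ}

/-- The components of a tensor field in the chart of a parametrization. -/
def cmp (τ : TensorField n Mb a b) (i : 𝒜.Ix) : EE n → Tensor n a b :=
  pullback (cpar (𝒜.ech i)) τ

/-- The components of `τ` are of class `C^m` with derivatives bounded by `N`. -/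
structure JetBound (m : ℕ) (N : ℝ) (τ : TensorField n Mb a b) : Prop where
  contDiffAt : ∀ i, ∀ z ∈ hypBall n 2, ContDiffAt ℝ m (𝒜.cmp τ i) (mobius (𝒜.ctr i) z)
  bound : ∀ i, ∀ z ∈ hypBall n 2, ∀ q ≤ m,
    ‖iteratedFDeriv ℝ q (𝒜.cmp τ i) (mobius (𝒜.ctr i) z)‖ ≤ N

/-- The Taylor polynomial of the components of `τ` at the center of a parametrization. -/
def tpoly (m : ℕ) (τ : TensorField n Mb a b) (i : 𝒜.Ix) : EE n → Tensor n a b :=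
  taylorPoly m (𝒜.cmp τ i) (𝒜.ctr i)

variable {𝒜}

lemma JetBound.nonneg {m : ℕ} {N : ℝ} {τ : TensorField n Mb a b} (h : 𝒜.JetBound m N τ) (i : 𝒜.Ix) :
    0 ≤ N :=
  (norm_nonneg _).trans (h.bound i _ (basePt_mem_hypBall two_pos) 0 (Nat.zero_le _))

lemma contDiff_tpoly (m : ℕ) (τ : TensorField n Mb a b) (i : 𝒜.Ix) (k : WithTop ℕ∞) :
    ContDiff ℝ k (𝒜.tpoly m τ i) := contDiff_taylorPoly _ _ _ _

/-- In the chart the image of the ball is convex and lies within `diamB * sc i` of the center, so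
Taylor's estimate applies with that radius. -/
lemma JetBound.sub_tpoly {m q : ℕ} {N : ℝ} {τ : TensorField n Mb a b} (h : 𝒜.JetBound m N τ)
    (i : 𝒜.Ix) {z : EE n} (hz : z ∈ hypBall n 2) (hq : q ≤ m) :
    ‖iteratedFDeriv ℝ q (fun y => 𝒜.cmp τ i y - 𝒜.tpoly m τ i y) (mobius (𝒜.ctr i) z)‖ ≤
      N * (diamB * 𝒜.sc i) ^ (m - q) := by
  have hp := 𝒜.sc_pos i
  have hB := isOpen_mobius_image (n := n) hp
  refine norm_iteratedFDeriv_sub_taylorPoly (B := mobius (𝒜.ctr i) '' hypBall n 2) hB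
    (convex_mobius_image _) ⟨basePt n, basePt_mem_hypBall two_pos, mobius_basePt_self _⟩ ?_ ?_ ?_ hq
    _ ⟨z, hz, rfl⟩
  · rintro _ ⟨y, hy, rfl⟩
    exact (h.contDiffAt i y hy).contDiffWithinAt
  · rintro _ ⟨y, hy, rfl⟩
    have h1 := norm_mobius_sub hp y (basePt n)
    rw [mobius_basePt_self] at h1
    rw [h1, mul_comm]
    exact mul_le_mul_of_nonneg_right (norm_sub_le_diamB hy (basePt_mem_hypBall two_pos)) hp.le
  · rintro _ ⟨y, hy, rfl⟩
    exact h.bound i y hy m le_rfl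

lemma JetBound.sJet_sub_tpoly {m : ℕ} {N ε c : ℝ} {τ : TensorField n Mb a b}
    (h : 𝒜.JetBound m N τ) (i : 𝒜.Ix) {z : EE n} (hz : z ∈ hypBall n 2) (hε : 0 < ε) (hc : 1 ≤ c)
    (hεc : diamB * 𝒜.sc i ≤ c * ε) :
    SJet ε m (c ^ m * N * ε ^ m) (fun y => 𝒜.cmp τ i y - 𝒜.tpoly m τ i y) (mobius (𝒜.ctr i) z) := by
  have hN := h.nonneg i
  refine ⟨(h.contDiffAt i z hz).sub (contDiff_tpoly m τ i m).contDiffAt, fun q hq => ?_⟩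
  have hp := 𝒜.sc_pos i
  have hd := diamB_pos
  calc _ ≤ ε ^ q * (N * (diamB * 𝒜.sc i) ^ (m - q)) :=
        mul_le_mul_of_nonneg_left (h.sub_tpoly i hz hq) (by positivity)
    _ ≤ ε ^ q * (N * (c * ε) ^ (m - q)) := by gcongr
    _ = c ^ (m - q) * N * (ε ^ q * ε ^ (m - q)) := by rw [mul_pow]; ring
    _ ≤ c ^ m * N * (ε ^ q * ε ^ (m - q)) := by
        have : c ^ (m - q) ≤ c ^ m := pow_le_pow_right₀ hc (Nat.sub_le _ _)
        gcongr
    _ = c ^ m * N * ε ^ m := by rw [← pow_add, Nat.add_sub_cancel' hq]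

variable (𝒜)

/-- Below order m the polynomial is the components minus the remainder, both bounded; from order m
on its derivatives vanish. Hence one constant serves all orders. -/
lemma exists_tpoly_bound [CompactSpace Mb] (hρ : IsDefiningFunction n ρ) (m : ℕ) :
    ∃ C : ℝ, 1 ≤ C ∧ ∀ (τ : TensorField n Mb a b) (N : ℝ), 𝒜.JetBound m N τ →
      ∀ i, ∀ z ∈ hypBall n 2, ∀ q,
        ‖iteratedFDeriv ℝ q (𝒜.tpoly m τ i) (mobius (𝒜.ctr i) z)‖ ≤ C * N := by
  obtain ⟨E, hE1, hE⟩ := 𝒜.exists_sc_le hρ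
  have hd := diamB_pos
  refine ⟨1 + (1 + diamB * E) ^ m, le_add_of_nonneg_right (by positivity),
    fun τ N h i z hz q => ?_⟩
  have hN := h.nonneg i
  rcases lt_or_ge q m with hq | hq
  · have h1 : iteratedFDeriv ℝ q (𝒜.tpoly m τ i) (mobius (𝒜.ctr i) z) =
        iteratedFDeriv ℝ q (𝒜.cmp τ i) (mobius (𝒜.ctr i) z) -
        iteratedFDeriv ℝ q (fun y => 𝒜.cmp τ i y - 𝒜.tpoly m τ i y) (mobius (𝒜.ctr i) z) := by
      rw [iteratedFDeriv_sub_at ((h.contDiffAt i z hz).of_le (by exact_mod_cast hq.le))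
        (contDiff_tpoly m τ i _).contDiffAt, sub_sub_cancel]
    rw [h1]
    have hp := 𝒜.sc_pos i
    calc _ ≤ N + N * (diamB * 𝒜.sc i) ^ (m - q) :=
          (norm_sub_le _ _).trans (add_le_add (h.bound i z hz q hq.le) (h.sub_tpoly i hz hq.le))
      _ ≤ N + N * (1 + diamB * E) ^ (m - q) := by
          have h2 : diamB * 𝒜.sc i ≤ 1 + diamB * E := by
            have := mul_le_mul_of_nonneg_left (hE i) hd.le
            linarith
          gcongr
      _ ≤ N + N * (1 + diamB * E) ^ m := by
          have h2 : (1 : ℝ) ≤ 1 + diamB * E := le_add_of_nonneg_right (by positivity)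
          have : (1 + diamB * E) ^ (m - q) ≤ (1 + diamB * E) ^ m :=
            pow_le_pow_right₀ h2 (Nat.sub_le _ _)
          gcongr
      _ = _ := by ring
  · rw [tpoly, iteratedFDeriv_taylorPoly_of_le _ _ _ hq, norm_zero]
    positivity

lemma exists_of_mem_around {i₀ i : 𝒜.Ix} {z : EE n} (hz : z ∈ hypBall n 2)
    (hi : i ∈ 𝒜.around (𝒜.param i₀ z)) : ∃ w ∈ hypBall n 2, 𝒜.param i w = 𝒜.param i₀ z ∧
      ctrans (𝒜.ech i₀) (𝒜.ech i) (mobius (𝒜.ctr i₀) z) = mobius (𝒜.ctr i) w ∧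
      mobius (𝒜.ctr i₀) z ∈ cset (𝒜.ech i₀) (𝒜.bK (𝒜.ci i₀) ∩ 𝒜.bK (𝒜.ci i)) := by
  obtain ⟨w, hw, h⟩ := hi
  refine ⟨w, hw, h, ?_, ?_⟩
  · rw [ctrans, ← 𝒜.param_eq i₀ z, ← h, 𝒜.param_eq i w, ccoord_cpar (𝒜.mobius_mem_cdom i hw)]
  · refine ⟨𝒜.mobius_mem_cdom i₀ hz, (𝒜.mobius_mem_dset i₀ hz).2, ?_⟩
    rw [← 𝒜.param_eq i₀ z, ← h, 𝒜.param_eq i w]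
    exact (𝒜.mobius_mem_dset i hw).2

lemma exists_ctrans_bound [T2Space Mb] (k : ℕ) : ∃ C : ℝ, 1 ≤ C ∧ ∀ c c' : 𝒜.Cx,
    ∀ z ∈ cset (𝒜.bchart c) (𝒜.bK c ∩ 𝒜.bK c'),
      ContDiffAt ℝ k (ctrans (𝒜.bchart c) (𝒜.bchart c')) z ∧
      ∀ j ≤ k, ‖iteratedFDeriv ℝ j (ctrans (𝒜.bchart c) (𝒜.bchart c')) z‖ ≤ C := by
  have h : ∀ p : 𝒜.Cx × 𝒜.Cx, BddJets (ctrans (𝒜.bchart p.1) (𝒜.bchart p.2))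
      (cset (𝒜.bchart p.1) (𝒜.bK p.1 ∩ 𝒜.bK p.2)) := fun p =>
    bddJets_ctrans (𝒜.bchart_mem _) (𝒜.bchart_mem _) ((𝒜.bK_compact _).inter (𝒜.bK_compact _))
      (Set.inter_subset_left.trans (𝒜.bK_subset _)) (Set.inter_subset_right.trans (𝒜.bK_subset _))
  obtain ⟨C, hC, h1⟩ := exists_uniform_bound h k
  exact ⟨C, hC, fun c c' z hz => ⟨(h (c, c')).contDiffAt_nat hz k, h1 (c, c') z hz⟩⟩

lemma exists_ctens_bound [T2Space Mb] (a b k : ℕ) : ∃ C : ℝ, 1 ≤ C ∧ ∀ c c' : 𝒜.Cx,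
    ∀ z ∈ cset (𝒜.bchart c) (𝒜.bK c ∩ 𝒜.bK c'),
      ContDiffAt ℝ k (ctens a b (𝒜.bchart c) (𝒜.bchart c')) z ∧
      ∀ j ≤ k, ‖iteratedFDeriv ℝ j (ctens a b (𝒜.bchart c) (𝒜.bchart c')) z‖ ≤ C := by
  have h : ∀ p : 𝒜.Cx × 𝒜.Cx, BddJets (ctens a b (𝒜.bchart p.1) (𝒜.bchart p.2))
      (cset (𝒜.bchart p.1) (𝒜.bK p.1 ∩ 𝒜.bK p.2)) := fun p =>
    bddJets_ctens (𝒜.bchart_mem _) (𝒜.bchart_mem _) ((𝒜.bK_compact _).inter (𝒜.bK_compact _))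
      (Set.inter_subset_left.trans (𝒜.bK_subset _)) (Set.inter_subset_right.trans (𝒜.bK_subset _))
  obtain ⟨C, hC, h1⟩ := exists_uniform_bound h k
  exact ⟨C, hC, fun c c' z hz => ⟨(h (c, c')).contDiffAt_nat hz k, h1 (c, c') z hz⟩⟩

/-- The components, in the chart of `i₀`, of the tensor field with the components `tpoly m τ i` in
the chart of `i`. -/
def tpolyIn (m : ℕ) (τ : TensorField n Mb a b) (i₀ i : 𝒜.Ix) (y : EE n) : Tensor n a b :=
  ctens a b (𝒜.ech i₀) (𝒜.ech i) y (𝒜.tpoly m τ i (ctrans (𝒜.ech i₀) (𝒜.ech i) y))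

/-- The key estimate. Up to order m both polynomials are compared with τ and the remainders are used
at scale `sc i₀`. Above order m the chart derivatives of both are bounded by a multiple of N, and
the factor `sc i₀` ^ q from the scale is at most a multiple of `sc i₀` ^ m. So k is arbitrary
although τ has only m controlled derivatives. -/
lemma exists_tpolyIn_sub_bound [T2Space Mb] [CompactSpace Mb] (hρ : IsDefiningFunction n ρ)
    (a b m k : ℕ) : ∃ C : ℝ, 1 ≤ C ∧ ∀ (τ : TensorField n Mb a b) (N : ℝ), 𝒜.JetBound m N τ →
      ∀ i₀ i, ∀ z ∈ hypBall n 2, i ∈ 𝒜.around (𝒜.param i₀ z) →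
        SJet (𝒜.sc i₀) k (C * N * 𝒜.sc i₀ ^ m)
          (fun y => 𝒜.tpolyIn m τ i₀ i y - 𝒜.tpoly m τ i₀ y) (mobius (𝒜.ctr i₀) z) := by
  obtain ⟨E, hE1, hE⟩ := 𝒜.exists_sc_le hρ
  obtain ⟨C₀, hC₀, hsc⟩ := 𝒜.exists_sc_compare hρ
  obtain ⟨C₁, hC₁, hP⟩ := 𝒜.exists_tpoly_bound (a := a) (b := b) hρ m
  obtain ⟨C₂, hC₂, hT⟩ := 𝒜.exists_ctrans_bound (max k m)
  obtain ⟨C₃, hC₃, hQ⟩ := 𝒜.exists_ctens_bound a b (max k m)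
  have hd := diamB_pos
  -- Chosen so that `c * ε` dominates the diameters of both balls, whose scales are comparable
  -- because their images meet.
  set c : ℝ := 1 + diamB * C₀ with hc
  have hc1 : 1 ≤ c := le_add_of_nonneg_right (by positivity)
  set D₁ : ℝ := 2 ^ m * (E ^ m * C₃) * (m.factorial * c ^ m * (E * C₂) ^ m) + c ^ m
  set D₂ : ℝ := E ^ k * (2 ^ k * (1 ^ k * C₃) * (k.factorial * C₁ * (1 * C₂) ^ k) + C₁)
  have hD₁ : 0 ≤ D₁ := by positivity
  have hD₂ : 0 ≤ D₂ := by positivity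
  refine ⟨1 + D₁ + D₂, by linarith, fun τ N h i₀ i z hz hi => ?_⟩
  obtain ⟨w, hw, hwz, hTz, hzK⟩ := 𝒜.exists_of_mem_around hz hi
  have hN := h.nonneg i
  set ε := 𝒜.sc i₀ with hε
  have hεp : 0 < ε := 𝒜.sc_pos i₀
  have hεE : ε ≤ E := hE i₀
  set z₁ := mobius (𝒜.ctr i₀) z with hz₁
  obtain ⟨hTc, hTb⟩ := hT _ _ _ hzK
  obtain ⟨hQc, hQb⟩ := hQ _ _ _ hzK
  have hkm : (k : WithTop ℕ∞) ≤ (max k m : ℕ) := by exact_mod_cast le_max_left k m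
  have hmm : (m : WithTop ℕ∞) ≤ (max k m : ℕ) := by exact_mod_cast le_max_right k m
  -- the remainder
  have hm : SJet ε m (D₁ * N * ε ^ m)
      (fun y => 𝒜.tpolyIn m τ i₀ i y - 𝒜.tpoly m τ i₀ y) z₁ := by
    have hci : diamB * 𝒜.sc i ≤ c * ε := by
      have h1 := mul_le_mul_of_nonneg_left (hsc i i₀ w hw z hz hwz) hd.le
      rw [hc]
      nlinarith
    have hci₀ : diamB * 𝒜.sc i₀ ≤ c * ε := by
      rw [hc]
      have : diamB * 1 ≤ diamB * C₀ := mul_le_mul_of_nonneg_left hC₀ hd.le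
      nlinarith
    have s1 := h.sJet_sub_tpoly i hw hεp hc1 hci
    rw [← hTz] at s1
    have s2 := s1.comp hεp hE1 hεE hC₂ (hTc.of_le hmm) fun j hj => hTb j (hj.trans (le_max_right _ _))
    have s3 := (SJet.of_bound hεp hE1 hεE (hQc.of_le hmm)
      fun j hj => hQb j (hj.trans (le_max_right _ _))).apply hεp s2
    have s4 := (h.sJet_sub_tpoly i₀ hz hεp hc1 hci₀).sub hεp s3
    refine (s4.congr ?_).mono (le_of_eq ?_)
    · filter_upwards [eventually_mem_cdom_source hzK.1 (𝒜.bK_subset _ hzK.2.2)] with y hy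
      have h5 : 𝒜.cmp τ i₀ y = ctens a b (𝒜.ech i₀) (𝒜.ech i) y
          (𝒜.cmp τ i (ctrans (𝒜.ech i₀) (𝒜.ech i) y)) :=
        pullback_cpar (𝒜.bchart_mem _) (𝒜.bchart_mem _) hy.1 hy.2 τ
      simp only [map_sub]
      rw [tpolyIn, ← h5]
      abel
    · ring
  -- For the orders above m, plain bounds at scale one.
  have hk : SJet 1 k ((2 ^ k * (1 ^ k * C₃) * (k.factorial * C₁ * (1 * C₂) ^ k) + C₁) * N)
      (fun y => 𝒜.tpolyIn m τ i₀ i y - 𝒜.tpoly m τ i₀ y) z₁ := by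
    have s1 : SJet 1 k (C₁ * N) (𝒜.tpoly m τ i) (ctrans (𝒜.ech i₀) (𝒜.ech i) z₁) :=
      ⟨(contDiff_tpoly m τ i k).contDiffAt, fun j _ => by
        rw [one_pow, one_mul, hTz]; exact hP τ N h i w hw j⟩
    have s2 := s1.comp one_pos le_rfl le_rfl hC₂ (hTc.of_le hkm)
      fun j hj => hTb j (hj.trans (le_max_left _ _))
    have s3 := (SJet.of_bound one_pos le_rfl le_rfl (hQc.of_le hkm)
      fun j hj => hQb j (hj.trans (le_max_left _ _))).apply one_pos s2
    have s4 : SJet 1 k (C₁ * N) (𝒜.tpoly m τ i₀) z₁ :=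
      ⟨(contDiff_tpoly m τ i₀ k).contDiffAt, fun j _ => by
        rw [one_pow, one_mul]; exact hP τ N h i₀ z hz j⟩
    refine (s3.sub one_pos s4).mono (le_of_eq (by ring))
  refine ⟨hk.contDiffAt, fun q hq => ?_⟩
  have hεm : 0 ≤ N * ε ^ m := by positivity
  rcases le_or_gt q m with hqm | hqm
  · refine (hm.bound q hqm).trans ?_
    rw [mul_assoc, mul_assoc]
    exact mul_le_mul_of_nonneg_right (by linarith) hεm
  · have h1 := hk.bound q hq
    rw [one_pow, one_mul] at h1
    -- The q - m surplus powers of ε are absorbed by the upper bound E for the scales.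
    have h2 : ε ^ q ≤ E ^ k * ε ^ m := by
      obtain ⟨t, rfl⟩ := Nat.exists_eq_add_of_le hqm.le
      rw [pow_add, mul_comm]
      refine mul_le_mul_of_nonneg_right ?_ (by positivity)
      exact (pow_le_pow_left₀ hεp.le hεE t).trans (pow_le_pow_right₀ hE1 (by omega))
    calc _ ≤ (E ^ k * ε ^ m) * ((2 ^ k * (1 ^ k * C₃) *
          (k.factorial * C₁ * (1 * C₂) ^ k) + C₁) * N) :=
          mul_le_mul h2 h1 (norm_nonneg _) (by positivity)
      _ = D₂ * (N * ε ^ m) := by simp only [D₂]; ring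
      _ ≤ (1 + D₁ + D₂) * (N * ε ^ m) := mul_le_mul_of_nonneg_right (by linarith) hεm
      _ = _ := by ring

end MobiusCover

end WAH

end

noncomputable section

namespace WAH

open Filter Topology Function IsManifold

set_option linter.unusedSectionVars false

/-! ### The partition of unity and the regularization -/

namespace MobiusCover

variable {n : ℕ} {Mb : Type*} [TopologicalSpace Mb] [ChartedSpace (EuclideanHalfSpace (n + 1)) Mb]
  {ρ : Mb → ℝ} (𝒜 : MobiusCover n Mb ρ) [IsManifold (𝓡∂ (n + 1)) ∞ Mb] {a b : ℕ}

open Classical in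
/-- The bump function of a parametrization. -/
def bump (i : 𝒜.Ix) (p : Mb) : ℝ :=
  if p ∈ (𝒜.ech i).source then bumpB n (minv (𝒜.ctr i) (ccoord (𝒜.ech i) p)) else 0

lemma bump_nonneg (i : 𝒜.Ix) (p : Mb) : 0 ≤ 𝒜.bump i p := by
  rw [bump]
  split_ifs
  · exact bumpB_nonneg _
  · exact le_rfl

lemma exists_of_bump_ne_zero {i : 𝒜.Ix} {p : Mb} (h : 𝒜.bump i p ≠ 0) :
    ∃ w ∈ hypClosedBall n (3 / 2), 𝒜.param i w = p := by
  rw [bump] at h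
  split_ifs at h with hp
  · refine ⟨_, mem_of_bumpB_ne_zero h, ?_⟩
    rw [param_eq, mobius_minv (𝒜.sc_pos i), cpar_ccoord hp]
  · exact absurd rfl h

lemma bump_param (i : 𝒜.Ix) {w : EE n} (hw : w ∈ hypBall n 2) :
    𝒜.bump i (𝒜.param i w) = bumpB n w := by
  have h := 𝒜.mobius_mem_cdom i hw
  rw [bump, param_eq, if_pos (cpar_mem_source h), ccoord_cpar h, minv_mobius (𝒜.sc_pos i)]

lemma hypClosedBall_subset : hypClosedBall n (3 / 2) ⊆ hypBall n 2 :=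
  hypClosedBall_subset_hypBall (by norm_num)

lemma support_bump_subset (p : Mb) : (Function.support fun i => 𝒜.bump i p) ⊆ 𝒜.around p :=
  fun _ hi => by
    obtain ⟨w, hw, h⟩ := 𝒜.exists_of_bump_ne_zero hi
    exact ⟨w, hypClosedBall_subset hw, h⟩

lemma finite_support_bump (p : Mb) : (Function.support fun i => 𝒜.bump i p).Finite := by
  by_cases hp : p ∈ (𝓡∂ (n + 1)).interior Mb
  · exact (𝒜.finite_around hp).subset (𝒜.support_bump_subset p)
  · convert Set.finite_empty
    rw [Set.eq_empty_iff_forall_notMem]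
    intro i hi
    obtain ⟨w, hw, h⟩ := 𝒜.exists_of_bump_ne_zero hi
    exact hp (h ▸ 𝒜.param_mem_interior i (hypClosedBall_subset hw))

/-- Near a point, only the bump functions of the parametrizations around it are nonzero. -/
lemma eventually_bump_ne_zero_imp [T2Space Mb] (hρ : IsDefiningFunction n ρ) {p₁ : Mb}
    (hp₁ : p₁ ∈ (𝓡∂ (n + 1)).interior Mb) :
    ∀ᶠ p in 𝓝 p₁, ∀ i, 𝒜.bump i p ≠ 0 → i ∈ 𝒜.around p₁ := by
  -- The hypothesis of local finiteness speaks of single points. The gap between the support of the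
  -- bump function, in the ball of radius 3/2, and the ball of radius 2 turns it into a statement
  -- about neighborhoods.
  obtain ⟨r, hr, hrB⟩ := (isCompact_hypClosedBall (n := n)
    (show (0 : ℝ) < 3 / 2 by norm_num)).exists_thickening_subset_open
    (isOpen_hypBall two_pos) hypClosedBall_subset
  obtain ⟨C, hC, hcomp⟩ := 𝒜.exists_rho_compare hρ
  have hρ1 : 0 < ρ p₁ := rho_pos hρ hp₁
  have key : ∀ c : 𝒜.Cx, ∀ᶠ p in 𝓝 p₁, ∀ i, 𝒜.ci i = c → 𝒜.bump i p ≠ 0 → i ∈ 𝒜.around p₁ := by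
    intro c
    by_cases hc : p₁ ∈ 𝒜.bK c
    · have hs := 𝒜.bK_subset c hc
      have h1 : ∀ᶠ p in 𝓝 p₁, ‖ccoord (𝒜.bchart c) p₁ - ccoord (𝒜.bchart c) p‖ <
          r * (ρ p₁ / (2 * C)) := by
        have h2 : ContinuousAt (fun p => ‖ccoord (𝒜.bchart c) p₁ - ccoord (𝒜.bchart c) p‖) p₁ :=
          (continuousAt_const.sub (continuousAt_ccoord hs)).norm
        refine h2.eventually_lt continuousAt_const ?_
        rw [sub_self, norm_zero]
        positivity
      have h3 : ∀ᶠ p in 𝓝 p₁, ρ p₁ / 2 < ρ p :=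
        continuousAt_const.eventually_lt hρ.smooth.continuous.continuousAt (by linarith)
      filter_upwards [h1, h3] with p hp1 hp2 i hic hi
      subst hic
      obtain ⟨w, hw, rfl⟩ := 𝒜.exists_of_bump_ne_zero hi
      have hw2 := hypClosedBall_subset hw
      have hsc := 𝒜.sc_pos i
      -- Every ball reaching near the interior point has scale bounded below, so chart-closeness of
      -- p and p₁ becomes closeness in the coordinates of all these balls at once.
      have h4 : ρ p₁ / (2 * C) ≤ 𝒜.sc i := by
        rw [div_le_iff₀ (by positivity)]
        have := (hcomp i w hw2).1
        linarith
      rw [𝒜.param_eq i w, ccoord_cpar (𝒜.mobius_mem_cdom i hw2)] at hp1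
      have h5 := mobius_minv (𝒜.sc_pos i) (ccoord (𝒜.ech i) p₁)
      refine ⟨minv (𝒜.ctr i) (ccoord (𝒜.ech i) p₁), hrB ?_, ?_⟩
      · rw [Metric.mem_thickening_iff]
        refine ⟨w, hw, ?_⟩
        rw [dist_eq_norm]
        have h6 := norm_mobius_sub hsc (minv (𝒜.ctr i) (ccoord (𝒜.ech i) p₁)) w
        rw [h5] at h6
        have h7 : 𝒜.sc i * ‖minv (𝒜.ctr i) (ccoord (𝒜.ech i) p₁) - w‖ < 𝒜.sc i * r := by
          rw [← h6, mul_comm _ r]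
          exact hp1.trans_le (mul_le_mul_of_nonneg_left h4 hr.le)
        exact lt_of_mul_lt_mul_left h7 hsc.le
      · rw [param_eq, h5, cpar_ccoord hs]
    -- If p₁ is outside the compact set of a chart, nearby points meet no ball of that chart.
    · filter_upwards [(𝒜.bK_compact c).isClosed.isOpen_compl.mem_nhds hc] with p hp i hic hi
      subst hic
      obtain ⟨w, hw, rfl⟩ := 𝒜.exists_of_bump_ne_zero hi
      refine absurd ?_ hp
      rw [param_eq]
      exact (𝒜.mobius_mem_dset i (hypClosedBall_subset hw)).2
  filter_upwards [eventually_all.2 key] with p hp i hi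
  exact hp _ i rfl hi

/-- The sum of the bump functions. -/
def bumpSum (p : Mb) : ℝ := ∑ᶠ i, 𝒜.bump i p

/-- The tensor field with the components `tpoly m τ i` in the chart of `i`. -/
def tfield (m : ℕ) (τ : TensorField n Mb a b) (i : 𝒜.Ix) : TensorField n Mb a b := fun p =>
  (𝒜.tpoly m τ i (ccoord (𝒜.ech i) p)).pull (dParam (cpar (𝒜.ech i)) (ccoord (𝒜.ech i) p)).inverse
    (dParam (cpar (𝒜.ech i)) (ccoord (𝒜.ech i) p))

/-- The regularization of a tensor field. -/
def whit (m : ℕ) (τ : TensorField n Mb a b) : TensorField n Mb a b := fun p =>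
  ∑ᶠ i, (𝒜.bump i p / 𝒜.bumpSum p) • 𝒜.tfield m τ i p

lemma pullback_tfield (m : ℕ) (τ : TensorField n Mb a b) (i : 𝒜.Ix) {w : EE n}
    (hw : w ∈ cdom (𝒜.ech i)) : pullback (cpar (𝒜.ech i)) (𝒜.tfield m τ i) w = 𝒜.tpoly m τ i w := by
  have hi := isInvertible_dParam (𝒜.bchart_mem _) hw
  rw [pullback, tfield, ccoord_cpar hw, Tensor.pull_pull, hi.inverse_comp_self, Tensor.pull_id]

lemma pullback_tfield_in (m : ℕ) (τ : TensorField n Mb a b) (i₀ i : 𝒜.Ix) {y : EE n}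
    (hy : y ∈ cdom (𝒜.ech i₀)) (hy' : cpar (𝒜.ech i₀) y ∈ (𝒜.ech i).source) :
    pullback (cpar (𝒜.ech i₀)) (𝒜.tfield m τ i) y = 𝒜.tpolyIn m τ i₀ i y := by
  rw [pullback_cpar (𝒜.bchart_mem _) (𝒜.bchart_mem _) hy hy', pbk_ctrans, pullback_tfield, tpolyIn]
  exact ctrans_mem_cdom (𝒜.bchart_mem _) (𝒜.bchart_mem _) hy hy'

lemma around_source {i₀ i : 𝒜.Ix} {z : EE n} (hz : z ∈ hypBall n 2)
    (hi : i ∈ 𝒜.around (𝒜.param i₀ z)) :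
    cpar (𝒜.ech i₀) (mobius (𝒜.ctr i₀) z) ∈ (𝒜.ech i).source := by
  obtain ⟨w, hw, hwz, hTz, hzK⟩ := 𝒜.exists_of_mem_around hz hi
  exact 𝒜.bK_subset _ hzK.2.2

lemma eventually_bump [T2Space Mb] (hρ : IsDefiningFunction n ρ) (i₀ : 𝒜.Ix) {z : EE n}
    (hz : z ∈ hypBall n 2) {J : Finset 𝒜.Ix} (hJ : ∀ i, i ∈ J ↔ i ∈ 𝒜.around (𝒜.param i₀ z)) :
    ∀ᶠ y in 𝓝 (mobius (𝒜.ctr i₀) z), y ∈ cdom (𝒜.ech i₀) ∧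
      (∀ i ∈ J, cpar (𝒜.ech i₀) y ∈ (𝒜.ech i).source) ∧
      (Function.support fun i => 𝒜.bump i (cpar (𝒜.ech i₀) y)) ⊆ J := by
  have h0 := 𝒜.mobius_mem_cdom i₀ hz
  have h1 := 𝒜.eventually_bump_ne_zero_imp hρ (𝒜.param_mem_interior i₀ hz)
  rw [𝒜.param_eq i₀ z] at h1
  have h2 : ∀ᶠ y in 𝓝 (mobius (𝒜.ctr i₀) z), ∀ i ∈ J, cpar (𝒜.ech i₀) y ∈ (𝒜.ech i).source :=
    (eventually_all_finset J).2 fun i hi =>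
      eventually_cpar_mem_source h0 (𝒜.around_source hz ((hJ i).1 hi))
  filter_upwards [cdom_mem_nhds h0, h2, (continuousAt_cpar h0).eventually h1] with y hy1 hy2 hy3
  refine ⟨hy1, hy2, fun i hi => ?_⟩
  rw [Finset.mem_coe, hJ, 𝒜.param_eq i₀ z]
  exact hy3 i hi

lemma bumpSum_eq_sum {J : Finset 𝒜.Ix} {p : Mb} (h : (Function.support fun i => 𝒜.bump i p) ⊆ J) :
    𝒜.bumpSum p = ∑ i ∈ J, 𝒜.bump i p := finsum_eq_sum_of_support_subset _ h

lemma one_le_bumpSum {p : Mb} (hp : p ∈ (𝓡∂ (n + 1)).interior Mb) : 1 ≤ 𝒜.bumpSum p := by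
  obtain ⟨i, z, hz, rfl⟩ := 𝒜.exists_param hp
  have hz2 : z ∈ hypBall n 2 := hypClosedBall_subset_hypBall (by norm_num)
    (hypBall_subset_hypClosedBall hz)
  rw [← bumpB_eq_one hz, ← 𝒜.bump_param i hz2]
  exact single_le_finsum i (𝒜.finite_support_bump _) fun j => 𝒜.bump_nonneg j _

/-- At its own scale each bump function is a copy of one fixed function. Overlapping balls have
comparable scales, and the coordinate change to the chart of i₀ has bounded derivatives. -/
lemma exists_bump_bound [T2Space Mb] [CompactSpace Mb] (hρ : IsDefiningFunction n ρ) (k : ℕ) :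
    ∃ C : ℝ, 1 ≤ C ∧ ∀ i₀ i, ∀ z ∈ hypBall n 2, i ∈ 𝒜.around (𝒜.param i₀ z) →
      SJet (𝒜.sc i₀) k C (fun y => 𝒜.bump i (cpar (𝒜.ech i₀) y)) (mobius (𝒜.ctr i₀) z) := by
  obtain ⟨E, hE1, hE⟩ := 𝒜.exists_sc_le hρ
  obtain ⟨C₀, hC₀, hsc⟩ := 𝒜.exists_sc_compare hρ
  obtain ⟨C₂, hC₂, hT⟩ := 𝒜.exists_ctrans_bound k
  obtain ⟨D, hD, hb⟩ := (bddJets_bumpB (n := n)).bound k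
  refine ⟨1 + k.factorial * (C₀ ^ k * D) * (E * C₂) ^ k,
    le_add_of_nonneg_right (by positivity), fun i₀ i z hz hi => ?_⟩
  obtain ⟨w, hw, hwz, hTz, hzK⟩ := 𝒜.exists_of_mem_around hz hi
  obtain ⟨hTc, hTb⟩ := hT _ _ _ hzK
  have hp := 𝒜.sc_pos i
  have hp₀ := 𝒜.sc_pos i₀
  have s1 : SJet (𝒜.sc i) k D (fun y => bumpB n (minv (𝒜.ctr i) y)) (mobius (𝒜.ctr i) w) := by
    refine ⟨(contDiff_bumpB.of_le (natCast_le_infty k)).contDiffAt.comp _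
      (contDiff_minv _ k).contDiffAt, fun j hj => ?_⟩
    rw [iteratedFDeriv_comp_minv hp, minv_mobius hp, norm_smul, norm_pow, norm_inv,
      Real.norm_of_nonneg hp.le, ← mul_assoc, ← mul_pow, mul_inv_cancel₀ hp.ne', one_pow, one_mul]
    exact hb w hw j hj
  have s2 := s1.scale hp hp₀ hC₀ (hsc i₀ i z hz w hw hwz.symm)
  rw [← hTz] at s2
  have s3 := s2.comp hp₀ hE1 (hE i₀) hC₂ hTc hTb
  refine (s3.congr ?_).mono (le_add_of_nonneg_left zero_le_one)
  filter_upwards [eventually_cpar_mem_source hzK.1 (𝒜.around_source hz hi)] with y hy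
  rw [bump, if_pos hy]
  rfl

lemma bddJets_inv (M : ℝ) : BddJets (fun x : ℝ => x⁻¹) (Set.Icc 1 M) :=
  ContDiffOn.bddJets (s := Set.Ioi 0)
    (fun _ hx => (contDiffAt_inv ℝ (ne_of_gt hx)).contDiffWithinAt)
    isOpen_Ioi.uniqueDiffOn isCompact_Icc (fun _ hx => lt_of_lt_of_le one_pos hx.1) le_rfl
    (fun _ hx => isOpen_Ioi.mem_nhds (lt_of_lt_of_le one_pos hx.1))

/-- The regularization differs from the Taylor polynomials by small terms. -/
lemma exists_whit_sub_bound [T2Space Mb] [CompactSpace Mb] (hρ : IsDefiningFunction n ρ)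
    (a b m k : ℕ) : ∃ C : ℝ, 1 ≤ C ∧ ∀ (τ : TensorField n Mb a b) (N : ℝ), 𝒜.JetBound m N τ →
      ∀ i₀, ∀ z ∈ hypBall n 2, SJet (𝒜.sc i₀) k (C * N * 𝒜.sc i₀ ^ m)
        (fun y => 𝒜.cmp (𝒜.whit m τ) i₀ y - 𝒜.tpoly m τ i₀ y) (mobius (𝒜.ctr i₀) z) := by
  obtain ⟨C₁, hC₁, hd⟩ := 𝒜.exists_tpolyIn_sub_bound hρ a b m k
  obtain ⟨C₂, hC₂, hb⟩ := 𝒜.exists_bump_bound hρ k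
  obtain ⟨L, hL⟩ := 𝒜.exists_encard_around_le
  -- The sum of the bump functions lies in this interval: at least 1 because the balls of radius 1
  -- cover, at most L terms bounded by C₂.
  obtain ⟨C₃, hC₃, hinv⟩ := (bddJets_inv (1 + L * C₂)).bound k
  set D : ℝ := k.factorial * C₃ * (1 + L * C₂) ^ k
  have hD : 0 ≤ D := by positivity
  refine ⟨1 + L * (2 ^ k * (2 ^ k * C₂ * D) * C₁), le_add_of_nonneg_right (by positivity),
    fun τ N h i₀ z hz => ?_⟩
  have hN := h.nonneg i₀
  have hp := 𝒜.sc_pos i₀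
  have hint := 𝒜.param_mem_interior i₀ hz
  set J := (𝒜.finite_around hint).toFinset with hJdef
  have hJ : ∀ i, i ∈ J ↔ i ∈ 𝒜.around (𝒜.param i₀ z) := fun i => by simp [hJdef]
  have hcard : (J.card : ℝ) ≤ L := by
    have h1 := hL _ hint
    rw [(𝒜.finite_around hint).encard_eq_coe_toFinset_card] at h1
    exact_mod_cast h1
  have hev := 𝒜.eventually_bump hρ i₀ hz hJ
  have hsum : ∀ᶠ y in 𝓝 (mobius (𝒜.ctr i₀) z), 𝒜.bumpSum (cpar (𝒜.ech i₀) y) =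
      ∑ i ∈ J, 𝒜.bump i (cpar (𝒜.ech i₀) y) := by
    filter_upwards [hev] with y hy
    exact 𝒜.bumpSum_eq_sum hy.2.2
  have s1 : SJet (𝒜.sc i₀) k (1 + L * C₂) (fun y => 𝒜.bumpSum (cpar (𝒜.ech i₀) y))
      (mobius (𝒜.ctr i₀) z) := by
    refine ((SJet.sum J hp fun i hi => hb i₀ i z hz ((hJ i).1 hi)).congr hsum).mono ?_
    have : (J.card : ℝ) * C₂ ≤ L * C₂ := mul_le_mul_of_nonneg_right hcard (by linarith)
    linarith
  have hmem : 𝒜.bumpSum (cpar (𝒜.ech i₀) (mobius (𝒜.ctr i₀) z)) ∈ Set.Icc 1 (1 + L * C₂) := by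
    refine ⟨?_, ?_⟩
    · rw [← 𝒜.param_eq i₀ z]
      exact 𝒜.one_le_bumpSum hint
    · have := s1.bound 0 (Nat.zero_le _)
      rw [pow_zero, one_mul, norm_iteratedFDeriv_zero] at this
      exact (le_abs_self _).trans this
  have s2 : SJet (𝒜.sc i₀) k D (fun y => (𝒜.bumpSum (cpar (𝒜.ech i₀) y))⁻¹)
      (mobius (𝒜.ctr i₀) z) :=
    s1.outer (g := fun x : ℝ => x⁻¹) hp (le_add_of_nonneg_right (by positivity))
      ((bddJets_inv _).contDiffAt_nat hmem k) (hinv _ hmem)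
  -- The finite set J works in a whole neighborhood of the point, so the sum may be differentiated
  -- termwise.
  have s3 := SJet.sum J hp fun i hi =>
    ((hb i₀ i z hz ((hJ i).1 hi)).smul hp s2).smul hp (hd τ N h i₀ i z hz ((hJ i).1 hi))
  refine (s3.congr ?_).mono ?_
  · filter_upwards [hev, hsum] with y hy hys
    have hy0 : 𝒜.bumpSum (cpar (𝒜.ech i₀) y) ≠ 0 := by
      have := 𝒜.one_le_bumpSum (isInteriorPoint_cpar (𝒜.bchart_mem _) hy.1)
      linarith
    have h1 : 𝒜.cmp (𝒜.whit m τ) i₀ y = ∑ i ∈ J, (𝒜.bump i (cpar (𝒜.ech i₀) y) *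
        (𝒜.bumpSum (cpar (𝒜.ech i₀) y))⁻¹) • 𝒜.tpolyIn m τ i₀ i y := by
      rw [cmp, pullback, whit, finsum_eq_sum_of_support_subset (s := J), ← Tensor.pullL_apply,
        map_sum]
      · refine Finset.sum_congr rfl fun i hi => ?_
        rw [map_smul, Tensor.pullL_apply, ← 𝒜.pullback_tfield_in m τ i₀ i hy.1 (hy.2.1 i hi),
          div_eq_mul_inv]
        rfl
      · refine subset_trans (fun i hi => ?_) hy.2.2
        intro h0
        refine hi ?_
        change 𝒜.bump i (cpar (𝒜.ech i₀) y) = 0 at h0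
        simp only [h0, zero_div, zero_smul]
    -- The partition functions sum to one, so the common polynomial of i₀ can be subtracted inside
    -- the sum.
    simp only [smul_eq_mul, smul_sub, Finset.sum_sub_distrib]
    rw [h1, ← Finset.sum_smul, ← Finset.sum_mul, ← hys, mul_inv_cancel₀ hy0, one_smul]
  · have hεm : 0 ≤ N * 𝒜.sc i₀ ^ m := by positivity
    calc _ = (J.card : ℝ) * (2 ^ k * (2 ^ k * C₂ * D) * C₁) * (N * 𝒜.sc i₀ ^ m) := by ring
      _ ≤ (1 + L * (2 ^ k * (2 ^ k * C₂ * D) * C₁)) * (N * 𝒜.sc i₀ ^ m) := by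
          refine mul_le_mul_of_nonneg_right ?_ hεm
          have : (J.card : ℝ) * (2 ^ k * (2 ^ k * C₂ * D) * C₁) ≤
              L * (2 ^ k * (2 ^ k * C₂ * D) * C₁) :=
            mul_le_mul_of_nonneg_right hcard (by positivity)
          linarith
      _ = _ := by ring

/-- Bounds, with weights, for the components of a tensor field in the coordinates of the
parametrizations. -/
structure RepBound (s k : ℕ) (A : ℝ) (u : TensorField n Mb a b) : Prop where
  contDiffAt : ∀ i, ∀ z ∈ hypBall n 2, ContDiffAt ℝ k (𝒜.crep u i) z
  bound : ∀ i, ∀ z ∈ hypBall n 2, ∀ q ≤ k,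
    ‖iteratedFDeriv ℝ q (𝒜.crep u i) z‖ ≤ A * 𝒜.sc i ^ min q s

/-- Passing to ball coordinates multiplies a derivative of order q by `sc i` ^ q. The polynomial
contributes only for q < m, with exactly this factor, and the difference contributes `sc i` ^ m at
every order. -/
lemma exists_repBound_whit [T2Space Mb] [CompactSpace Mb] (hρ : IsDefiningFunction n ρ)
    (a b m k : ℕ) : ∃ C : ℝ, 1 ≤ C ∧ ∀ (τ : TensorField n Mb a b) (N : ℝ), 𝒜.JetBound m N τ →
      𝒜.RepBound m k (C * N) (𝒜.whit m τ) := by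
  obtain ⟨E, hE1, hE⟩ := 𝒜.exists_sc_le hρ
  obtain ⟨C₁, hC₁, h1⟩ := 𝒜.exists_whit_sub_bound hρ a b m k
  obtain ⟨C₂, hC₂, h2⟩ := 𝒜.exists_tpoly_bound (a := a) (b := b) hρ m
  refine ⟨C₁ * E ^ m + C₂, by nlinarith [one_le_pow₀ hE1 (n := m)], fun τ N h => ?_⟩
  have hcd : ∀ i, ∀ z ∈ hypBall n 2,
      ContDiffAt ℝ k (𝒜.cmp (𝒜.whit m τ) i) (mobius (𝒜.ctr i) z) := fun i z hz => by
    have h3 := (h1 τ N h i z hz).contDiffAt.add (contDiff_tpoly m τ i k).contDiffAt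
    simpa using h3
  refine ⟨fun i z hz => (contDiffAt_comp_mobius_iff (𝒜.sc_pos i)).2 (hcd i z hz),
    fun i z hz q hq => ?_⟩
  have hN := h.nonneg i
  have hp := 𝒜.sc_pos i
  have hqk : (q : WithTop ℕ∞) ≤ k := by exact_mod_cast hq
  have h3 := (h1 τ N h i z hz).bound q hq
  rw [iteratedFDeriv_sub_at ((hcd i z hz).of_le hqk) (contDiff_tpoly m τ i q).contDiffAt] at h3
  have h4 := norm_iteratedFDeriv_comp_mobius hp (𝒜.cmp (𝒜.whit m τ) i) q z
  change ‖iteratedFDeriv ℝ q (fun y => 𝒜.cmp (𝒜.whit m τ) i (mobius (𝒜.ctr i) y)) z‖ ≤ _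
  rw [h4]
  have h5 : 𝒜.sc i ^ q * ‖iteratedFDeriv ℝ q (𝒜.tpoly m τ i) (mobius (𝒜.ctr i) z)‖ ≤
      C₂ * N * 𝒜.sc i ^ min q m := by
    rcases lt_or_ge q m with hqm | hqm
    · rw [min_eq_left hqm.le, mul_comm]
      exact mul_le_mul_of_nonneg_right (h2 τ N h i z hz q) (by positivity)
    · rw [tpoly, iteratedFDeriv_taylorPoly_of_le _ _ _ hqm, norm_zero, mul_zero]
      positivity
  have h6 : 𝒜.sc i ^ m ≤ E ^ m * 𝒜.sc i ^ min q m := by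
    obtain ⟨t, ht⟩ := Nat.exists_eq_add_of_le (min_le_right q m)
    calc 𝒜.sc i ^ m = 𝒜.sc i ^ t * 𝒜.sc i ^ min q m := by
          rw [← pow_add]; congr 1; omega
      _ ≤ E ^ m * 𝒜.sc i ^ min q m := by
          refine mul_le_mul_of_nonneg_right ?_ (by positivity)
          exact (pow_le_pow_left₀ hp.le (hE i) t).trans (pow_le_pow_right₀ hE1 (by omega))
  calc 𝒜.sc i ^ q * ‖iteratedFDeriv ℝ q (𝒜.cmp (𝒜.whit m τ) i) (mobius (𝒜.ctr i) z)‖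
      ≤ 𝒜.sc i ^ q * (‖iteratedFDeriv ℝ q (𝒜.cmp (𝒜.whit m τ) i) (mobius (𝒜.ctr i) z) -
          iteratedFDeriv ℝ q (𝒜.tpoly m τ i) (mobius (𝒜.ctr i) z)‖ +
          ‖iteratedFDeriv ℝ q (𝒜.tpoly m τ i) (mobius (𝒜.ctr i) z)‖) := by
        refine mul_le_mul_of_nonneg_left ?_ (by positivity)
        simpa using norm_add_le (iteratedFDeriv ℝ q (𝒜.cmp (𝒜.whit m τ) i) (mobius (𝒜.ctr i) z) -
          iteratedFDeriv ℝ q (𝒜.tpoly m τ i) (mobius (𝒜.ctr i) z))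
          (iteratedFDeriv ℝ q (𝒜.tpoly m τ i) (mobius (𝒜.ctr i) z))
    _ ≤ C₁ * N * (E ^ m * 𝒜.sc i ^ min q m) + C₂ * N * 𝒜.sc i ^ min q m := by
        rw [mul_add]
        refine add_le_add (h3.trans ?_) h5
        exact mul_le_mul_of_nonneg_left h6 (by positivity)
    _ = _ := by ring

/-- Both τ and its regularization are within O(`sc i` ^ m) of the same Taylor polynomial, to order m
at scale `sc i`. -/
lemma exists_whit_sub_self_bound [T2Space Mb] [CompactSpace Mb] (hρ : IsDefiningFunction n ρ)
    (a b m : ℕ) : ∃ C : ℝ, 1 ≤ C ∧ ∀ (τ : TensorField n Mb a b) (N : ℝ), 𝒜.JetBound m N τ →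
      ∀ i, ∀ z ∈ hypBall n 2, ∀ q ≤ m,
        ‖iteratedFDeriv ℝ q (fun y => 𝒜.crep (𝒜.whit m τ) i y - 𝒜.crep τ i y) z‖ ≤
          C * N * 𝒜.sc i ^ m := by
  obtain ⟨C₁, hC₁, h1⟩ := 𝒜.exists_whit_sub_bound hρ a b m m
  have hd := diamB_pos
  have hc : 1 ≤ 1 + diamB := le_add_of_nonneg_right hd.le
  refine ⟨C₁ + (1 + diamB) ^ m, by nlinarith [one_le_pow₀ hc (n := m)],
    fun τ N h i z hz q hq => ?_⟩
  have hp := 𝒜.sc_pos i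
  have s1 := (h1 τ N h i z hz).sub hp (h.sJet_sub_tpoly i hz hp hc (by nlinarith))
  simp only [sub_sub_sub_cancel_right] at s1
  have h2 := s1.bound q hq
  rw [← norm_iteratedFDeriv_comp_mobius hp] at h2
  exact h2.trans (le_of_eq (by ring))

end MobiusCover

end WAH

end

noncomputable section

namespace WAH

open Filter Topology Function IsManifold

set_option linter.unusedSectionVars false

/-! ### The slot action as a continuous bilinear map -/

section Act

variable {n a b : ℕ}

/-- `Tensor.act A` as a continuous linear map. -/
def Tensor.actT (A : EE n →L[ℝ] EE n) : Tensor n a b →L[ℝ] Tensor n a b :=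
  (∑ s : Fin a, ContinuousMultilinearMap.compContinuousLinearMapL
      (Function.update (fun _ => ContinuousLinearMap.id ℝ (EE n)) s A)) -
  ∑ t : Fin b, ContinuousLinearMap.compContinuousMultilinearMapL ℝ (fun _ : Fin a => EE n)
    (ContraTensor n b) (ContraTensor n b) (ContraTensor.compL
      (Function.update (fun _ : Fin b => ContinuousLinearMap.id ℝ (EE n →L[ℝ] ℝ)) t
        (ContinuousLinearMap.precomp ℝ A)))

@[simp] lemma Tensor.actT_apply (A : EE n →L[ℝ] EE n) (T : Tensor n a b) :
    Tensor.actT A T = T.act A := by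
  rw [Tensor.actT, _root_.sub_apply, sum_apply, sum_apply]
  rfl

/-- `Tensor.act` as a bilinear map. -/
def Tensor.actB (n a b : ℕ) : (EE n →L[ℝ] EE n) →L[ℝ] (Tensor n a b →L[ℝ] Tensor n a b) :=
  LinearMap.toContinuousLinearMap
    { toFun := fun A => Tensor.actT A
      map_add' := fun A B => by
        ext1 T
        rw [_root_.add_apply]
        simp only [Tensor.actT_apply, Tensor.act_add]
      map_smul' := fun c A => by
        ext1 T
        rw [_root_.smul_apply]
        simp only [Tensor.actT_apply, RingHom.id_apply]
        exact map_smul (Tensor.actL T) c A }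

@[simp] lemma Tensor.actB_apply (A : EE n →L[ℝ] EE n) (T : Tensor n a b) :
    Tensor.actB n a b A T = T.act A := Tensor.actT_apply A T

set_option maxSynthPendingDepth 3 in
lemma exists_covBilin {X V W : Type*} [NormedAddCommGroup X] [NormedSpace ℝ X]
    [NormedAddCommGroup V] [NormedSpace ℝ V] [NormedAddCommGroup W] [NormedSpace ℝ W]
    (L : V →L[ℝ] (W →L[ℝ] W)) :
    ∃ B : (X →L[ℝ] V) →L[ℝ] (W →L[ℝ] (X →L[ℝ] W)), ∀ Γ T v, B Γ T v = L (Γ v) T :=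
  ⟨((ContinuousLinearMap.flipₗᵢ ℝ X W W).toContinuousLinearEquiv.toContinuousLinearMap).comp
    (ContinuousLinearMap.compL ℝ X V (W →L[ℝ] W) L), fun _ _ _ => rfl⟩

end Act

/-! ### Derivatives with the truncated weights ε ^ min q s -/

section WJet

variable {X V W G : Type*} [NormedAddCommGroup X] [NormedSpace ℝ X]
  [NormedAddCommGroup V] [NormedSpace ℝ V] [NormedAddCommGroup W] [NormedSpace ℝ W]
  [NormedAddCommGroup G] [NormedSpace ℝ G]

/-- The derivatives of `f` at `z` of order `q ≤ k` are bounded by `A ε ^ min q s`. -/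
structure WJet (ε : ℝ) (s k : ℕ) (A : ℝ) (f : X → V) (z : X) : Prop where
  contDiffAt : ContDiffAt ℝ k f z
  bound : ∀ q ≤ k, ‖iteratedFDeriv ℝ q f z‖ ≤ A * ε ^ min q s

variable {ε A A' : ℝ} {s k : ℕ} {f : X → V} {z : X}

lemma WJet.congr {g : X → V} (h : WJet ε s k A f z) (hfg : g =ᶠ[𝓝 z] f) : WJet ε s k A g z :=
  ⟨h.contDiffAt.congr_of_eventuallyEq hfg, fun j hj => by
    rw [(hfg.iteratedFDeriv ℝ j).self_of_nhds]; exact h.bound j hj⟩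

lemma WJet.nonneg (h : WJet ε s k A f z) : 0 ≤ A := by
  have h1 := (norm_nonneg _).trans (h.bound 0 (Nat.zero_le _))
  simpa using h1

lemma WJet.add {g : X → V} (hf : WJet ε s k A f z) (hg : WJet ε s k A' g z) :
    WJet ε s k (A + A') (fun y => f y + g y) z := by
  refine ⟨hf.contDiffAt.add hg.contDiffAt, fun j hj => ?_⟩
  have hjk : (j : WithTop ℕ∞) ≤ k := by exact_mod_cast hj
  have h1 : iteratedFDeriv ℝ j (fun y => f y + g y) z =
      iteratedFDeriv ℝ j f z + iteratedFDeriv ℝ j g z :=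
    iteratedFDeriv_add_apply (hf.contDiffAt.of_le hjk) (hg.contDiffAt.of_le hjk)
  rw [h1, add_mul]
  exact (norm_add_le _ _).trans (add_le_add (hf.bound j hj) (hg.bound j hj))

lemma WJet.clm (L : V →L[ℝ] W) (hf : WJet ε s k A f z) :
    WJet ε s k (‖L‖ * A) (fun y => L (f y)) z :=
  ⟨L.contDiff.contDiffAt.comp z hf.contDiffAt, fun j hj => by
    rw [mul_assoc]
    exact (L.norm_iteratedFDeriv_comp_left hf.contDiffAt (by exact_mod_cast hj)).trans
      (mul_le_mul_of_nonneg_left (hf.bound j hj) (norm_nonneg _))⟩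

lemma WJet.weaken {s' k' : ℕ} {E : ℝ} (hε : 0 < ε) (hE : 1 ≤ E) (hεE : ε ≤ E)
    (hf : WJet ε s k A f z) (hs : s' ≤ s) (hk : k' ≤ k) : WJet ε s' k' (E ^ s * A) f z := by
  have hA := hf.nonneg
  refine ⟨hf.contDiffAt.of_le (by exact_mod_cast hk), fun j hj => (hf.bound j (hj.trans hk)).trans ?_⟩
  obtain ⟨t, ht⟩ := Nat.exists_eq_add_of_le (min_le_min_left j hs)
  have h1 : ε ^ t ≤ E ^ s := (pow_le_pow_left₀ hε.le hεE t).trans (pow_le_pow_right₀ hE (by omega))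
  rw [ht, pow_add]
  calc A * (ε ^ min j s' * ε ^ t) ≤ A * (ε ^ min j s' * E ^ s) := by gcongr
    _ = _ := by ring

/-- A chart function bounded with its derivatives, read in ball coordinates, has derivatives O(ε ^
j). Multiplying by it loses no weight since min q s ≤ j + min (q - j) s. -/
lemma WJet.bilin {g : X → W} {C E : ℝ} (B : V →L[ℝ] W →L[ℝ] G) (hε : 0 < ε) (hE : 1 ≤ E)
    (hεE : ε ≤ E) (hC : 0 ≤ C) (hf : ContDiffAt ℝ k f z)
    (hfC : ∀ j ≤ k, ‖iteratedFDeriv ℝ j f z‖ ≤ C * ε ^ j)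
    (hg : WJet ε s k A g z) : WJet ε s k (‖B‖ * 2 ^ k * C * E ^ k * A) (fun y => B (f y) (g y)) z := by
  have hA := hg.nonneg
  refine ⟨(B.isBoundedBilinearMap.contDiff (n := (k : WithTop ℕ∞))).contDiffAt.comp₂ hf
    hg.contDiffAt, fun q hq => ?_⟩
  have h1 := norm_iteratedFDeriv_bilin_weighted B hf hg.contDiffAt hq hC hA
    (w₁ := fun j => ε ^ j) (w₂ := fun j => ε ^ min j s) (w := E ^ k * ε ^ min q s)
    (fun j hj => hfC j (hj.trans hq)) (fun j hj => hg.bound j (hj.trans hq)) (fun j hj => by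
      obtain ⟨t, ht⟩ := Nat.exists_eq_add_of_le (show min q s ≤ j + min (q - j) s by omega)
      rw [← pow_add, ht, pow_add, mul_comm]
      refine mul_le_mul_of_nonneg_right ?_ (by positivity)
      exact (pow_le_pow_left₀ hε.le hεE t).trans (pow_le_pow_right₀ hE (by omega)))
  refine h1.trans ?_
  have h2 : (2 : ℝ) ^ q ≤ 2 ^ k := pow_le_pow_right₀ (by norm_num) hq
  calc ‖B‖ * 2 ^ q * C * A * (E ^ k * ε ^ min q s) ≤ ‖B‖ * 2 ^ k * C * A * (E ^ k * ε ^ min q s) := by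
        gcongr
    _ = _ := by ring

/-- A chart derivative costs one power of ε and one order; this mirrors how m counts the permitted
Lie derivatives. -/
lemma WJet.fderiv_scaled (hε : 0 < ε) (hf : WJet ε (s + 1) (k + 1) A f z) :
    WJet ε s k A (fun y => ε⁻¹ • fderiv ℝ f y) z := by
  have h1 : ContDiffAt ℝ k (fderiv ℝ f) z := hf.contDiffAt.fderiv_right (by norm_cast)
  refine ⟨h1.const_smul _, fun q hq => ?_⟩
  rw [iteratedFDeriv_const_smul_apply' (h1.of_le (by exact_mod_cast hq)), norm_smul, norm_inv,
    Real.norm_of_nonneg hε.le, norm_iteratedFDeriv_fderiv, inv_mul_le_iff₀ hε]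
  refine (hf.bound (q + 1) (by omega)).trans (le_of_eq ?_)
  rw [Nat.add_min_add_right, pow_succ]
  ring

end WJet

namespace MobiusCover

variable {n : ℕ} {Mb : Type*} [TopologicalSpace Mb] [ChartedSpace (EuclideanHalfSpace (n + 1)) Mb]
  {ρ : Mb → ℝ} (𝒜 : MobiusCover n Mb ρ) [IsManifold (𝓡∂ (n + 1)) ∞ Mb] {a b : ℕ}

/-! ### Linearity of the regularization -/

section Linear

lemma cmp_add (τ σ : TensorField n Mb a b) (i : 𝒜.Ix) :
    𝒜.cmp (τ + σ) i = 𝒜.cmp τ i + 𝒜.cmp σ i := by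
  ext1 z
  exact map_add (Tensor.pullL (a := a) (b := b) _ _) _ _

lemma cmp_smul (c : ℝ) (τ : TensorField n Mb a b) (i : 𝒜.Ix) :
    𝒜.cmp (c • τ) i = c • 𝒜.cmp τ i := by
  ext1 z
  exact map_smul (Tensor.pullL (a := a) (b := b) _ _) _ _

/-- The tensor fields of class `C^m` at the centers of the parametrizations. -/
def smoothAtCenters (n : ℕ) {Mb : Type*} [TopologicalSpace Mb]
    [ChartedSpace (EuclideanHalfSpace (n + 1)) Mb] {ρ : Mb → ℝ} (𝒜 : MobiusCover n Mb ρ)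
    [IsManifold (𝓡∂ (n + 1)) ∞ Mb] (a b m : ℕ) : Submodule ℝ (TensorField n Mb a b) where
  carrier := {τ | ∀ i, ContDiffAt ℝ m (𝒜.cmp τ i) (𝒜.ctr i)}
  add_mem' := fun {τ σ} hτ hσ i => by rw [cmp_add]; exact (hτ i).add (hσ i)
  zero_mem' := fun i => by
    have : 𝒜.cmp (0 : TensorField n Mb a b) i = 0 := by
      ext1 z
      exact map_zero (Tensor.pullL (a := a) (b := b) _ _)
    rw [this]
    exact contDiffAt_const
  smul_mem' := fun c τ hτ i => by rw [cmp_smul]; exact (hτ i).const_smul c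

variable {𝒜}

lemma tpoly_add {m : ℕ} {τ σ : TensorField n Mb a b} (hτ : τ ∈ smoothAtCenters n 𝒜 a b m)
    (hσ : σ ∈ smoothAtCenters n 𝒜 a b m) (i : 𝒜.Ix) (z : EE n) :
    𝒜.tpoly m (τ + σ) i z = 𝒜.tpoly m τ i z + 𝒜.tpoly m σ i z := by
  rw [tpoly, tpoly, tpoly, cmp_add, taylorPoly, taylorPoly, taylorPoly, ← Finset.sum_add_distrib]
  refine Finset.sum_congr rfl fun j hj => ?_
  have hjm : (j : WithTop ℕ∞) ≤ m := by exact_mod_cast (Finset.mem_range.1 hj).le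
  rw [iteratedFDeriv_add_apply ((hτ i).of_le hjm) ((hσ i).of_le hjm), ← smul_add]
  rfl

lemma tpoly_smul {m : ℕ} {τ : TensorField n Mb a b} (hτ : τ ∈ smoothAtCenters n 𝒜 a b m) (c : ℝ)
    (i : 𝒜.Ix) (z : EE n) : 𝒜.tpoly m (c • τ) i z = c • 𝒜.tpoly m τ i z := by
  rw [tpoly, tpoly, cmp_smul, taylorPoly, taylorPoly, Finset.smul_sum]
  refine Finset.sum_congr rfl fun j hj => ?_
  have hjm : (j : WithTop ℕ∞) ≤ m := by exact_mod_cast (Finset.mem_range.1 hj).le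
  rw [iteratedFDeriv_const_smul_apply ((hτ i).of_le hjm), smul_comm c]
  rfl

lemma finite_support_whit (m : ℕ) (τ : TensorField n Mb a b) (p : Mb) :
    (Function.support fun i => (𝒜.bump i p / 𝒜.bumpSum p) • 𝒜.tfield m τ i p).Finite := by
  refine (𝒜.finite_support_bump p).subset fun i hi h0 => hi ?_
  change 𝒜.bump i p = 0 at h0
  simp only [h0, zero_div, zero_smul]

lemma whit_add {m : ℕ} {τ σ : TensorField n Mb a b} (hτ : τ ∈ smoothAtCenters n 𝒜 a b m)
    (hσ : σ ∈ smoothAtCenters n 𝒜 a b m) : 𝒜.whit m (τ + σ) = 𝒜.whit m τ + 𝒜.whit m σ := by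
  ext1 p
  rw [Pi.add_apply, whit, whit, whit,
    ← finsum_add_distrib (finite_support_whit m τ p) (finite_support_whit m σ p)]
  refine finsum_congr fun i => ?_
  rw [← smul_add, tfield, tfield, tfield, tpoly_add hτ hσ]
  congr 1

lemma whit_smul {m : ℕ} {τ : TensorField n Mb a b} (hτ : τ ∈ smoothAtCenters n 𝒜 a b m) (c : ℝ) :
    𝒜.whit m (c • τ) = c • 𝒜.whit m τ := by
  ext1 p
  rw [Pi.smul_apply, whit, whit, smul_finsum' c (finite_support_whit m τ p)]
  refine finsum_congr fun i => ?_
  rw [smul_comm c, tfield, tfield, tpoly_smul hτ]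
  congr 1

variable (𝒜)

/-- Iterated derivatives are additive only where they are meaningful, so `whit` is linear only on
fields that are C^m at the centers. An arbitrary linear extension to all fields is harmless, because
every field in question lies in this subspace. -/
lemma exists_whit_linear (a b m : ℕ) : ∃ R : TensorField n Mb a b →ₗ[ℝ] TensorField n Mb a b,
    ∀ τ ∈ smoothAtCenters n 𝒜 a b m, R τ = 𝒜.whit m τ := by
  let f : smoothAtCenters n 𝒜 a b m →ₗ[ℝ] TensorField n Mb a b :=
    { toFun := fun τ => 𝒜.whit m τ.1
      map_add' := fun τ σ => whit_add τ.2 σ.2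
      map_smul' := fun c τ => whit_smul τ.2 c }
  obtain ⟨R, hR⟩ := f.exists_extend
  exact ⟨R, fun τ hτ => DFunLike.congr_fun hR ⟨τ, hτ⟩⟩

end Linear

end MobiusCover

end WAH

end

noncomputable section

namespace WAH

open Filter Topology Function IsManifold

set_option linter.unusedSectionVars false

/-- Uncurrying as a continuous linear map. -/
def uncurryT (n a b : ℕ) : (EE n →L[ℝ] Tensor n a b) →L[ℝ] Tensor n (a + 1) b :=
  (continuousMultilinearCurryLeftEquiv ℝ (fun _ : Fin (a + 1) => EE n)
    (ContraTensor n b)).symm.toContinuousLinearEquiv.toContinuousLinearMap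

/-! ### Lie and covariant derivatives in ball coordinates -/

namespace MobiusCover

variable {n : ℕ} {Mb : Type*} [TopologicalSpace Mb] [ChartedSpace (EuclideanHalfSpace (n + 1)) Mb]
  {ρ : Mb → ℝ} {𝒜 : MobiusCover n Mb ρ} [IsManifold (𝓡∂ (n + 1)) ∞ Mb] {a b : ℕ}

section Derivatives

variable {u : TensorField n Mb a b} {i : 𝒜.Ix} {z : EE n}

lemma differentiableAt_cmp (hu : DifferentiableAt ℝ (𝒜.crep u i) z) :
    DifferentiableAt ℝ (𝒜.cmp u i) (mobius (𝒜.ctr i) z) := by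
  have h1 : 𝒜.cmp u i = fun y => 𝒜.crep u i (minv (𝒜.ctr i) y) := by
    ext1 y; rw [crep, mobius_minv (𝒜.sc_pos i)]; rfl
  rw [h1]
  refine DifferentiableAt.comp (mobius (𝒜.ctr i) z) (g := 𝒜.crep u i) ?_
    ((contDiff_minv (𝒜.ctr i) 1).differentiable one_ne_zero _)
  rwa [minv_mobius (𝒜.sc_pos i)]

lemma fderiv_crep (hu : DifferentiableAt ℝ (𝒜.crep u i) z) :
    (𝒜.sc i)⁻¹ • fderiv ℝ (𝒜.crep u i) z = fderiv ℝ (𝒜.cmp u i) (mobius (𝒜.ctr i) z) := by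
  have h2 : HasFDerivAt (mobius (𝒜.ctr i)) (𝒜.sc i • ContinuousLinearMap.id ℝ (EE n)) z := by
    unfold mobius
    exact (((hasFDerivAt_id z).sub_const (basePt n)).const_smul (𝒜.ctr i 0)).const_add _
  have h3 : HasFDerivAt (𝒜.crep u i) ((fderiv ℝ (𝒜.cmp u i) (mobius (𝒜.ctr i) z)).comp
      (𝒜.sc i • ContinuousLinearMap.id ℝ (EE n))) z :=
    (differentiableAt_cmp hu).hasFDerivAt.comp z h2
  rw [h3.fderiv, ContinuousLinearMap.comp_smul, ContinuousLinearMap.comp_id, smul_smul,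
    inv_mul_cancel₀ (𝒜.sc_pos i).ne', one_smul]

lemma crep_lieDeriv (X : VField n Mb) (hz : z ∈ hypBall n 2)
    (hu : DifferentiableAt ℝ (𝒜.crep u i) z) :
    𝒜.crep (lieDeriv X u) i z =
      ((𝒜.sc i)⁻¹ • fderiv ℝ (𝒜.crep u i) z) (vfC (𝒜.ech i) X (mobius (𝒜.ctr i) z)) +
      Tensor.actB n a b (fderiv ℝ (vfC (𝒜.ech i) X) (mobius (𝒜.ctr i) z)) (𝒜.crep u i z) := by
  rw [crep, pullback_lieDeriv (𝒜.bchart_mem _) (𝒜.mobius_mem_cdom i hz) X (differentiableAt_cmp hu)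
    (differentiableAt_vfC X), lieC, Tensor.actB_apply, fderiv_crep hu]
  rfl

lemma crep_covDeriv (h : Metric n Mb) (hz : z ∈ hypBall n 2)
    (hu : DifferentiableAt ℝ (𝒜.crep u i) z) :
    𝒜.crep (covDeriv h u) i z =
      uncurryT n a b ((𝒜.sc i)⁻¹ • fderiv ℝ (𝒜.crep u i) z -
        (𝒜.crep u i z).actL.comp (chrisC (h.coeff (cpar (𝒜.ech i))) (mobius (𝒜.ctr i) z))) := by
  rw [crep, pullback_covDeriv h (𝒜.bchart_mem _) (𝒜.mobius_mem_cdom i hz) (differentiableAt_cmp hu)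
    (differentiableAt_coeff h), covC, fderiv_crep hu]
  rfl

end Derivatives

lemma RepBound.wjet {s k : ℕ} {A : ℝ} {u : TensorField n Mb a b} (h : 𝒜.RepBound s k A u)
    (i : 𝒜.Ix) {z : EE n} (hz : z ∈ hypBall n 2) : WJet (𝒜.sc i) s k A (𝒜.crep u i) z :=
  ⟨h.contDiffAt i z hz, h.bound i z hz⟩

lemma RepBound.weaken {s k s' k' : ℕ} {A E : ℝ} {u : TensorField n Mb a b} (hE1 : 1 ≤ E)
    (hE : ∀ i, 𝒜.sc i ≤ E) (h : 𝒜.RepBound s k A u) (hs : s' ≤ s) (hk : k' ≤ k) :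
    𝒜.RepBound s' k' (E ^ s * A) u :=
  ⟨fun i _ hz => ((h.wjet i hz).weaken (𝒜.sc_pos i) hE1 (hE i) hs hk).contDiffAt,
    fun i _ hz => ((h.wjet i hz).weaken (𝒜.sc_pos i) hE1 (hE i) hs hk).bound⟩

/-- Each derivative of a fixed chart function in ball coordinates brings a factor `sc i`, by the
chain rule for an affine map. -/
lemma exists_jets_comp_mobius {V : Type*} [NormedAddCommGroup V] [NormedSpace ℝ V]
    {f : 𝒜.Cx → EE n → V} (hf : ∀ c, BddJets (f c) (𝒜.dset c)) (k : ℕ) : ∃ C : ℝ, 1 ≤ C ∧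
      ∀ i, ∀ z ∈ hypBall n 2, ContDiffAt ℝ k (fun y => f (𝒜.ci i) (mobius (𝒜.ctr i) y)) z ∧
        ∀ j ≤ k, ‖iteratedFDeriv ℝ j (fun y => f (𝒜.ci i) (mobius (𝒜.ctr i) y)) z‖ ≤
          C * 𝒜.sc i ^ j := by
  obtain ⟨C, hC, h1⟩ := exists_uniform_bound hf k
  refine ⟨C, hC, fun i z hz => ⟨?_, fun j hj => ?_⟩⟩
  · exact (contDiffAt_comp_mobius_iff (𝒜.sc_pos i)).2
      ((hf _).contDiffAt_nat (𝒜.mobius_mem_dset i hz) k)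
  · rw [norm_iteratedFDeriv_comp_mobius (𝒜.sc_pos i), mul_comm]
    exact mul_le_mul_of_nonneg_right (h1 _ _ (𝒜.mobius_mem_dset i hz) j hj)
      (pow_nonneg (𝒜.sc_pos i).le _)

variable [CompactSpace Mb]

set_option maxSynthPendingDepth 3 in
-- The first-order term is `(sc i)⁻¹` times a derivative, which uses up one order and one weight;
-- the zeroth-order term keeps more weight than is required. The coefficients have bounded chart
-- derivatives.
lemma exists_repBound_lieDeriv (hρ : IsDefiningFunction n ρ) (X : VField n Mb) (a b s k : ℕ) :
    ∃ C : ℝ, 1 ≤ C ∧ ∀ (u : TensorField n Mb a b) (A : ℝ), 𝒜.RepBound (s + 1) (k + 1) A u →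
      𝒜.RepBound s k (C * A) (lieDeriv X u) := by
  obtain ⟨E, hE1, hE⟩ := 𝒜.exists_sc_le hρ
  obtain ⟨C₁, hC₁, h1⟩ := exists_jets_comp_mobius (𝒜 := 𝒜) (f := fun c => vfC (𝒜.bchart c) X)
    (fun c => bddJets_vfC (𝒜.bchart_mem c) X (𝒜.bK_compact c) (𝒜.bK_subset c)) k
  obtain ⟨C₂, hC₂, h2⟩ := exists_jets_comp_mobius (𝒜 := 𝒜)
    (f := fun c => fderiv ℝ (vfC (𝒜.bchart c) X))
    (fun c => (bddJets_vfC (𝒜.bchart_mem c) X (𝒜.bK_compact c) (𝒜.bK_subset c)).fderiv) k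
  set B₁ : EE n →L[ℝ] (EE n →L[ℝ] Tensor n a b) →L[ℝ] Tensor n a b :=
    ContinuousLinearMap.apply ℝ (Tensor n a b)
  set C := ‖B₁‖ * 2 ^ k * C₁ * E ^ k + ‖Tensor.actB n a b‖ * 2 ^ k * C₂ * E ^ k * E ^ (s + 1)
  refine ⟨1 + C, le_add_of_nonneg_right (by positivity), fun u A h => ?_⟩
  have key : ∀ i, ∀ z ∈ hypBall n 2, WJet (𝒜.sc i) s k ((1 + C) * A) (𝒜.crep (lieDeriv X u) i) z := by
    intro i z hz
    have hw := h.wjet i hz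
    have hA := hw.nonneg
    have hε := 𝒜.sc_pos i
    have h3 := (hw.fderiv_scaled hε).bilin B₁ hε hE1 (hE i) (zero_le_one.trans hC₁) (h1 i z hz).1
      (h1 i z hz).2
    have h4 := (hw.weaken hε hE1 (hE i) (Nat.le_succ s) (Nat.le_succ k)).bilin (Tensor.actB n a b)
      hε hE1 (hE i) (zero_le_one.trans hC₂) (h2 i z hz).1 (h2 i z hz).2
    have h5 := (h3.add h4).congr (g := 𝒜.crep (lieDeriv X u) i) (by
      filter_upwards [(isOpen_hypBall two_pos).mem_nhds hz] with y hy
      exact crep_lieDeriv X hy ((h.contDiffAt i y hy).differentiableAt (by simp)))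
    refine ⟨h5.contDiffAt, fun q hq => (h5.bound q hq).trans ?_⟩
    refine mul_le_mul_of_nonneg_right ?_ (pow_nonneg hε.le _)
    calc _ = C * A := by ring
      _ ≤ _ := by nlinarith
  exact ⟨fun i z hz => (key i z hz).contDiffAt, fun i z hz => (key i z hz).bound⟩

set_option maxSynthPendingDepth 3 in
-- The weight of the tensor rises by one with its rank, so the loss of one power of `sc i` is the
-- same as for a Lie derivative; Christoffel symbols take the role of the derivative of the vector
-- field.
lemma exists_repBound_covDeriv (hρ : IsDefiningFunction n ρ) (h : Metric n Mb) (a b s k : ℕ) :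
    ∃ C : ℝ, 1 ≤ C ∧ ∀ (u : TensorField n Mb a b) (A : ℝ), 𝒜.RepBound (s + 1) (k + 1) A u →
      𝒜.RepBound s k (C * A) (covDeriv h u) := by
  obtain ⟨E, hE1, hE⟩ := 𝒜.exists_sc_le hρ
  obtain ⟨C₁, hC₁, h1⟩ := exists_jets_comp_mobius (𝒜 := 𝒜)
    (f := fun c => chrisC (h.coeff (cpar (𝒜.bchart c))))
    (fun c => bddJets_christoffel h (𝒜.bchart_mem c) (𝒜.bK_compact c) (𝒜.bK_subset c)) k
  obtain ⟨B, hB⟩ := exists_covBilin (X := EE n) (Tensor.actB n a b)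
  set C := ‖uncurryT n a b‖ * (1 + ‖-B‖ * 2 ^ k * C₁ * E ^ k * E ^ (s + 1))
  refine ⟨1 + C, le_add_of_nonneg_right (by positivity), fun u A hu => ?_⟩
  have key : ∀ i, ∀ z ∈ hypBall n 2, WJet (𝒜.sc i) s k ((1 + C) * A) (𝒜.crep (covDeriv h u) i) z := by
    intro i z hz
    have hw := hu.wjet i hz
    have hA := hw.nonneg
    have hε := 𝒜.sc_pos i
    have h4 := (hw.weaken hε hE1 (hE i) (Nat.le_succ s) (Nat.le_succ k)).bilin (-B)
      hε hE1 (hE i) (zero_le_one.trans hC₁) (h1 i z hz).1 (h1 i z hz).2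
    have h5 := (((hw.fderiv_scaled hε).add h4).clm (uncurryT n a b)).congr
      (g := 𝒜.crep (covDeriv h u) i) (by
      filter_upwards [(isOpen_hypBall two_pos).mem_nhds hz] with y hy
      rw [crep_covDeriv h hy ((hu.contDiffAt i y hy).differentiableAt (by simp)), sub_eq_add_neg]
      congr 2
      ext1 v
      change -((𝒜.crep u i y).act (chrisC _ _ v)) = -(B (chrisC _ _) (𝒜.crep u i y) v)
      rw [hB, Tensor.actB_apply])
    refine ⟨h5.contDiffAt, fun q hq => (h5.bound q hq).trans ?_⟩
    refine mul_le_mul_of_nonneg_right ?_ (pow_nonneg hε.le _)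
    calc _ = C * A := by ring
      _ ≤ _ := by nlinarith
  exact ⟨fun i z hz => (key i z hz).contDiffAt, fun i z hz => (key i z hz).bound⟩

lemma exists_repBound_covDerivIter (hρ : IsDefiningFunction n ρ) (h : Metric n Mb) (a b m k : ℕ) :
    ∀ j ≤ m, j ≤ k → ∃ C : ℝ, 1 ≤ C ∧ ∀ (u : TensorField n Mb a b) (A : ℝ), 𝒜.RepBound m k A u →
      𝒜.RepBound (m - j) (k - j) (C * A) (covDerivIter h u j)
  | 0, _, _ => ⟨1, le_rfl, fun u A hu => by rw [one_mul]; exact hu⟩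
  | j + 1, hm, hk => by
    obtain ⟨C₁, hC₁, h1⟩ := exists_repBound_covDerivIter hρ h a b m k j (by omega) (by omega)
    obtain ⟨C₂, hC₂, h2⟩ := exists_repBound_covDeriv (𝒜 := 𝒜) hρ h (a + j) b (m - (j + 1)) (k - (j + 1))
    refine ⟨C₂ * C₁, one_le_mul_of_one_le_of_one_le hC₂ hC₁, fun u A hu => ?_⟩
    rw [mul_assoc]
    refine h2 _ _ ?_
    rw [show m - (j + 1) + 1 = m - j by omega, show k - (j + 1) + 1 = k - j by omega]
    exact h1 u A hu

lemma exists_repBound_foldr_lieDeriv (hρ : IsDefiningFunction n ρ) {m k : ℕ}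
    {u : TensorField n Mb a b} {A : ℝ} (hu : 𝒜.RepBound m k A u) :
    ∀ X : List (VField n Mb), X.length ≤ m → X.length ≤ k → ∃ A' : ℝ,
      𝒜.RepBound (m - X.length) (k - X.length) A' (X.foldr lieDeriv u)
  | [], _, _ => ⟨A, by simpa using hu⟩
  | X :: L, hm, hk => by
    rw [List.length_cons] at hm hk
    obtain ⟨A₁, h1⟩ := exists_repBound_foldr_lieDeriv hρ hu L (by omega) (by omega)
    obtain ⟨C₂, hC₂, h2⟩ := exists_repBound_lieDeriv (𝒜 := 𝒜) hρ X a b (m - (L.length + 1))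
      (k - (L.length + 1))
    refine ⟨C₂ * A₁, h2 _ _ ?_⟩
    rw [show m - (L.length + 1) + 1 = m - L.length by omega,
      show k - (L.length + 1) + 1 = k - L.length by omega]
    exact h1

end MobiusCover

end WAH

end

noncomputable section

namespace WAH

open Filter Topology Function IsManifold

set_option linter.unusedSectionVars false

lemma HolderB.const_smul {n : ℕ} {V : Type*} [NormedAddCommGroup V] [NormedSpace ℝ V] {k : ℕ}
    {α A c : ℝ} {f : EE n → V} (hc : 0 ≤ c) (hf : HolderB k α A f) :
    HolderB k α (c * A) (fun z => c • f z) := by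
  refine (hf.clm (c • ContinuousLinearMap.id ℝ V)).mono ?_
  refine mul_le_mul_of_nonneg_right ?_ hf.nonneg
  rw [norm_smul, Real.norm_of_nonneg hc]
  exact mul_le_of_le_one_right hc ContinuousLinearMap.norm_id_le

/-! ### From weighted Hölder norms to chart components and back -/

namespace MobiusCover

variable {n : ℕ} {Mb : Type*} [TopologicalSpace Mb] [ChartedSpace (EuclideanHalfSpace (n + 1)) Mb]
  {ρ : Mb → ℝ} (𝒜 : MobiusCover n Mb ρ) [IsManifold (𝓡∂ (n + 1)) ∞ Mb] {a b : ℕ}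

lemma exists_wt_smul_holderB (V : Type*) [NormedAddCommGroup V] [NormedSpace ℝ V]
    (hρ : IsDefiningFunction n ρ) (k : ℕ) {α : ℝ} (hα0 : 0 ≤ α) (hα1 : α < 1)
    (δ : ℝ) : ∃ C : ℝ, 0 ≤ C ∧ ∀ i (A : ℝ) (f : EE n → V), HolderB k α A f →
      HolderB k α (C * A) (fun z => 𝒜.wt δ i z • f z) := by
  obtain ⟨C, hC, h1⟩ := 𝒜.exists_wt_bound hρ δ (k + 1)
  have hd := one_le_diamC
  exact ⟨‖(ContinuousLinearMap.lsmul ℝ ℝ : ℝ →L[ℝ] V →L[ℝ] V)‖ * 2 ^ k * 2 * diamC * C,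
    by positivity, fun i A f hf => HolderB.bilin (ContinuousLinearMap.lsmul ℝ ℝ) hα0 hα1
      (fun z hz => (h1 i z hz).1) (fun z hz => (h1 i z hz).2) hf⟩

lemma rep_eq_pow (hρ : IsDefiningFunction n ρ) {δ : ℝ} {t : ℕ} (hδ : δ = weight a b + t)
    (u : TensorField n Mb a b) (i : 𝒜.Ix) {z : EE n} (hz : z ∈ hypBall n 2) :
    𝒜.rep δ u i z = (𝒜.sc i ^ t)⁻¹ • 𝒜.wt δ i z • 𝒜.crep u i z := by
  rw [𝒜.rep_eq hρ δ u i hz, hδ, sub_add_cancel_left, Real.rpow_neg (𝒜.sc_pos i).le,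
    Real.rpow_natCast]

lemma crep_eq_pow (hρ : IsDefiningFunction n ρ) {δ : ℝ} {t : ℕ} (hδ : δ = weight a b + t)
    (u : TensorField n Mb a b) (i : 𝒜.Ix) {z : EE n} (hz : z ∈ hypBall n 2) :
    𝒜.crep u i z = 𝒜.sc i ^ t • 𝒜.wt (-δ) i z • 𝒜.rep δ u i z := by
  have h1 := pow_ne_zero t (𝒜.sc_pos i).ne'
  rw [𝒜.rep_eq_pow hρ hδ u i hz, smul_comm (𝒜.wt (-δ) i z), smul_smul, mul_inv_cancel₀ h1, one_smul,
    smul_smul, 𝒜.wt_mul_wt_neg hρ δ i hz, one_smul]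

/-- Uniform bounds for the components of a tensor field give bounds in the Hölder spaces. -/
lemma exists_holderNorm_le (hρ : IsDefiningFunction n ρ) (a b k t : ℕ) {α : ℝ} (hα0 : 0 ≤ α)
    (hα1 : α < 1) {δ : ℝ} (hδ : δ = weight a b + t) : ∃ C : ℝ, 0 ≤ C ∧
      ∀ (u : TensorField n Mb a b) (A : ℝ), (∀ i, HolderB k α (A * 𝒜.sc i ^ t) (𝒜.crep u i)) →
        𝒜.MemHolder k α δ u ∧ 𝒜.holderNorm k α δ u ≤ ENNReal.ofReal (C * A) := by
  obtain ⟨C, hC, h1⟩ := 𝒜.exists_wt_smul_holderB (Tensor n a b) hρ k hα0 hα1 δ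
  refine ⟨(k + 2) * C, by positivity, fun u A h => ?_⟩
  have key : ∀ i, HolderB k α (C * A) (𝒜.rep δ u i) := fun i => by
    have hs := pow_pos (𝒜.sc_pos i) t
    have h2 := ((h1 i _ _ (h i)).const_smul (inv_nonneg.2 hs.le)).congr
      (g := 𝒜.rep δ u i) (fun z hz => 𝒜.rep_eq_pow hρ hδ u i hz)
    refine h2.mono (le_of_eq ?_)
    field_simp
  have h3 : 𝒜.holderNorm k α δ u ≤ ENNReal.ofReal ((k + 2) * C * A) := iSup_le fun i => by
    rw [mul_assoc]
    exact (key i).holderNormOn_le hα0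
  exact ⟨⟨fun i z hz => ((key i).contDiffAt z hz).contDiffWithinAt,
    h3.trans_lt ENNReal.ofReal_lt_top⟩, h3⟩

/-- The weight function is inverted by the one with exponent of opposite sign, which obeys the same
kind of bounds. -/
lemma exists_holderB_crep (hρ : IsDefiningFunction n ρ) (a b k t : ℕ) {α : ℝ} (hα0 : 0 ≤ α)
    (hα1 : α < 1) {δ : ℝ} (hδ : δ = weight a b + t) : ∃ C : ℝ, 0 ≤ C ∧
      ∀ u : TensorField n Mb a b, 𝒜.MemHolder k α δ u → ∀ i,
        HolderB k α (C * (𝒜.holderNorm k α δ u).toReal * 𝒜.sc i ^ t) (𝒜.crep u i) := by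
  obtain ⟨C, hC, h1⟩ := 𝒜.exists_wt_smul_holderB (Tensor n a b) hρ k hα0 hα1 (-δ)
  refine ⟨C, hC, fun u h i => ?_⟩
  have h2 : HolderB k α (𝒜.holderNorm k α δ u).toReal (𝒜.rep δ u i) :=
    holderB_of_holderNormOn_lt_top (h.1 i) hα0 (by
      rw [ENNReal.ofReal_toReal h.2.ne]
      exact le_iSup (fun i => holderNormOn (hypBall n 2) k α (𝒜.rep δ u i)) i) ENNReal.toReal_nonneg
  have h3 := ((h1 i _ _ h2).const_smul (pow_pos (𝒜.sc_pos i) t).le).congr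
    (g := 𝒜.crep u i) (fun z hz => 𝒜.crep_eq_pow hρ hδ u i hz)
  exact h3.mono (le_of_eq (mul_comm _ _))

/-- Only finiteness of the norm is assumed, not membership: for covariant derivatives the norm is
what is available directly, and only its sup part is needed. The constant does not depend on k or α.
-/
lemma exists_norm_crep_le (hρ : IsDefiningFunction n ρ) (a b : ℕ) {δ : ℝ} (hδ : δ = weight a b) :
    ∃ C : ℝ, 0 ≤ C ∧ ∀ (k : ℕ) (α : ℝ) (u : TensorField n Mb a b), 𝒜.holderNorm k α δ u ≠ ⊤ →
      ∀ i, ∀ z ∈ hypBall n 2, ‖𝒜.crep u i z‖ ≤ C * (𝒜.holderNorm k α δ u).toReal := by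
  obtain ⟨C, hC, h1⟩ := 𝒜.exists_wt_bound hρ (-δ) 0
  refine ⟨C, hC, fun k α u h i z hz => ?_⟩
  have h2 : ‖𝒜.rep δ u i z‖ₑ ≤ 𝒜.holderNorm k α δ u := by
    refine le_trans ?_ (le_iSup (fun i => holderNormOn (hypBall n 2) k α (𝒜.rep δ u i)) i)
    refine le_trans ?_ (le_self_add)
    refine le_trans ?_ (Finset.single_le_sum (f := fun j => ⨆ z ∈ hypBall n 2,
        ‖iteratedFDeriv ℝ j (𝒜.rep δ u i) z‖ₑ) (fun _ _ => zero_le)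
        (Finset.mem_range.2 (Nat.succ_pos k)))
    refine le_trans (le_of_eq ?_)
      (le_iSup₂ (f := fun z (_ : z ∈ hypBall n 2) => ‖iteratedFDeriv ℝ 0 (𝒜.rep δ u i) z‖ₑ) z hz)
    rw [← ofReal_norm, ← ofReal_norm, norm_iteratedFDeriv_zero]
  have h3 : ‖𝒜.rep δ u i z‖ ≤ (𝒜.holderNorm k α δ u).toReal := by
    rw [← toReal_enorm]
    exact ENNReal.toReal_mono h h2
  have h4 := (h1 i z hz).2 0 le_rfl
  rw [norm_iteratedFDeriv_zero] at h4
  rw [𝒜.crep_eq_pow hρ (t := 0) (by simpa using hδ) u i hz, pow_zero, one_smul, norm_smul]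
  gcongr

lemma RepBound.holderB {𝒜 : MobiusCover n Mb ρ} {k : ℕ} {α A : ℝ} {u : TensorField n Mb a b}
    (hα0 : 0 ≤ α) (hα1 : α < 1) (h : 𝒜.RepBound 0 (k + 1) A u) (i : 𝒜.Ix) :
    HolderB k α (diamC * A * 𝒜.sc i ^ 0) (𝒜.crep u i) := by
  rw [pow_zero, mul_one]
  exact holderB_of_bound hα0 hα1 (h.contDiffAt i) fun z hz j hj => by
    simpa using h.bound i z hz j hj

end MobiusCover

end WAH

end

noncomputable section

namespace WAH

open Filter Topology Function IsManifold

set_option linter.unusedSectionVars false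

/-! ### Global vector fields that are constant in a chart -/

section Frames

variable {n : ℕ} {Mb : Type*} [TopologicalSpace Mb] [ChartedSpace (EuclideanHalfSpace (n + 1)) Mb]
  [IsManifold (𝓡∂ (n + 1)) ∞ Mb] {e : OpenPartialHomeomorph Mb (EuclideanHalfSpace (n + 1))}

lemma contMDiffOn_coordinateField (he : e ∈ maximalAtlas (𝓡∂ (n + 1)) ∞ Mb) (v : EE n) :
    ContMDiffOn (𝓡∂ (n + 1)) (𝓡∂ (n + 1)).tangent ∞
      (fun p => (⟨p, dParamW e (ccoord e p) v⟩ : TangentBundle (𝓡∂ (n + 1)) Mb)) e.source := by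
  have : IsManifold (𝓡∂ (n + 1)) 1 Mb := IsManifold.of_le (n := ∞) (by simp)
  have h2 := (contMDiffOn_cpar he).contMDiffOn_tangentMapWithin (m := ∞) (by simp)
    uniqueDiffOn_extend_target.uniqueMDiffOn
  have h4 : ContMDiffOn 𝓘(ℝ, EE n) 𝓘(ℝ, EE n).tangent ∞
      (fun z => (⟨z, v⟩ : TangentBundle 𝓘(ℝ, EE n) (EE n)))
      (e.extend (𝓡∂ (n + 1))).target :=
    contMDiffOn_vectorSpace_iff_contDiffOn.2 contDiffOn_const
  have h3 : ContMDiffOn 𝓘(ℝ, EE n) (𝓡∂ (n + 1)).tangent ∞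
      (fun z => (⟨cpar e z, dParamW e z v⟩ : TangentBundle (𝓡∂ (n + 1)) Mb))
      (e.extend (𝓡∂ (n + 1))).target := h2.comp h4 (fun z hz => hz)
  have h5 : ContMDiffOn (𝓡∂ (n + 1)) 𝓘(ℝ, EE n) ∞ (ccoord e) e.source :=
    OpenPartialHomeomorph.contMDiffOn_extend he
  have key : ∀ (p q : Mb) (w : EE n), p = q →
      (⟨p, w⟩ : TangentBundle (𝓡∂ (n + 1)) Mb) = ⟨q, w⟩ := by rintro p _ w rfl; rfl
  refine (h3.comp h5 fun p hp => ?_).congr fun p hp => (key _ _ _ (cpar_ccoord hp)).symm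
  exact (e.extend (𝓡∂ (n + 1))).map_source (by rwa [e.extend_source])

/-- Coordinate vector fields near a compact subset of a chart domain extend to the manifold. -/
lemma exists_vfield_const [T2Space Mb] [CompactSpace Mb] (he : e ∈ maximalAtlas (𝓡∂ (n + 1)) ∞ Mb)
    {K : Set Mb} (hK : IsCompact K) (hKe : K ⊆ e.source) (v : EE n) :
    ∃ X : VField n Mb, ∀ y ∈ cset e K, vfC e X =ᶠ[𝓝 y] fun _ => v := by
  -- An intermediate open set leaves room for a cutoff that is one near K and supported inside the
  -- chart domain.
  obtain ⟨V, hV, hKV, hVe⟩ := normal_exists_closure_subset hK.isClosed e.open_source hKe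
  obtain ⟨χ, h1, h0, -⟩ := exists_contMDiffMap_one_nhds_of_subset_interior (n := (⊤ : ℕ∞)) (𝓡∂ (n + 1))
    hK.isClosed (t := closure V) (hKV.trans (interior_maximal subset_closure hV))
  have hsupp : tsupport χ ⊆ e.source := by
    refine (closure_minimal (fun p hp => ?_) isClosed_closure).trans hVe
    by_contra hc
    exact hp (h0 p hc)
  let s : ∀ p : Mb, TangentSpace (𝓡∂ (n + 1)) p := fun p => dParamW e (ccoord e p) v
  have h2 := ContMDiffOn.smul_section_of_tsupport (V := (TangentSpace (𝓡∂ (n + 1)) : Mb → Type _))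
    (s := s) (χ.contMDiff.contMDiffOn) e.open_source hsupp (contMDiffOn_coordinateField he v)
  refine ⟨⟨fun p => χ p • s p, h2⟩, fun y hy => ?_⟩
  have h3 : ∀ᶠ x in 𝓝 (cpar e y), χ x = 1 := (eventually_nhdsSet_iff_forall.1 h1) _ hy.2
  filter_upwards [(continuousAt_cpar hy.1).eventually h3, cdom_mem_nhds hy.1] with w hw hwc
  have h4 : (χ (cpar e w) • s (cpar e w) : EE n) = dParam (cpar e) w v := by
    rw [hw, one_smul]
    change dParamW e (ccoord e (cpar e w)) v = _
    rw [ccoord_cpar hwc, dParamW_eq hwc]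
  change (dParam (cpar e) w).inverse (χ (cpar e w) • s (cpar e w) : EE n) = v
  rw [h4]
  exact DFunLike.congr_fun (isInvertible_dParam he hwc).inverse_comp_self v

end Frames

/-! ### Truncated weights with Hölder control at the top order -/

section WHolder

variable {n : ℕ} {V W : Type*} [NormedAddCommGroup V] [NormedSpace ℝ V]
  [NormedAddCommGroup W] [NormedSpace ℝ W]

/-- The derivatives of `f` of order `q ≤ k` on the ball of radius `2` are bounded by
`A ε ^ min q s`, with a Hölder bound for the derivatives of order `k`. -/
structure WHolder (ε : ℝ) (s k : ℕ) (α A : ℝ) (f : EE n → V) : Prop where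
  wjet : ∀ z ∈ hypBall n 2, WJet ε s k A f z
  holder : α ≠ 0 → ∀ z ∈ hypBall n 2, ∀ w ∈ hypBall n 2,
    ‖iteratedFDeriv ℝ k f z - iteratedFDeriv ℝ k f w‖ ≤ A * ε ^ s * ‖z - w‖ ^ α

variable {ε α A A' : ℝ} {s k : ℕ} {f : EE n → V}

lemma WHolder.mono (hε : 0 < ε) (h : WHolder ε s k α A f) (hA : A ≤ A') : WHolder ε s k α A' f := by
  refine ⟨fun z hz => ⟨(h.wjet z hz).contDiffAt, fun q hq => ((h.wjet z hz).bound q hq).trans ?_⟩,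
    fun h0 z hz w hw => (h.holder h0 z hz w hw).trans ?_⟩
  · gcongr
  · have := Real.rpow_nonneg (norm_nonneg (z - w)) α
    gcongr

lemma WHolder.add {g : EE n → V} (hf : WHolder ε s k α A f) (hg : WHolder ε s k α A' g) :
    WHolder ε s k α (A + A') (fun z => f z + g z) := by
  refine ⟨fun z hz => (hf.wjet z hz).add (hg.wjet z hz), fun h0 z hz w hw => ?_⟩
  have e : ∀ z ∈ hypBall n 2, iteratedFDeriv ℝ k (fun z => f z + g z) z =
      iteratedFDeriv ℝ k f z + iteratedFDeriv ℝ k g z := fun z hz =>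
    iteratedFDeriv_add_apply (hf.wjet z hz).contDiffAt (hg.wjet z hz).contDiffAt
  rw [e z hz, e w hw, add_sub_add_comm, add_mul, add_mul]
  exact (norm_add_le _ _).trans (add_le_add (hf.holder h0 z hz w hw) (hg.holder h0 z hz w hw))

lemma WHolder.clm (L : V →L[ℝ] W) (hf : WHolder ε s k α A f) :
    WHolder ε s k α (‖L‖ * A) (fun z => L (f z)) := by
  have e : ∀ z ∈ hypBall n 2, iteratedFDeriv ℝ k (fun z => L (f z)) z =
      L.compContinuousMultilinearMap (iteratedFDeriv ℝ k f z) := fun z hz =>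
    L.iteratedFDeriv_comp_left (hf.wjet z hz).contDiffAt le_rfl
  refine ⟨fun z hz => (hf.wjet z hz).clm L, fun h0 z hz w hw => ?_⟩
  have h1 : L.compContinuousMultilinearMap (iteratedFDeriv ℝ k f z) -
      L.compContinuousMultilinearMap (iteratedFDeriv ℝ k f w) =
      L.compContinuousMultilinearMap (iteratedFDeriv ℝ k f z - iteratedFDeriv ℝ k f w) := by
    ext1 v; simp
  rw [e z hz, e w hw, h1, mul_assoc, mul_assoc, ← mul_assoc A]
  exact (L.norm_compContinuousMultilinearMap_le _).trans
    (mul_le_mul_of_nonneg_left (hf.holder h0 z hz w hw) (norm_nonneg _))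

lemma wHolder_zero : WHolder ε s k α 0 (fun _ : EE n => (0 : V)) := by
  refine ⟨fun z hz => ⟨contDiffAt_const, fun q hq => ?_⟩, fun h0 z hz w hw => ?_⟩
  · rw [iteratedFDeriv_fun_zero]; simp
  · rw [iteratedFDeriv_fun_zero]; simp

lemma WHolder.sum {ι : Type*} (t : Finset ι) {f : ι → EE n → V} {A : ι → ℝ}
    (h : ∀ i ∈ t, WHolder ε s k α (A i) (f i)) :
    WHolder ε s k α (∑ i ∈ t, A i) (fun z => ∑ i ∈ t, f i z) := by
  classical
  induction t using Finset.induction_on with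
  | empty => simpa using wHolder_zero
  | insert i t hi ih =>
    simp only [Finset.sum_insert hi]
    exact (h i (Finset.mem_insert_self i t)).add
      (ih fun j hj => h j (Finset.mem_insert_of_mem hj))

/-- The inverse of the loss in a chart derivative: if Df is ε times a function with weights up to s,
then f itself has weights up to s + 1; order zero needs only a bound. -/
lemma WHolder.of_fderiv {F : EE n → EE n →L[ℝ] V} (hε : 0 < ε) (hA' : 0 ≤ A')
    (hf : ∀ z ∈ hypBall n 2, ContDiffAt ℝ (k + 1 : ℕ) f z)
    (h0 : ∀ z ∈ hypBall n 2, ‖f z‖ ≤ A') (hF : WHolder ε s k α A F)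
    (h : ∀ z ∈ hypBall n 2, fderiv ℝ f z = ε • F z) :
    WHolder ε (s + 1) (k + 1) α (A + A') f := by
  have hA : 0 ≤ A := (hF.wjet _ (basePt_mem_hypBall two_pos)).nonneg
  have e : ∀ q ≤ k, ∀ z ∈ hypBall n 2, iteratedFDeriv ℝ q (fderiv ℝ f) z =
      ε • iteratedFDeriv ℝ q F z := fun q hq z hz => by
    have h1 : fderiv ℝ f =ᶠ[𝓝 z] fun z => ε • F z := by
      filter_upwards [(isOpen_hypBall two_pos).mem_nhds hz] with y hy using h y hy
    rw [(h1.iteratedFDeriv ℝ q).self_of_nhds]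
    exact iteratedFDeriv_const_smul_apply'
      ((hF.wjet z hz).contDiffAt.of_le (by exact_mod_cast hq))
  refine ⟨fun z hz => ⟨hf z hz, fun q hq => ?_⟩, fun hα z hz w hw => ?_⟩
  · cases q with
    | zero =>
      rw [norm_iteratedFDeriv_zero, Nat.zero_min, pow_zero, mul_one]
      exact (h0 z hz).trans (le_add_of_nonneg_left hA)
    | succ q =>
      rw [← norm_iteratedFDeriv_fderiv, e q (by omega) z hz, norm_smul, Real.norm_of_nonneg hε.le,
        Nat.add_min_add_right, pow_succ]
      have h2 := (hF.wjet z hz).bound q (by omega)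
      have h3 : 0 < ε ^ min q s := pow_pos hε _
      calc _ ≤ ε * (A * ε ^ min q s) := by gcongr
        _ ≤ ε * ((A + A') * ε ^ min q s) := by gcongr; linarith
        _ = _ := by ring
  · have h4 : ‖iteratedFDeriv ℝ (k + 1) f z - iteratedFDeriv ℝ (k + 1) f w‖ =
        ‖iteratedFDeriv ℝ k (fderiv ℝ f) z - iteratedFDeriv ℝ k (fderiv ℝ f) w‖ := by
      rw [iteratedFDeriv_succ_eq_comp_right (x := z), iteratedFDeriv_succ_eq_comp_right (x := w)]
      rw [← dist_eq_norm, ← dist_eq_norm]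
      exact LinearIsometryEquiv.dist_map _ _ _
    rw [h4, e k le_rfl z hz, e k le_rfl w hw, ← smul_sub, norm_smul, Real.norm_of_nonneg hε.le,
      pow_succ]
    have h2 := hF.holder hα z hz w hw
    have h3 := Real.rpow_nonneg (norm_nonneg (z - w)) α
    have h5 : 0 < ε ^ s := pow_pos hε _
    calc _ ≤ ε * (A * ε ^ s * ‖z - w‖ ^ α) := by gcongr
      _ ≤ ε * ((A + A') * ε ^ s * ‖z - w‖ ^ α) := by gcongr; linarith
      _ = _ := by ring

end WHolder

/-! ### Lie derivatives control the derivatives of the components -/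

namespace MobiusCover

variable {n : ℕ} {Mb : Type*} [TopologicalSpace Mb] [ChartedSpace (EuclideanHalfSpace (n + 1)) Mb]
  {ρ : Mb → ℝ} (𝒜 : MobiusCover n Mb ρ) [IsManifold (𝓡∂ (n + 1)) ∞ Mb] {a b : ℕ}

lemma fderiv_crep_apply {𝒜 : MobiusCover n Mb ρ} {u : TensorField n Mb a b} {X : VField n Mb}
    {i : 𝒜.Ix} {v z : EE n} (hz : z ∈ hypBall n 2)
    (hX : vfC (𝒜.ech i) X =ᶠ[𝓝 (mobius (𝒜.ctr i) z)] fun _ => v)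
    (hu : DifferentiableAt ℝ (𝒜.crep u i) z) :
    fderiv ℝ (𝒜.crep u i) z v = 𝒜.sc i • 𝒜.crep (lieDeriv X u) i z := by
  rw [crep_lieDeriv X hz hu, hX.fderiv_eq, hX.self_of_nhds, fderiv_const_apply, map_zero,
    _root_.zero_apply, add_zero, _root_.smul_apply, smul_smul, mul_inv_cancel₀ (𝒜.sc_pos i).ne', one_smul]

set_option maxSynthPendingDepth 3 in
-- Induction on s: a partial derivative of `crep` is `sc i` times `crep` of a Lie derivative along
-- an extended coordinate field, and that Lie derivative satisfies the hypothesis with s and k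
-- lowered by one. There is one frame for each of finitely many charts, so A is uniform in i. It
-- depends on u; no estimate by a norm is claimed here.
lemma exists_wHolder_crep [T2Space Mb] [CompactSpace Mb] (hρ : IsDefiningFunction n ρ) {α : ℝ}
    (hα0 : 0 ≤ α) (hα1 : α < 1) : ∀ (s k : ℕ) (u : TensorField n Mb a b), s ≤ k →
      𝒜.MemScriptC k α s u → ∃ A : ℝ, ∀ i, WHolder (𝒜.sc i) s k α A (𝒜.crep u i)
  | 0, k, u, _, h => by
    obtain ⟨C, hC, h1⟩ := 𝒜.exists_holderB_crep hρ a b k 0 hα0 hα1 (δ := weight a b) (by simp)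
    have h2 := h1 u (h [] (Nat.zero_le _))
    exact ⟨_, fun i => ⟨fun z hz => ⟨(h2 i).contDiffAt z hz, fun q hq => by
      simpa using (h2 i).bound z hz q hq⟩, fun hα z hz w hw => (h2 i).holder hα z hz w hw⟩⟩
  | s + 1, 0, _, h, _ => absurd h (by omega)
  | s + 1, k + 1, u, hsk, h => by
    obtain ⟨C, hC, h1⟩ := 𝒜.exists_holderB_crep hρ a b (k + 1) 0 hα0 hα1 (δ := weight a b) (by simp)
    have h2 := h1 u (h [] (Nat.zero_le _))
    choose X hX using fun (c : 𝒜.Cx) (j : Fin (n + 1)) =>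
      exists_vfield_const (𝒜.bchart_mem c) (𝒜.bK_compact c) (𝒜.bK_subset c)
        (EuclideanSpace.single j (1 : ℝ))
    have h3 : ∀ c j, 𝒜.MemScriptC k α s (lieDeriv (X c j) u) := fun c j L hL => by
      -- In the fold the last field of the list acts first, so the new field is appended at the end.
      have h4 := h (L ++ [X c j]) (by simpa using hL)
      rw [List.foldr_append, List.length_append, List.length_singleton, Nat.add_sub_add_right] at h4
      exact h4
    choose A hA using fun c j => exists_wHolder_crep hρ hα0 hα1 s k _ (by omega) (h3 c j)
    -- The derivative is reassembled from its partial derivatives as the sum of dx_j ⊗ ∂_j.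
    let P : Fin (n + 1) → Tensor n a b →L[ℝ] EE n →L[ℝ] Tensor n a b := fun j =>
      ContinuousLinearMap.smulRightL ℝ (EE n) (Tensor n a b) (EuclideanSpace.proj j)
    have := Fintype.ofFinite 𝒜.Cx
    let A₀ : 𝒜.Cx → ℝ := fun c => ∑ j, ‖P j‖ * A c j
    set A₁ := C * (𝒜.holderNorm (k + 1) α (weight a b) u).toReal with hA₁
    have hA₁0 : 0 ≤ A₁ := by positivity
    refine ⟨∑ c, |A₀ c| + A₁, fun i => ?_⟩
    have hF : WHolder (𝒜.sc i) s k α (∑ c, |A₀ c|)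
        (fun z => ∑ j, P j (𝒜.crep (lieDeriv (X (𝒜.ci i) j) u) i z)) :=
      (WHolder.sum Finset.univ fun j _ => (hA (𝒜.ci i) j i).clm (P j)).mono (𝒜.sc_pos i)
        ((le_abs_self _).trans (Finset.single_le_sum (f := fun c => |A₀ c|)
          (fun c _ => abs_nonneg _) (Finset.mem_univ (𝒜.ci i))))
    refine hF.of_fderiv (𝒜.sc_pos i) hA₁0 (h2 i).contDiffAt (fun z hz => ?_) fun z hz => ?_
    · simpa using (h2 i).bound z hz 0 (Nat.zero_le _)
    · have hd : DifferentiableAt ℝ (𝒜.crep u i) z :=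
        ((h2 i).contDiffAt z hz).differentiableAt (by simp)
      ext1 v
      rw [_root_.smul_apply, sum_apply, Finset.smul_sum]
      have hv : v = ∑ j, v j • EuclideanSpace.single j (1 : ℝ) := by
        ext l
        simp [Finset.sum_apply, Pi.single_apply]
      conv_lhs => rw [hv, map_sum]
      refine Finset.sum_congr rfl fun j _ => ?_
      rw [map_smul, fderiv_crep_apply hz (hX (𝒜.ci i) j _ (𝒜.mobius_mem_dset i hz)) hd, smul_comm]
      rfl

end MobiusCover

end WAH

end

noncomputable section

namespace WAH

open Filter Topology Function IsManifold

set_option linter.unusedSectionVars false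

/-- Currying as a continuous linear map. -/
def curryT (n a b : ℕ) : Tensor n (a + 1) b →L[ℝ] (EE n →L[ℝ] Tensor n a b) :=
  (continuousMultilinearCurryLeftEquiv ℝ (fun _ : Fin (a + 1) => EE n)
    (ContraTensor n b)).toContinuousLinearEquiv.toContinuousLinearMap

lemma curryT_uncurryT {n a b : ℕ} (f : EE n →L[ℝ] Tensor n a b) :
    curryT n a b (uncurryT n a b f) = f :=
  (continuousMultilinearCurryLeftEquiv ℝ (fun _ : Fin (a + 1) => EE n)
    (ContraTensor n b)).apply_symm_apply f

lemma WJet.of_fderiv {X V : Type*} [NormedAddCommGroup X] [NormedSpace ℝ X]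
    [NormedAddCommGroup V] [NormedSpace ℝ V] {f : X → V} {z : X} {k : ℕ} {A A' : ℝ}
    (hf : ContDiffAt ℝ (k + 1 : ℕ) f z) (h0 : ‖f z‖ ≤ A') (h : WJet 1 0 k A (fderiv ℝ f) z) :
    WJet 1 0 (k + 1) (A + A') f z := by
  have hA := h.nonneg
  have hA' := (norm_nonneg _).trans h0
  refine ⟨hf, fun q hq => ?_⟩
  rw [one_pow, mul_one]
  cases q with
  | zero => rw [norm_iteratedFDeriv_zero]; linarith
  | succ q =>
    rw [← norm_iteratedFDeriv_fderiv]
    have h1 := h.bound q (by omega)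
    rw [one_pow, mul_one] at h1
    linarith

/-! ### Covariant derivatives control partial derivatives -/

namespace MobiusCover

variable {n : ℕ} {Mb : Type*} [TopologicalSpace Mb] [ChartedSpace (EuclideanHalfSpace (n + 1)) Mb]
  {ρ : Mb → ℝ} {𝒜 : MobiusCover n Mb ρ} [IsManifold (𝓡∂ (n + 1)) ∞ Mb] {a b : ℕ}

lemma contDiffAt_cmp_iff {u : TensorField n Mb a b} {i : 𝒜.Ix} {k : ℕ} {z : EE n} :
    ContDiffAt ℝ k (𝒜.crep u i) z ↔ ContDiffAt ℝ k (𝒜.cmp u i) (mobius (𝒜.ctr i) z) :=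
  contDiffAt_comp_mobius_iff (𝒜.sc_pos i)

set_option maxSynthPendingDepth 3 in
-- This is D = ∇ + Γ, the coordinate formula for ∇ solved for the partial derivative.
lemma fderiv_cmp (h : Metric n Mb) {u : TensorField n Mb a b} {i : 𝒜.Ix} {w : EE n}
    {B : (EE n →L[ℝ] EE n →L[ℝ] EE n) →L[ℝ] (Tensor n a b →L[ℝ] (EE n →L[ℝ] Tensor n a b))}
    (hB : ∀ Γ T v, B Γ T v = Tensor.actB n a b (Γ v) T)
    (hw : w ∈ cdom (𝒜.ech i)) (hu : DifferentiableAt ℝ (𝒜.cmp u i) w) :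
    fderiv ℝ (𝒜.cmp u i) w = curryT n a b (𝒜.cmp (covDeriv h u) i w) +
      B (chrisC (h.coeff (cpar (𝒜.ech i))) w) (𝒜.cmp u i w) := by
  have h1 : 𝒜.cmp (covDeriv h u) i w = uncurryT n a b (fderiv ℝ (𝒜.cmp u i) w -
      (𝒜.cmp u i w).actL.comp (chrisC (h.coeff (cpar (𝒜.ech i))) w)) :=
    pullback_covDeriv h (𝒜.bchart_mem _) hw hu (differentiableAt_coeff h)
  have h2 : B (chrisC (h.coeff (cpar (𝒜.ech i))) w) (𝒜.cmp u i w) =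
      (𝒜.cmp u i w).actL.comp (chrisC (h.coeff (cpar (𝒜.ech i))) w) := by
    ext1 v
    rw [hB, Tensor.actB_apply]
    rfl
  rw [h1, curryT_uncurryT, h2, sub_add_cancel]

/-- The covariant derivatives of order `≤ m` control the partial derivatives of order `≤ m`. -/
structure CovBound (𝒜 : MobiusCover n Mb ρ) (h : Metric n Mb) (m : ℕ) (N : ℝ)
    (τ : TensorField n Mb a b) : Prop where
  contDiffAt : ∀ t ≤ m, ∀ i, ∀ z ∈ hypBall n 2,
    ContDiffAt ℝ (m - t : ℕ) (𝒜.cmp (covDerivIter h τ t) i) (mobius (𝒜.ctr i) z)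
  bound : ∀ t ≤ m, ∀ i, ∀ z ∈ hypBall n 2, ‖𝒜.crep (covDerivIter h τ t) i z‖ ≤ N

set_option maxSynthPendingDepth 3 in
-- Induction on the number q of partial derivatives: the derivative of the components of ∇^t τ
-- consists of the components of ∇^(t+1) τ and a bounded multiple of those of ∇^t τ, each then
-- differentiated only q times. Bounds at scale one suffice, hence the trivial weight.
lemma exists_wjet_covDerivIter (h : Metric n Mb) (a b m : ℕ) : ∀ q t : ℕ, q + t ≤ m →
    ∃ C : ℝ, 0 ≤ C ∧ ∀ (τ : TensorField n Mb a b) (N : ℝ), CovBound 𝒜 h m N τ → ∀ i, ∀ z ∈ hypBall n 2,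
      WJet 1 0 q (C * N) (𝒜.cmp (covDerivIter h τ t) i) (mobius (𝒜.ctr i) z)
  | 0, t, ht => ⟨1, zero_le_one, fun τ N hτ i z hz =>
      ⟨(hτ.contDiffAt t (by omega) i z hz).of_le (by exact_mod_cast Nat.zero_le _), fun j hj => by
        obtain rfl := Nat.le_zero.1 hj
        rw [norm_iteratedFDeriv_zero, one_mul, one_pow, mul_one]
        exact hτ.bound t (by omega) i z hz⟩⟩
  | q + 1, t, ht => by
    obtain ⟨C₁, hC₁, h1⟩ := exists_wjet_covDerivIter h a b m q (t + 1) (by omega)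
    obtain ⟨C₂, hC₂, h2⟩ := exists_wjet_covDerivIter h a b m q t (by omega)
    obtain ⟨C₃, hC₃, h3⟩ := exists_uniform_bound
      (f := fun c => chrisC (h.coeff (cpar (𝒜.bchart c)))) (S := 𝒜.dset)
      (fun c => bddJets_christoffel h (𝒜.bchart_mem c) (𝒜.bK_compact c) (𝒜.bK_subset c)) q
    obtain ⟨B, hB⟩ := exists_covBilin (X := EE n) (Tensor.actB n (a + t) b)
    refine ⟨‖curryT n (a + t) b‖ * C₁ + ‖B‖ * 2 ^ q * C₃ * 1 ^ q * C₂ + 1, by positivity,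
      fun τ N hτ i z hz => ?_⟩
    have hc : ContDiffAt ℝ (q + 1 : ℕ) (𝒜.cmp (covDerivIter h τ t) i) (mobius (𝒜.ctr i) z) :=
      (hτ.contDiffAt t (by omega) i z hz).of_le (by exact_mod_cast (by omega : q + 1 ≤ m - t))
    have hev : ∀ᶠ w in 𝓝 (mobius (𝒜.ctr i) z),
        DifferentiableAt ℝ (𝒜.cmp (covDerivIter h τ t) i) w := by
      filter_upwards [eventually_contDiffAt hc] with w hw
      exact hw.differentiableAt (by simp)
    have hd := 𝒜.mobius_mem_dset i hz
    have h4 := (h2 τ N hτ i z hz).bilin (E := 1) (C := C₃) B one_pos le_rfl le_rfl (zero_le_one.trans hC₃)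
      ((bddJets_christoffel h (𝒜.bchart_mem _) (𝒜.bK_compact _) (𝒜.bK_subset _)).contDiffAt_nat hd q)
      (fun j hj => by rw [one_pow, mul_one]; exact h3 _ _ hd j hj)
    have h5 := (((h1 τ N hτ i z hz).clm (curryT n (a + t) b)).add h4).congr
      (g := fderiv ℝ (𝒜.cmp (covDerivIter h τ t) i)) (by
        filter_upwards [hev, cdom_mem_nhds hd.1] with w hw hwc
        exact fderiv_cmp h hB hwc hw)
    have h6 := h5.of_fderiv hc (hτ.bound t (by omega) i z hz)
    refine ⟨h6.contDiffAt, fun j hj => (h6.bound j hj).trans (le_of_eq ?_)⟩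
    ring

lemma exists_jetBound (h : Metric n Mb) (a b m : ℕ) : ∃ C : ℝ, 0 ≤ C ∧
    ∀ (τ : TensorField n Mb a b) (N : ℝ), CovBound 𝒜 h m N τ → 𝒜.JetBound m (C * N) τ := by
  obtain ⟨C, hC, h1⟩ := exists_wjet_covDerivIter (𝒜 := 𝒜) h a b m m 0 le_rfl
  refine ⟨C, hC, fun τ N hτ => ⟨fun i z hz => (h1 τ N hτ i z hz).contDiffAt, fun i z hz q hq => ?_⟩⟩
  have h2 := (h1 τ N hτ i z hz).bound q hq
  rw [one_pow, mul_one] at h2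
  exact h2

/-! ### Membership, the norm estimate and the difference -/

section Main

variable [T2Space Mb] [CompactSpace Mb]

/-- The weight of ∇^t τ is r + t, exactly the exponent in the norm, so its components are bounded by
the t-th summand with no power of the scale. -/
lemma exists_covBound (hρ : IsDefiningFunction n ρ) (h : Metric n Mb) (a b : ℕ) {l m : ℕ} {β : ℝ}
    (hml : m ≤ l) (hβ0 : 0 ≤ β) (hβ1 : β < 1) : ∃ C : ℝ, 0 ≤ C ∧
      ∀ τ : TensorField n Mb a b, 𝒜.MemScriptC l β m τ → 𝒜.scriptNorm h l β m τ ≠ ⊤ →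
        CovBound 𝒜 h m (C * (𝒜.scriptNorm h l β m τ).toReal) τ := by
  choose C hC h1 using fun t : ℕ => 𝒜.exists_norm_crep_le hρ (a + t) b (δ := weight a b + t)
    (by simp [weight]; ring)
  refine ⟨∑ t ∈ Finset.range (m + 1), C t, Finset.sum_nonneg fun t _ => hC t,
    fun τ hτ hfin => ⟨fun t ht i z hz => ?_, fun t ht i z hz => ?_⟩⟩
  -- The bound A, which depends on τ, serves only to prove differentiability and does not enter the
  -- constant.
  · obtain ⟨A, hA⟩ := 𝒜.exists_wHolder_crep hρ hβ0 hβ1 m l τ hml hτ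
    have h2 : 𝒜.RepBound m m A τ := ⟨fun i z hz => ((hA i).wjet z hz).contDiffAt.of_le
      (by exact_mod_cast hml), fun i z hz q hq => ((hA i).wjet z hz).bound q (hq.trans hml)⟩
    obtain ⟨C', -, h3⟩ := exists_repBound_covDerivIter (𝒜 := 𝒜) hρ h a b m m t ht ht
    exact contDiffAt_cmp_iff.1 ((h3 τ A h2).contDiffAt i z hz)
  · have hle : 𝒜.holderNorm (l - t) β (weight a b + t) (covDerivIter h τ t) ≤
        𝒜.scriptNorm h l β m τ := Finset.single_le_sum
      (f := fun t => 𝒜.holderNorm (l - t) β (weight a b + t) (covDerivIter h τ t))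
      (fun _ _ => zero_le) (Finset.mem_range.2 (Nat.lt_succ_of_le ht))
    have h2 := h1 t (l - t) β (covDerivIter h τ t) (ne_top_of_le_ne_top hfin hle) i z hz
    have h3 := ENNReal.toReal_mono hfin hle
    have h4 : C t ≤ ∑ t ∈ Finset.range (m + 1), C t :=
      Finset.single_le_sum (fun t _ => hC t) (Finset.mem_range.2 (Nat.lt_succ_of_le ht))
    exact h2.trans (mul_le_mul h4 h3 ENNReal.toReal_nonneg ((hC t).trans h4))

/-- For orders q ≤ m the factor `sc i` ^ q is precisely the one produced by passing to ball
coordinates, and it cancels. -/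
lemma jetBound_of_wHolder {l m : ℕ} {β A : ℝ} (hml : m ≤ l) {τ : TensorField n Mb a b}
    (hA : ∀ i, WHolder (𝒜.sc i) m l β A (𝒜.crep τ i)) : 𝒜.JetBound m A τ := by
  refine ⟨fun i z hz => contDiffAt_cmp_iff.1
    (((hA i).wjet z hz).contDiffAt.of_le (by exact_mod_cast hml)), fun i z hz q hq => ?_⟩
  have h1 := ((hA i).wjet z hz).bound q (hq.trans hml)
  have h2 : ‖iteratedFDeriv ℝ q (𝒜.crep τ i) z‖ =
      𝒜.sc i ^ q * ‖iteratedFDeriv ℝ q (𝒜.cmp τ i) (mobius (𝒜.ctr i) z)‖ :=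
    norm_iteratedFDeriv_comp_mobius (𝒜.sc_pos i) (𝒜.cmp τ i) q z
  rw [h2, min_eq_left hq, mul_comm A] at h1
  exact le_of_mul_le_mul_left h1 (pow_pos (𝒜.sc_pos i) q)

lemma crep_sub (τ σ : TensorField n Mb a b) (i : 𝒜.Ix) (z : EE n) :
    𝒜.crep (τ - σ) i z = 𝒜.crep τ i z - 𝒜.crep σ i z :=
  map_sub (Tensor.pullL (a := a) (b := b) _ _) _ _

/-- A tensor field with suitable bounds lies in the spaces defined by Lie derivatives. -/
lemma memScriptC_of_repBound (hρ : IsDefiningFunction n ρ) {k m : ℕ} {α : ℝ} (hmk : m ≤ k)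
    (hα0 : 0 ≤ α) (hα1 : α < 1) {u : TensorField n Mb a b} {A : ℝ} (hu : 𝒜.RepBound m (k + 1) A u) :
    𝒜.MemScriptC k α m u := fun X hX => by
  obtain ⟨E, hE1, hE⟩ := 𝒜.exists_sc_le hρ
  obtain ⟨A', h1⟩ := exists_repBound_foldr_lieDeriv hρ hu X hX (by omega)
  obtain ⟨C, hC, h2⟩ := 𝒜.exists_holderNorm_le hρ a b (k - X.length) 0 hα0 hα1 (δ := weight a b)
    (by simp)
  exact (h2 _ _ fun i => (h1.weaken hE1 hE (Nat.zero_le _)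
    (show k - X.length + 1 ≤ k + 1 - X.length by omega)).holderB hα0 hα1 i).1

/-- Each ∇^j u still has bounded components, with one derivative to spare: the order k + 1 in the
hypothesis yields the Hölder seminorm. -/
lemma exists_scriptNorm_le (hρ : IsDefiningFunction n ρ) (h : Metric n Mb) (a b : ℕ) {k m : ℕ} {α : ℝ}
    (hmk : m ≤ k) (hα0 : 0 ≤ α) (hα1 : α < 1) : ∃ C : ℝ, 0 ≤ C ∧
      ∀ (u : TensorField n Mb a b) (A : ℝ), 0 ≤ A → 𝒜.RepBound m (k + 1) A u →
        𝒜.scriptNorm h k α m u ≤ ENNReal.ofReal (C * A) := by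
  obtain ⟨E, hE1, hE⟩ := 𝒜.exists_sc_le hρ
  have key : ∀ j ∈ Finset.range (m + 1), ∃ C : ℝ, 0 ≤ C ∧ ∀ (u : TensorField n Mb a b) (A : ℝ),
      𝒜.RepBound m (k + 1) A u → 𝒜.holderNorm (k - j) α (weight a b + j) (covDerivIter h u j) ≤
        ENNReal.ofReal (C * A) := fun j hj => by
    have hjm : j ≤ m := Nat.lt_succ_iff.1 (Finset.mem_range.1 hj)
    obtain ⟨C₁, hC₁, h1⟩ := exists_repBound_covDerivIter (𝒜 := 𝒜) hρ h a b m (k + 1) j hjm (by omega)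
    obtain ⟨C₂, hC₂, h2⟩ := 𝒜.exists_holderNorm_le hρ (a + j) b (k - j) 0 hα0 hα1
      (δ := weight a b + j) (by simp [weight]; ring)
    have hd := one_le_diamC
    refine ⟨C₂ * (diamC * (E ^ (m - j) * C₁)), by positivity, fun u A hu => ?_⟩
    refine (h2 _ _ fun i => ((h1 u A hu).weaken hE1 hE (Nat.zero_le _)
      (show k - j + 1 ≤ k + 1 - j by omega)).holderB hα0 hα1 i).2.trans (le_of_eq ?_)
    congr 1
    ring
  choose! C hC h1 using key
  refine ⟨∑ j ∈ Finset.range (m + 1), C j, Finset.sum_nonneg hC, fun u A hA hu => ?_⟩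
  rw [Finset.sum_mul, ENNReal.ofReal_sum_of_nonneg fun j hj => mul_nonneg (hC j hj) hA]
  exact Finset.sum_le_sum fun j hj => h1 j hj u A hu

/-- The difference has to be O(`sc i` ^ m) at every order up to l, with the same factor in its
Hölder seminorm. -/
lemma memHolder_whit_sub (hρ : IsDefiningFunction n ρ) {l m : ℕ} {β : ℝ} (hml : m ≤ l)
    (hβ0 : 0 ≤ β) (hβ1 : β < 1) {τ : TensorField n Mb a b} {A : ℝ}
    (hA : ∀ i, WHolder (𝒜.sc i) m l β A (𝒜.crep τ i)) :
    𝒜.MemHolder l β (weight a b + m) (𝒜.whit m τ - τ) := by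
  have hJ := jetBound_of_wHolder hml hA
  obtain ⟨C₁, hC₁, h1⟩ := 𝒜.exists_repBound_whit hρ a b m (l + 1)
  obtain ⟨C₂, hC₂, h2⟩ := 𝒜.exists_whit_sub_self_bound hρ a b m
  obtain ⟨C₃, hC₃, h3⟩ := 𝒜.exists_holderNorm_le hρ a b l m hβ0 hβ1 (δ := weight a b + m) rfl
  have hR := h1 τ A hJ
  have hS := h2 τ A hJ
  refine (h3 _ (C₂ * A + diamC * (C₁ * A) + A) fun i => ?_).1
  have hA0 : 0 ≤ A := ((hA i).wjet _ (basePt_mem_hypBall two_pos)).nonneg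
  have hs : 0 < 𝒜.sc i ^ m := pow_pos (𝒜.sc_pos i) m
  have hd := one_le_diamC
  have hcR : ∀ z ∈ hypBall n 2, ContDiffAt ℝ l (𝒜.crep (𝒜.whit m τ) i) z := fun z hz =>
    (hR.contDiffAt i z hz).of_le (by exact_mod_cast Nat.le_succ l)
  have e : ∀ q ≤ l, ∀ z ∈ hypBall n 2, iteratedFDeriv ℝ q (fun y => 𝒜.crep (𝒜.whit m τ) i y -
      𝒜.crep τ i y) z = iteratedFDeriv ℝ q (𝒜.crep (𝒜.whit m τ) i) z -
        iteratedFDeriv ℝ q (𝒜.crep τ i) z := fun q hq z hz => by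
    have hql : (q : WithTop ℕ∞) ≤ l := by exact_mod_cast hq
    exact iteratedFDeriv_sub_at ((hcR z hz).of_le hql) (((hA i).wjet z hz).contDiffAt.of_le hql)
  have hC₂A : 0 ≤ C₂ * A := by positivity
  have hC₁A : 0 ≤ C₁ * A := by positivity
  have hdC : C₁ * A ≤ diamC * (C₁ * A) := le_mul_of_one_le_left hC₁A hd
  have hD : HolderB l β ((C₂ * A + diamC * (C₁ * A) + A) * 𝒜.sc i ^ m)
      (fun y => 𝒜.crep (𝒜.whit m τ) i y - 𝒜.crep τ i y) := by
    refine ⟨fun z hz => (hcR z hz).sub ((hA i).wjet z hz).contDiffAt, fun z hz q hq => ?_,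
      fun hβ z hz w hw => ?_⟩
    -- Cancellation against the Taylor polynomial is needed only up to order m; beyond it the two
    -- terms are separately of the required size.
    · rcases le_total q m with hqm | hqm
      · refine (hS i z hz q hqm).trans (mul_le_mul_of_nonneg_right ?_ hs.le)
        linarith
      · rw [e q hq z hz]
        have h4 := hR.bound i z hz q (by omega)
        have h5 := ((hA i).wjet z hz).bound q hq
        rw [min_eq_right hqm] at h4 h5
        refine (norm_sub_le _ _).trans ((add_le_add h4 h5).trans ?_)
        rw [← add_mul]
        refine mul_le_mul_of_nonneg_right ?_ hs.le
        linarith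
    -- The regularization is Lipschitz at order l by its bound at order l + 1; τ brings its own
    -- Hölder bound with the factor `sc i` ^ m.
    · have h4 : ‖iteratedFDeriv ℝ l (𝒜.crep (𝒜.whit m τ) i) z -
          iteratedFDeriv ℝ l (𝒜.crep (𝒜.whit m τ) i) w‖ ≤ C₁ * A * 𝒜.sc i ^ m * ‖z - w‖ :=
        norm_iteratedFDeriv_sub_le (hR.contDiffAt i) (fun y hy => by
          have := hR.bound i y hy (l + 1) le_rfl
          rwa [min_eq_right (hml.trans (Nat.le_succ l))] at this) hz hw
      have h5 := (hA i).holder hβ z hz w hw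
      have h6 := norm_sub_le_rpow hβ0 hβ1 hz hw
      have h7 := Real.rpow_nonneg (norm_nonneg (z - w)) β
      rw [e l le_rfl z hz, e l le_rfl w hw, sub_sub_sub_comm]
      calc _ ≤ C₁ * A * 𝒜.sc i ^ m * (diamC * ‖z - w‖ ^ β) + A * 𝒜.sc i ^ m * ‖z - w‖ ^ β :=
            (norm_sub_le _ _).trans (add_le_add (h4.trans (by gcongr)) h5)
        _ = (diamC * (C₁ * A) + A) * 𝒜.sc i ^ m * ‖z - w‖ ^ β := by ring
        _ ≤ _ := by
          refine mul_le_mul_of_nonneg_right (mul_le_mul_of_nonneg_right ?_ hs.le) h7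
          linarith
  exact hD.congr fun z hz => crep_sub _ _ i z

end Main

end MobiusCover

end WAH

end

theorem mainTheorem7 {n : ℕ} (hn : 1 ≤ n)
    {Mb : Type*} [TopologicalSpace Mb] [T2Space Mb] [CompactSpace Mb]
    [ChartedSpace (EuclideanHalfSpace (n + 1)) Mb] [IsManifold (𝓡∂ (n + 1)) ∞ Mb]
    (ρ : Mb → ℝ) (hρ : WAH.IsDefiningFunction n ρ)
    (𝒜 : WAH.MobiusCover n Mb ρ)
    (h : WAH.Metric n Mb) (hunit : WAH.UnitAlongBoundary ρ h)
    (a b l m : ℕ) (β : ℝ) (hml : m ≤ l) (hβ0 : 0 ≤ β) (hβ1 : β < 1) :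
    ∃ R : WAH.TensorField n Mb a b →ₗ[ℝ] WAH.TensorField n Mb a b,
      (∀ τ : WAH.TensorField n Mb a b, 𝒜.MemScriptC l β m τ →
        (∀ (k : ℕ) (α : ℝ), m ≤ k → 0 ≤ α → α < 1 → 𝒜.MemScriptC k α m (R τ)) ∧
        𝒜.MemHolder l β (WAH.weight a b + m) (R τ - τ)) ∧
      (∀ (k : ℕ) (α : ℝ), m ≤ k → 0 ≤ α → α < 1 →
        ∃ C : ℝ≥0, ∀ τ : WAH.TensorField n Mb a b, 𝒜.MemScriptC l β m τ →
          𝒜.scriptNorm h k α m (R τ) ≤ C * 𝒜.scriptNorm h l β m τ) := by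
  obtain ⟨R, hR⟩ := 𝒜.exists_whit_linear a b m
  -- The center is the image of the base point of the ball, so a jet bound puts τ in the subspace on
  -- which R is the regularization.
  have hlin : ∀ τ (N : ℝ), 𝒜.JetBound m N τ → R τ = 𝒜.whit m τ := fun τ N hτ => hR τ fun i => by
    have h1 := hτ.contDiffAt i _ (WAH.basePt_mem_hypBall two_pos)
    rwa [WAH.mobius_basePt_self] at h1
  refine ⟨R, fun τ hτ => ?_, fun k α hmk hα0 hα1 => ?_⟩
  · obtain ⟨A, hA⟩ := 𝒜.exists_wHolder_crep hρ hβ0 hβ1 m l τ hml hτ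
    have hJ := WAH.MobiusCover.jetBound_of_wHolder hml hA
    rw [hlin τ A hJ]
    refine ⟨fun k α hmk hα0 hα1 => ?_, WAH.MobiusCover.memHolder_whit_sub hρ hml hβ0 hβ1 hA⟩
    obtain ⟨C, -, h1⟩ := 𝒜.exists_repBound_whit hρ a b m (k + 1)
    exact WAH.MobiusCover.memScriptC_of_repBound hρ hmk hα0 hα1 (h1 τ A hJ)
  · obtain ⟨C₁, hC₁, h1⟩ := WAH.MobiusCover.exists_covBound (𝒜 := 𝒜) hρ h a b hml hβ0 hβ1
    obtain ⟨C₂, hC₂, h2⟩ := WAH.MobiusCover.exists_jetBound (𝒜 := 𝒜) h a b m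
    obtain ⟨C₃, hC₃, h3⟩ := 𝒜.exists_repBound_whit hρ a b m (k + 1)
    obtain ⟨C₄, hC₄, h4⟩ := WAH.MobiusCover.exists_scriptNorm_le (𝒜 := 𝒜) hρ h a b hmk hα0 hα1
    -- The added 1 makes the constant positive, so the right-hand side is infinite whenever the norm
    -- of τ is.
    have hK : 0 < C₄ * C₃ * C₂ * C₁ + 1 := by positivity
    refine ⟨(C₄ * C₃ * C₂ * C₁ + 1).toNNReal, fun τ hτ => ?_⟩
    change _ ≤ ENNReal.ofReal _ * _
    by_cases hfin : 𝒜.scriptNorm h l β m τ = ⊤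
    · rw [hfin, ENNReal.mul_top (ENNReal.ofReal_pos.2 hK).ne']
      exact le_top
    -- Here the jet bound comes from the norm through covariant derivatives, so the constant is
    -- independent of τ, in contrast to the bound used for membership.
    · have hJ := h2 τ _ (h1 τ hτ hfin)
      rw [hlin τ _ hJ]
      refine (h4 (𝒜.whit m τ) _ (by positivity) (h3 τ _ hJ)).trans ?_
      conv_rhs => rw [← ENNReal.ofReal_toReal hfin, ← ENNReal.ofReal_mul hK.le]
      refine ENNReal.ofReal_le_ofReal ?_
      have hN : 0 ≤ (𝒜.scriptNorm h l β m τ).toReal := ENNReal.toReal_nonneg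
      linarith
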